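/- Let $n\ge 1$, $a_1,\dots,a_n>0$, $X_1,\dots,X_n>0$, $T>0$, $\Omega=(0,X_1)\times\dots\times(0,X_n)$, $Q_T=\Omega\times(0,T)$. Let $u\in C^6(\bar Q_T)$ solve $$\partial_t^2u-\sum_{i=1}^n a_i^2\partial_i^2u=f \text{ in } Q_T,\quad u=g \text{ on } \partial\Omega\times(0,T),\quad u|_{t=0}=u_0,\ \ \partial_tu|_{t=0}=u_1 \text{ in } \Omega,$$ with data $f,g,u_0,u_1$ continuous on $\bar Q_T$, $\partial\Omega\times[0,T]$, $\bar\Omega$, $\bar\Omega$, respectively. *Mesh.* For integers $N_i\ge1$, $M\ge2$ let $h_i=X_i/N_i$, $h=(h_1,\dots,h_n)$, $|h|=(\sum_i h_i^2)^{1/2}$, $h_t=T/M$, $t_m=mh_t$, $x_k=(k_1h_1,\dots,k_nh_n)$; $\bar\omega_h=\{x_k: 0\le k_i\le N_i\}$, $\omega_h=\{x_k:1\le k_i\le N_i-1\}$, $\partial\omega_h=\bar\omega_h\setminus\omega_h$. Put $y^m=y(t_m)$, $\delta_ty^m=(y^{m+1}-y^m)/h_t$, $\bar\delta_ty^m=(y^m-y^{m-1})/h_t$,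 $\bar s_ty^m=(y^{m-1}+y^m)/2$, $\Lambda_ty^m=(y^{m+1}-2y^m+y^{m-1})/h_t^2$, $(\Lambda_lw)_k=(w_{k+e_l}-2w_k+w_{k-e_l})/h_l^2$, $(v,w)_h=h_1\cdots h_n\sum_{x_k\in\omega_h}v_kw_k$, and $\|w\|_B=(Bw,w)_h^{1/2}$ for mesh functions $w$ vanishing on $\partial\omega_h$. *Operators.* $s_N=I+\frac1{12}\sum_ih_i^2\Lambda_i$, $s_{N\hat j}=I+\frac1{12}\sum_{i\ne j}h_i^2\Lambda_i$, $A_N=-\sum_ia_i^2s_{N\hat i}\Lambda_i$, $s_{kN}=I+\frac1{12}h_k^2\Lambda_k$, $\bar s_N=\prod_ks_{kN}$, $\bar s_{N\hat l}=\prod_{k\ne l}s_{kN}$, $\bar A_N=-\sum_ia_i^2\bar s_{N\hat i}\Lambda_i$, $\bar B_N=\prod_k\big(s_{kN}-\frac1{12}h_t^2a_k^2\Lambda_k\big)$, and $$R=\sum_{S\subseteq\{1,\dots,n\},\,|S|\ge2}\Big(\frac{h_t^2}{12}\Big)^{|S|}\Big(\prod_{i\in S}a_i^2\Big)\Big(\prod_{l\notin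 S}s_{lN}\Big)\prod_{i\in S}(-\Lambda_i).$$ *Schemes.* Each scheme has the form $$P\Lambda_tv^m+Av^m=f_N^m \text{ on } \omega_h\ (1\le m\le M-1),\quad v^m=g(\cdot,t_m) \text{ on } \partial\omega_h\ (1\le m\le M),$$ $$P\delta_tv^0+\tfrac12h_tAv^0=u_{1N}+\tfrac12h_tf_N^0 \text{ on } \omega_h,$$ where $f_N^m=\big(f+\frac1{12}h_t^2\Lambda_tf+\frac1{12}\sum_ih_i^2\Lambda_if\big)^m$ for $m\ge1$, $u_{1N}=\big(s_N+\frac1{12}h_t^2\sum_ia_i^2\Lambda_i\big)u_1$, $f_N^0=f_{dh_t}^{(0)}+\frac1{12}\sum_ih_i^2\Lambda_if|_{t=0}$, and $f_{dh_t}^{(0)}$ is any mesh function with $\big|f_{dh_t}^{(0)}-\big(f+\frac13h_t\partial_tf+\frac1{12}h_t^2\partial_t^2f\big)\big|_{t=0}\big|\le Kh_t^3$ on $\omega_h$, $K$ being independent of the mesh. The schemes, with the operators $(B_h,A_h)$ of their energy norms and a constant $C_0$, are: 1. $n=2$: $P=s_N+\frac1{12}h_t^2A_N$, $A=A_N$;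 $(B_h,A_h)=(s_N,A_N)$, $C_0=\frac43$; 2. $n=3$: $P=\bar s_N+\frac1{12}h_t^2A_N$, $A=A_N$; $(B_h,A_h)=(\bar s_N,A_N)$, $C_0=1$; 3. $n\ge1$: $P=\bar s_N+\frac1{12}h_t^2\bar A_N$, $A=\bar A_N$; $(B_h,A_h)=(\bar s_N,\bar A_N)$, $C_0=1$; for $n=1$ this is the scheme with $P=I+\frac1{12}(h_1^2-a_1^2h_t^2)\Lambda_1$, $A=-a_1^2\Lambda_1$; 4. $n\ge2$: $P=\bar B_N$, $A=\bar A_N$; $(B_h,A_h)=(\bar s_N+R,\bar A_N)$, $C_0=1$. **Claim.** Let $0<\varepsilon_0<1$. For each of these schemes there is a constant $C$, independent of the mesh (it may depend on $n$, $a_i$, $X_i$, $T$, $u$, $\varepsilon_0$, $K$), such that for all meshes with $$C_0h_t^2\sum_{i=1}^n\frac{a_i^2}{h_i^2}\le1-\varepsilon_0^2$$ and every solution $v$ of the scheme with $v^0=u_0$ on $\bar\omega_h$, $$\max_{1\le m\le M}\Big[\varepsilon_0^2\|\bar\delta_t(u-v)^m\|_{B_h}^2+\|\bar s_t(u-v)^m\|_{A_h}^2\Big]^{1/2}\le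 C|h|^4 .$$ -/

import Mathlib

open scoped BigOperators

namespace CompactWave

noncomputable section

/-! ### Meshes and mesh functions

A node of the spatial mesh is addressed by its multi-index `k : Fin n → ℤ`. Mesh functions are
functions of the multi-index; only their values at the nodes of the closed mesh
`0 ≤ k ≤ N` are ever used below (each difference operator acts at most once in each direction
and the results are evaluated at internal nodes only). -/

/-- Mesh functions of the multi-index. -/
abbrev MeshFn (n : ℕ) : Type := (Fin n → ℤ) → ℝ

/-- Spatial steps `h_i = X_i / N_i`. -/
def steps {n : ℕ} (X : Fin n → ℝ) (N : Fin n → ℕ) : Fin n → ℝ := fun i => X i / (N i : ℝ)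

/-- The node `x_k = (k_1 h_1, …, k_n h_n)`. -/
def node {n : ℕ} (h : Fin n → ℝ) (k : Fin n → ℤ) : Fin n → ℝ := fun i => (k i : ℝ) * h i

/-- Multi-indices of the closed mesh: `0 ≤ k_i ≤ N_i`. -/
def closedMesh {n : ℕ} (N : Fin n → ℕ) : Finset (Fin n → ℤ) :=
  Finset.Icc (fun _ => 0) (fun i => (N i : ℤ))

/-- Multi-indices of the internal mesh: `1 ≤ k_i ≤ N_i - 1`. -/
def innerMesh {n : ℕ} (N : Fin n → ℕ) : Finset (Fin n → ℤ) :=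
  Finset.Icc (fun _ => 1) (fun i => (N i : ℤ) - 1)

/-- Multi-indices of the boundary of the mesh. -/
def boundaryMesh {n : ℕ} (N : Fin n → ℕ) : Finset (Fin n → ℤ) :=
  closedMesh N \ innerMesh N

/-- The Euclidean length `|h|` of the vector of steps. -/
def stepLength {n : ℕ} (h : Fin n → ℝ) : ℝ := Real.sqrt (∑ i, h i ^ 2)

/-- Restriction of a function of `x` to the mesh. -/
def onMesh {n : ℕ} (h : Fin n → ℝ) (w : (Fin n → ℝ) → ℝ) : MeshFn n := fun k => w (node h k)

/-- Restriction of a function of `(x, t)` to the space-time mesh, `t_m = m h_t`. -/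
def onMeshT {n : ℕ} (h : Fin n → ℝ) (ht : ℝ) (w : (Fin n → ℝ) → ℝ → ℝ) : ℕ → MeshFn n :=
  fun m k => w (node h k) ((m : ℝ) * ht)

/-! ### Difference operators in time -/

/-- `δ_t y = (ŷ - y) / h_t`. -/
def deltaT {n : ℕ} (ht : ℝ) (y : ℕ → MeshFn n) (m : ℕ) : MeshFn n :=
  fun k => (y (m + 1) k - y m k) / ht

/-- `δ̄_t y = (y - y̌) / h_t`, used for `m ≥ 1`. -/
def deltaBarT {n : ℕ} (ht : ℝ) (y : ℕ → MeshFn n) (m : ℕ) : MeshFn n :=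
  fun k => (y m k - y (m - 1) k) / ht

/-- `s̄_t y = (y̌ + y) / 2`, used for `m ≥ 1`. -/
def sBarT {n : ℕ} (y : ℕ → MeshFn n) (m : ℕ) : MeshFn n :=
  fun k => (y (m - 1) k + y m k) / 2

/-- `Λ_t y = (ŷ - 2 y + y̌) / h_t²`, used for `m ≥ 1`. -/
def lamT {n : ℕ} (ht : ℝ) (y : ℕ → MeshFn n) (m : ℕ) : MeshFn n :=
  fun k => (y (m + 1) k - 2 * y m k + y (m - 1) k) / ht ^ 2

/-! ### Difference operators in space -/

/-- Linear operators on mesh functions. -/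
abbrev MeshOp (n : ℕ) : Type := Module.End ℝ (MeshFn n)

/-- `(Λ_l w)_k = (w_{k + e_l} - 2 w_k + w_{k - e_l}) / h_l²`. -/
def lam {n : ℕ} (h : Fin n → ℝ) (l : Fin n) : MeshOp n where
  toFun w := fun k => (w (k + Pi.single l 1) - 2 * w k + w (k - Pi.single l 1)) / h l ^ 2
  map_add' v w := by
    funext k
    simp only [Pi.add_apply]
    ring
  map_smul' c w := by
    funext k
    simp only [Pi.smul_apply, smul_eq_mul, RingHom.id_apply]
    ring

/-- The product, in increasing order of the indices, of the operators `F l` with `l ∈ S`. -/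
def opProd {n : ℕ} (S : Finset (Fin n)) (F : Fin n → MeshOp n) : MeshOp n :=
  ((List.finRange n).map fun l => if l ∈ S then F l else 1).prod

/-- `s_N = I + (1/12) ∑_i h_i² Λ_i`. -/
def sN {n : ℕ} (h : Fin n → ℝ) : MeshOp n :=
  1 + ∑ i, (h i ^ 2 / 12) • lam h i

/-- `s_{N ĵ} = I + (1/12) ∑_{i ≠ j} h_i² Λ_i`. -/
def sNhat {n : ℕ} (h : Fin n → ℝ) (j : Fin n) : MeshOp n :=
  1 + ∑ i ∈ Finset.univ.erase j, (h i ^ 2 / 12) • lam h i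

/-- `A_N = - ∑_i a_i² s_{N î} Λ_i`. -/
def opAN {n : ℕ} (a h : Fin n → ℝ) : MeshOp n :=
  -∑ i, a i ^ 2 • (sNhat h i * lam h i)

/-- `s_{kN} = I + (1/12) h_k² Λ_k`. -/
def s1N {n : ℕ} (h : Fin n → ℝ) (k : Fin n) : MeshOp n :=
  1 + (h k ^ 2 / 12) • lam h k

/-- `s̄_N = ∏_k s_{kN}`. -/
def sBarN {n : ℕ} (h : Fin n → ℝ) : MeshOp n := opProd Finset.univ (s1N h)

/-- `s̄_{N l̂} = ∏_{k ≠ l} s_{kN}`. -/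
def sBarNhat {n : ℕ} (h : Fin n → ℝ) (l : Fin n) : MeshOp n :=
  opProd (Finset.univ.erase l) (s1N h)

/-- `Ā_N = - ∑_i a_i² s̄_{N î} Λ_i`. -/
def opABarN {n : ℕ} (a h : Fin n → ℝ) : MeshOp n :=
  -∑ i, a i ^ 2 • (sBarNhat h i * lam h i)

/-- `B_{kN} = s_{kN} - (1/12) h_t² a_k² Λ_k`. -/
def opB1N {n : ℕ} (a h : Fin n → ℝ) (ht : ℝ) (k : Fin n) : MeshOp n :=
  s1N h k - (ht ^ 2 / 12 * a k ^ 2) • lam h k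

/-- The splitting operator `B̄_N = B_{1N} ⋯ B_{nN}`. -/
def opBBarN {n : ℕ} (a h : Fin n → ℝ) (ht : ℝ) : MeshOp n := opProd Finset.univ (opB1N a h ht)

/-- The operator `R`: the sum, over the sets `S` of at least two indices, of
`(h_t²/12)^{|S|} (∏_{i ∈ S} a_i²) (∏_{l ∉ S} s_{lN}) ∏_{i ∈ S} (-Λ_i)`. -/
def opR {n : ℕ} (a h : Fin n → ℝ) (ht : ℝ) : MeshOp n :=
  ∑ S ∈ (Finset.univ : Finset (Finset (Fin n))).filter (fun S => 2 ≤ S.card),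
    ((ht ^ 2 / 12) ^ S.card * ∏ i ∈ S, a i ^ 2) •
      (opProd Sᶜ (s1N h) * opProd S (fun i => -lam h i))

/-! ### The mesh inner product and the norms generated by operators

They are applied to mesh functions that vanish on the boundary of the mesh. -/

/-- `(v, w)_h = h_1 ⋯ h_n ∑_{internal nodes} v_k w_k`. -/
def meshInner {n : ℕ} (h : Fin n → ℝ) (N : Fin n → ℕ) (v w : MeshFn n) : ℝ :=
  (∏ i, h i) * ∑ k ∈ innerMesh N, v k * w k

/-- `‖w‖_B = (B w, w)_h^{1/2}`. -/
def opNorm {n : ℕ} (h : Fin n → ℝ) (N : Fin n → ℕ) (B : MeshOp n) (w : MeshFn n) : ℝ :=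
  Real.sqrt (meshInner h N (B w) w)

/-! ### The schemes -/

/-- The compact schemes. Writing the equations of a scheme as `P Λ_t v + A v = f_N` and
`P δ_t v⁰ + (h_t/2) A v⁰ = u_{1N} + (h_t/2) f_N⁰`, they are
* `oneDim`: `P = I + (1/12)(h_1² - a_1² h_t²) Λ_1`, `A = -a_1² Λ_1`, for `n = 1`;
* `plain`: `P = s_N + (1/12) h_t² A_N`, `A = A_N`, for `n = 2`;
* `mixed`: `P = s̄_N + (1/12) h_t² A_N`, `A = A_N`, for `n = 3`;
* `product`: `P = s̄_N + (1/12) h_t² Ā_N`, `A = Ā_N`, for `n ≥ 1`;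
* `splitting`: `P = B̄_N`, `A = Ā_N`, for `n ≥ 2`. -/
inductive Scheme
  | oneDim
  | plain
  | mixed
  | product
  | splitting

/-- The dimensions in which the scheme is considered. -/
def Scheme.Admissible : Scheme → ℕ → Prop
  | .oneDim, n => n = 1
  | .plain, n => n = 2
  | .mixed, n => n = 3
  | .product, n => 1 ≤ n
  | .splitting, n => 2 ≤ n

/-- The constant `C_0` in the step condition. -/
def Scheme.C0 : Scheme → ℝ
  | .plain => 4 / 3
  | _ => 1

/-- The operator `P` at the upper time level. -/
def Scheme.opP {n : ℕ} (a h : Fin n → ℝ) (ht : ℝ) : Scheme → MeshOp n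
  | .oneDim => 1 + ∑ i, ((h i ^ 2 - a i ^ 2 * ht ^ 2) / 12) • lam h i
  | .plain => sN h + (ht ^ 2 / 12) • opAN a h
  | .mixed => sBarN h + (ht ^ 2 / 12) • opAN a h
  | .product => sBarN h + (ht ^ 2 / 12) • opABarN a h
  | .splitting => opBBarN a h ht

/-- The operator `A` in the equations of the scheme. -/
def Scheme.opA {n : ℕ} (a h : Fin n → ℝ) : Scheme → MeshOp n
  | .oneDim => -∑ i, a i ^ 2 • lam h i
  | .plain => opAN a h
  | .mixed => opAN a h
  | .product => opABarN a h
  | .splitting => opABarN a h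

/-- The operator `B_h` of the energy norm. -/
def Scheme.normB {n : ℕ} (a h : Fin n → ℝ) (ht : ℝ) : Scheme → MeshOp n
  | .oneDim => sBarN h
  | .plain => sN h
  | .mixed => sBarN h
  | .product => sBarN h
  | .splitting => sBarN h + opR a h ht

/-- The operator `A_h` of the energy norm. -/
def Scheme.normA {n : ℕ} (a h : Fin n → ℝ) : Scheme → MeshOp n
  | .oneDim => opABarN a h
  | .plain => opAN a h
  | .mixed => opAN a h
  | .product => opABarN a h
  | .splitting => opABarN a h

/-- `f_N = f + (1/12) h_t² Λ_t f + (1/12) ∑_i h_i² Λ_i f` at the time level `t_m`, `m ≥ 1`. -/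
def rhsN {n : ℕ} (h : Fin n → ℝ) (ht : ℝ) (f : (Fin n → ℝ) → ℝ → ℝ) (m : ℕ) : MeshFn n :=
  onMeshT h ht f m + (ht ^ 2 / 12) • lamT ht (onMeshT h ht f) m
    + ∑ i, (h i ^ 2 / 12) • lam h i (onMeshT h ht f m)

/-- `u_{1N} = (s_N + (1/12) h_t² ∑_i a_i² Λ_i) u_1`. -/
def initN {n : ℕ} (a h : Fin n → ℝ) (ht : ℝ) (u₁ : (Fin n → ℝ) → ℝ) : MeshFn n :=
  (sN h + (ht ^ 2 / 12) • ∑ i, a i ^ 2 • lam h i) (onMesh h u₁)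

/-- `f_d^{(0)} = f_0 + (1/3) h_t (∂_t f)_0 + (1/12) h_t² (∂_t² f)_0`, with one-sided time
derivatives at `t = 0`. -/
def fD0 {n : ℕ} (T ht : ℝ) (f : (Fin n → ℝ) → ℝ → ℝ) (x : Fin n → ℝ) : ℝ :=
  f x 0 + ht / 3 * derivWithin (f x) (Set.Icc 0 T) 0
    + ht ^ 2 / 12 * iteratedDerivWithin 2 (f x) (Set.Icc 0 T) 0

/-- `f_N⁰ = f_{dh_t}^{(0)} + (1/12) ∑_i h_i² Λ_i f⁰`, where the mesh function `fd` is the chosen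
approximation `f_{dh_t}^{(0)}` of `f_d^{(0)}`. -/
def rhsN0 {n : ℕ} (h : Fin n → ℝ) (f : (Fin n → ℝ) → ℝ → ℝ) (fd : MeshFn n) : MeshFn n :=
  fd + ∑ i, (h i ^ 2 / 12) • lam h i (onMesh h (fun x => f x 0))

/-- `v` satisfies the equations of the scheme: the equation at internal nodes for
`1 ≤ m ≤ M - 1`, the boundary condition `v = g` for `1 ≤ m ≤ M`, and the equation at the initial
time level. -/
structure Scheme.IsSolution {n : ℕ} (S : Scheme) (a h : Fin n → ℝ) (ht : ℝ)
    (N : Fin n → ℕ) (M : ℕ) (f g : (Fin n → ℝ) → ℝ → ℝ) (u₁ : (Fin n → ℝ) → ℝ)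
    (fd : MeshFn n) (v : ℕ → MeshFn n) : Prop where
  eqn : ∀ m : ℕ, 1 ≤ m → m + 1 ≤ M → ∀ k ∈ innerMesh N,
    S.opP a h ht (lamT ht v m) k + S.opA a h (v m) k = rhsN h ht f m k
  boundary : ∀ m : ℕ, 1 ≤ m → m ≤ M → ∀ k ∈ boundaryMesh N,
    v m k = g (node h k) ((m : ℝ) * ht)
  initial : ∀ k ∈ innerMesh N,
    S.opP a h ht (deltaT ht v 0) k + ht / 2 * S.opA a h (v 0) k
      = initN a h ht u₁ k + ht / 2 * rhsN0 h f fd k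

/-! ### The initial-boundary value problem -/

/-- The open box `Ω = (0, X_1) × ⋯ × (0, X_n)`. -/
def box {n : ℕ} (X : Fin n → ℝ) : Set (Fin n → ℝ) := Set.univ.pi fun i => Set.Ioo 0 (X i)

/-- The closed box. -/
def closedBox {n : ℕ} (X : Fin n → ℝ) : Set (Fin n → ℝ) := Set.univ.pi fun i => Set.Icc 0 (X i)

/-- `u` solves `∂_t² u - ∑_i a_i² ∂_i² u = f` in `Ω × (0, T)`, `u = g` on `∂Ω × (0, T)`,
`u = u₀` and `∂_t u = u₁` at `t = 0` in `Ω`. It is used for functions `u` that are smooth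
in the closed cylinder, so that all the derivatives exist. -/
structure IsIBVPSolution {n : ℕ} (a X : Fin n → ℝ) (T : ℝ) (f g : (Fin n → ℝ) → ℝ → ℝ)
    (u₀ u₁ : (Fin n → ℝ) → ℝ) (u : (Fin n → ℝ) → ℝ → ℝ) : Prop where
  pde : ∀ x ∈ box X, ∀ t ∈ Set.Ioo 0 T,
    iteratedDeriv 2 (u x) t
      - ∑ i, a i ^ 2 * iteratedDeriv 2 (fun s => u (Function.update x i s) t) (x i) = f x t
  boundary : ∀ x ∈ frontier (box X), ∀ t ∈ Set.Ioo 0 T, u x t = g x t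
  initial : ∀ x ∈ box X, u x 0 = u₀ x
  initialVelocity : ∀ x ∈ box X, derivWithin (u x) (Set.Icc 0 T) 0 = u₁ x

end

end CompactWave

namespace CompactWave

noncomputable section

open Set Function

/-! ### The Taylor formula with a bounded remainder -/

/-! The error bound is stability plus consistency.

Stability. The operators `Λ_l` commute, so all operators involved are real polynomials in them,
their symbols. Every scheme, the factorized one after multiplying out its product, satisfies `P =
B_h + (h_t²/12) A_h`, that is, `P = D + (h_t²/4) A_h` with `D = B_h - (h_t²/6) A_h`. Testing the
error equation with `e^{m+1} - e^{m-1}` shows that the energy `(D δ̄_t e, δ̄_t e) + (A_h s̄_t e,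
s̄_t e)` changes only through the residual: if `D ≥ c²`, its square root grows in one step by at
most `h_t / c` times the norm of the residual (`energy_le`). On functions that vanish on the
boundary the `Λ_l` are symmetric and their joint eigenvalues satisfy `-4 ≤ h_l² γ_l ≤ 0`, so an
inequality of symbols on this box gives the inequality of operators (`inner_polyInner_nonneg`). The
decisive one is `A_h ≤ 6 C_0 (∑ a_i² / h_i²) B_h` (`Scheme.eval_aPoly_le`); with the step condition
it yields `D ≥ ε_0² B_h`, while `B_h ≥ 3^{-n}`. Passing to zero boundary values is legitimate
because no direction occurs twice in a monomial (`compatible`).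

Consistency. By continuity `f` is the wave operator of `u` up to the boundary, so the residual of
`u` is an expression in difference quotients and derivatives of `u` alone. It regroups
(`residual_identity`, `initial_residual_identity`) into brackets that are of fourth order and cost
at most six derivatives. The operators of the individual schemes differ from a common part by
products of several `c_l Λ_l` with `|c_l| ≤ h_l²` (`abs_prod_remainder_le`): two factors provide the
fourth order and act on a smooth function, the others are merely bounded. The terms with `h_t²` fit
in because the step condition contains `h_t a_l ≤ h_l`, which also makes `h_t` of the order of
`|h|`. -/

theorem taylor_remainder_le {s : Set ℝ} (hs : Convex ℝ s) {C : ℝ} (k : ℕ) :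
    ∀ φ : ℕ → ℝ → ℝ,
      (∀ j < k, ∀ r ∈ s, HasDerivWithinAt (φ j) (φ (j + 1) r) s r) →
      (∀ r ∈ s, |φ k r| ≤ C) → ∀ x ∈ s, ∀ y ∈ s,
      |φ 0 y - ∑ j ∈ Finset.range k, φ j x * (y - x) ^ j / (j.factorial : ℝ)|
        ≤ C * |y - x| ^ k := by
  induction k with
  | zero =>
    intro φ _ hC x _ y hy
    simpa using hC y hy
  | succ k ih =>
    intro φ hφ hC x hx y hy
    have hsub : uIcc x y ⊆ s := by
      rw [← segment_eq_uIcc]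
      exact hs.segment_subset hx hy
    have ih' := ih (fun j => φ (j + 1)) (fun j hj => hφ (j + 1) (by omega)) hC x hx
    -- The derivative of the remainder of `φ 0` of order `k + 1` is the remainder of `φ 1` of order
    -- `k`, bounded by induction; the mean value inequality then adds one power of `|y - x|`.
    have hder : ∀ r ∈ uIcc x y, HasDerivWithinAt
        (fun r => φ 0 r - ∑ j ∈ Finset.range (k + 1), φ j x * (r - x) ^ j / (j.factorial : ℝ))
        (φ 1 r - ∑ j ∈ Finset.range k, φ (j + 1) x * (r - x) ^ j / (j.factorial : ℝ))
        (uIcc x y) r := by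
      intro r hr
      refine ((hφ 0 (by omega) r (hsub hr)).mono hsub).sub ?_
      simp only [Finset.sum_range_succ']
      simp only [pow_zero, mul_one, Nat.factorial_zero, Nat.cast_one, div_one]
      refine HasDerivWithinAt.add_const _ ?_
      refine HasDerivWithinAt.fun_sum fun j _ => ?_
      have h1 : HasDerivWithinAt (fun r : ℝ => (r - x) ^ (j + 1))
          (((j + 1 : ℕ) : ℝ) * (r - x) ^ j * 1) (uIcc x y) r := by
        simpa using (((hasDerivAt_id' r).sub_const x).fun_pow (j + 1)).hasDerivWithinAt
      have h2 := (h1.const_mul (φ (j + 1) x)).div_const ((j + 1).factorial : ℝ)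
      refine h2.congr_deriv ?_
      have : (j.factorial : ℝ) ≠ 0 := by positivity
      rw [Nat.factorial_succ]
      push_cast
      field_simp
    have hbd : ∀ r ∈ uIcc x y,
        ‖φ 1 r - ∑ j ∈ Finset.range k, φ (j + 1) x * (r - x) ^ j / (j.factorial : ℝ)‖
          ≤ C * |y - x| ^ k := by
      intro r hr
      have hC0 : 0 ≤ C := (abs_nonneg _).trans (hC x hx)
      refine (ih' r (hsub hr)).trans ?_
      have : |r - x| ≤ |y - x| := abs_sub_left_of_mem_uIcc hr
      gcongr
    have hmv := Convex.norm_image_sub_le_of_norm_hasDerivWithin_le hder hbd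
      (convex_uIcc x y) left_mem_uIcc right_mem_uIcc
    have hx0 : φ 0 x - ∑ j ∈ Finset.range (k + 1), φ j x * (x - x) ^ j / (j.factorial : ℝ)
        = 0 := by
      simp [Finset.sum_range_succ']
    simp only [hx0, sub_zero, Real.norm_eq_abs] at hmv
    rw [pow_succ, ← mul_assoc]
    exact hmv

/-! ### Partial derivatives and second differences in a coordinate box -/

variable {ι : Type*}

/-- The points of the box `∏ [0, Y d]` that remain in it after a shift by at most `η d` in any
of the directions `d ∈ J`. -/
def region (Y η : ι → ℝ) (J : Finset ι) : Set (ι → ℝ) :=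
  {p | ∀ d, p d ∈ Icc 0 (Y d) ∧ (d ∈ J → p d ∈ Icc (η d) (Y d - η d))}

/-- The closed coordinate box. -/
def cbox (Y : ι → ℝ) : Set (ι → ℝ) := univ.pi fun d => Icc 0 (Y d)

variable {Y η : ι → ℝ} {C : ℝ}

theorem region_empty : region Y η ∅ = cbox Y := by
  ext p; simp [region, cbox, Pi.le_def, forall_and]

theorem region_subset_cbox (J : Finset ι) : region Y η J ⊆ cbox Y :=
  fun _ hp d _ => (hp d).1

theorem region_anti {J J' : Finset ι} (h : J ⊆ J') : region Y η J' ⊆ region Y η J :=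
  fun _ hp d => ⟨(hp d).1, fun hd => (hp d).2 (h hd)⟩

variable [DecidableEq ι]

/-- `w'` is the partial derivative of `w` in the direction `d` at the points of `s`, one-sided at
the faces of the box. -/
def HasPartial (Y : ι → ℝ) (d : ι) (s : Set (ι → ℝ)) (w w' : (ι → ℝ) → ℝ) : Prop :=
  ∀ p ∈ s, HasDerivWithinAt (fun r => w (update p d r)) (w' p) (Icc 0 (Y d)) (p d)

/-- The partial derivative in the direction `d`, one-sided at the faces of the box. -/
def partialD (Y : ι → ℝ) (d : ι) (w : (ι → ℝ) → ℝ) : (ι → ℝ) → ℝ :=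
  fun p => derivWithin (fun r => w (update p d r)) (Icc 0 (Y d)) (p d)

/-- The partial derivatives of `w` of orders at most `k` exist and are bounded by `C`. -/
def Jet (Y : ι → ℝ) (C : ℝ) : ℕ → ((ι → ℝ) → ℝ) → Prop
  | 0, w => ∀ p ∈ cbox Y, |w p| ≤ C
  | k + 1, w => (∀ p ∈ cbox Y, |w p| ≤ C) ∧
      ∀ d, HasPartial Y d (cbox Y) w (partialD Y d w) ∧ Jet Y C k (partialD Y d w)

/-- The second difference quotient in the direction `d`. -/
def sd (η : ι → ℝ) (d : ι) (w : (ι → ℝ) → ℝ) : (ι → ℝ) → ℝ :=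
  fun p => (w (update p d (p d + η d)) - 2 * w p + w (update p d (p d - η d))) / η d ^ 2

/-- The forward difference quotient in the direction `d`. -/
def fdq (η : ι → ℝ) (d : ι) (w : (ι → ℝ) → ℝ) : (ι → ℝ) → ℝ :=
  fun p => (w (update p d (p d + η d)) - w p) / η d

/-- The composition of the second difference quotients in the directions of a list. -/
def sdL (η : ι → ℝ) (l : List ι) (w : (ι → ℝ) → ℝ) : (ι → ℝ) → ℝ := l.foldr (sd η) w

theorem update_mem_region {J : Finset ι} {d : ι} (hd : d ∉ J) {p : ι → ℝ}
    (hp : p ∈ region Y η J) {r : ℝ} (hr : r ∈ Icc 0 (Y d)) : update p d r ∈ region Y η J := by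
  intro e
  by_cases he : e = d
  · subst he
    simpa [hd] using hr
  · simpa [he] using hp e

theorem region_insert_step {J : Finset ι} {d : ι} (hη : ∀ d, 0 < η d) {p : ι → ℝ}
    (hp : p ∈ region Y η (insert d J)) :
    p d + η d ∈ Icc 0 (Y d) ∧ p d - η d ∈ Icc 0 (Y d) ∧ p ∈ region Y η J := by
  have h := (hp d).2 (Finset.mem_insert_self d J)
  have h' := (hp d).1
  have := hη d
  refine ⟨⟨by linarith [h'.1], by linarith [h.2]⟩, ⟨by linarith [h.1], by linarith [h'.2]⟩,
    region_anti (Finset.subset_insert d J) hp⟩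

theorem Jet.bound {k : ℕ} {w : (ι → ℝ) → ℝ} (h : Jet Y C k w) : ∀ p ∈ cbox Y, |w p| ≤ C := by
  cases k with
  | zero => exact h
  | succ k => exact h.1

theorem Jet.hasPartial {k : ℕ} {w : (ι → ℝ) → ℝ} (h : Jet Y C (k + 1) w) (d : ι) :
    HasPartial Y d (cbox Y) w (partialD Y d w) := (h.2 d).1

theorem Jet.deriv {k : ℕ} {w : (ι → ℝ) → ℝ} (h : Jet Y C (k + 1) w) (d : ι) :
    Jet Y C k (partialD Y d w) := (h.2 d).2

theorem Jet.pred {k : ℕ} : ∀ {w : (ι → ℝ) → ℝ}, Jet Y C (k + 1) w → Jet Y C k w := by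
  induction k with
  | zero => exact fun h => h.1
  | succ k ih => exact fun h => ⟨h.1, fun d => ⟨(h.2 d).1, ih (h.2 d).2⟩⟩

theorem Jet.of_le {k k' : ℕ} (hk : k' ≤ k) {w : (ι → ℝ) → ℝ} (h : Jet Y C k w) :
    Jet Y C k' w := by
  induction hk with
  | refl => exact h
  | step _ ih => exact ih h.pred

theorem Jet.iterate {d : ι} {k : ℕ} (j : ℕ) : ∀ {w : (ι → ℝ) → ℝ}, Jet Y C (k + j) w →
    Jet Y C k ((partialD Y d)^[j] w) := by
  induction j with
  | zero => exact fun h => h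
  | succ j ih => exact fun h => ih (h.deriv d)

theorem Jet.mono {C' : ℝ} (hC : C ≤ C') {k : ℕ} : ∀ {w : (ι → ℝ) → ℝ}, Jet Y C k w →
    Jet Y C' k w := by
  induction k with
  | zero => exact fun h p hp => (h p hp).trans hC
  | succ k ih =>
    exact fun h => ⟨fun p hp => (h.1 p hp).trans hC, fun d => ⟨(h.2 d).1, ih (h.2 d).2⟩⟩

/-! ### Taylor expansions of difference quotients in one direction. -/

theorem taylor_region {J : Finset ι} {d : ι} (hd : d ∉ J) (k : ℕ) (g : ℕ → (ι → ℝ) → ℝ)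
    (hg : ∀ j < k, HasPartial Y d (region Y η J) (g j) (g (j + 1)))
    (hC : ∀ p ∈ region Y η J, |g k p| ≤ C) {p : ι → ℝ} (hp : p ∈ region Y η J) {r : ℝ}
    (hr : r ∈ Icc 0 (Y d)) :
    |g 0 (update p d r) - ∑ j ∈ Finset.range k, g j p * (r - p d) ^ j / (j.factorial : ℝ)|
      ≤ C * |r - p d| ^ k := by
  have := taylor_remainder_le (convex_Icc 0 (Y d)) k (fun j r => g j (update p d r))
    (fun j hj r hr => by
      have := hg j hj _ (update_mem_region hd hp hr)
      simpa only [update_idem, update_self] using this)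
    (fun r hr => hC _ (update_mem_region hd hp hr)) (p d) (hp d).1 r hr
  simpa only [update_eq_self] using this

/-- The quotient combines the values on three lines parallel to `d`, all of which lie in the box
when `p` keeps the distance `η j` from the faces of direction `j`. -/
theorem HasPartial.sd {J : Finset ι} {d j : ι} (hη : ∀ d, 0 < η d) (hj : j ∉ J) (hdj : j ≠ d)
    {w w' : (ι → ℝ) → ℝ} (h : HasPartial Y d (region Y η J) w w') :
    HasPartial Y d (region Y η (insert j J)) (sd η j w) (sd η j w') := by
  intro p hp
  obtain ⟨h1, h2, h3⟩ := region_insert_step hη hp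
  have e1 := h _ (update_mem_region hj h3 h1)
  have e2 := h _ (update_mem_region hj h3 h2)
  have e0 := h _ h3
  simp only [update_of_ne hdj.symm] at e1 e2
  have := ((e1.sub (e0.const_mul 2)).add e2).div_const (η j ^ 2)
  refine this.congr_of_eventuallyEq (Filter.Eventually.of_forall fun r => ?_) ?_ <;>
  simp [CompactWave.sd, update_comm hdj, update_of_ne hdj]

theorem HasPartial.sdL {d : ι} (hη : ∀ d, 0 < η d) {w w' : (ι → ℝ) → ℝ}
    (h : HasPartial Y d (cbox Y) w w') (l : List ι) (hl : l.Nodup) (hd : d ∉ l) :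
    HasPartial Y d (region Y η l.toFinset) (sdL η l w) (sdL η l w') := by
  induction l with
  | nil => simpa [CompactWave.sdL, region_empty] using h
  | cons j l ih =>
    rw [List.nodup_cons] at hl
    rw [List.mem_cons, not_or] at hd
    rw [List.toFinset_cons]
    exact (ih hl.2 hd.2).sd hη (by simpa using hl.1) (Ne.symm hd.1)

/-- Supplies the successive derivatives in the direction `d` for `taylor_region` when other
directions have already been differenced. -/
theorem sdL_chain {d : ι} (hη : ∀ d, 0 < η d) {l : List ι} (hl : l.Nodup) (hd : d ∉ l)
    {k : ℕ} {w : (ι → ℝ) → ℝ} (h : Jet Y C k w) (j : ℕ) (hj : j < k) :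
    HasPartial Y d (region Y η l.toFinset) (sdL η l ((partialD Y d)^[j] w))
      (sdL η l ((partialD Y d)^[j + 1] w)) := by
  refine HasPartial.sdL hη ?_ l hl hd
  rw [iterate_succ_apply']
  exact Jet.hasPartial (Jet.iterate (k := 1) j (h.of_le (by omega))) d

/-- In a symmetric quotient the odd Taylor terms cancel and two remainders are left, whence the
factor 2. The expansions with two, four and six derivatives are used in turn here and in the next
two lemmas. -/
theorem abs_sd_le {J : Finset ι} {d : ι} (hη : ∀ d, 0 < η d) (hd : d ∉ J)
    (g : ℕ → (ι → ℝ) → ℝ)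
    (hg : ∀ j < 2, HasPartial Y d (region Y η J) (g j) (g (j + 1)))
    (hC : ∀ p ∈ region Y η J, |g 2 p| ≤ C) {p : ι → ℝ}
    (hp : p ∈ region Y η (insert d J)) : |sd η d (g 0) p| ≤ 2 * C := by
  obtain ⟨h1, h2, h3⟩ := region_insert_step hη hp
  have e1 := taylor_region hd 2 g hg hC h3 h1
  have e2 := taylor_region hd 2 g hg hC h3 h2
  have hpos := hη d
  simp only [Finset.sum_range_succ, Finset.sum_range_zero, add_sub_cancel_left, abs_of_pos hpos,
    sub_sub_cancel_left, abs_neg] at e1 e2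
  norm_num [Nat.factorial] at e1 e2
  rw [CompactWave.sd, abs_div, abs_of_pos (by positivity : 0 < η d ^ 2),
    div_le_iff₀ (by positivity), abs_le]
  rw [abs_le] at e1 e2
  constructor <;> linarith [e1.1, e1.2, e2.1, e2.2]

theorem abs_sd_sub_le {J : Finset ι} {d : ι} (hη : ∀ d, 0 < η d) (hd : d ∉ J)
    (g : ℕ → (ι → ℝ) → ℝ)
    (hg : ∀ j < 4, HasPartial Y d (region Y η J) (g j) (g (j + 1)))
    (hC : ∀ p ∈ region Y η J, |g 4 p| ≤ C) {p : ι → ℝ}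
    (hp : p ∈ region Y η (insert d J)) : |sd η d (g 0) p - g 2 p| ≤ 2 * C * η d ^ 2 := by
  obtain ⟨h1, h2, h3⟩ := region_insert_step hη hp
  have e1 := taylor_region hd 4 g hg hC h3 h1
  have e2 := taylor_region hd 4 g hg hC h3 h2
  have hpos := hη d
  simp only [Finset.sum_range_succ, Finset.sum_range_zero, add_sub_cancel_left, abs_of_pos hpos,
    sub_sub_cancel_left, abs_neg] at e1 e2
  norm_num [Nat.factorial] at e1 e2
  have : sd η d (g 0) p - g 2 p
      = (g 0 (update p d (p d + η d)) - 2 * g 0 p + g 0 (update p d (p d - η d))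
        - η d ^ 2 * g 2 p) / η d ^ 2 := by
    rw [CompactWave.sd]; field_simp
  rw [this, abs_div, abs_of_pos (by positivity : 0 < η d ^ 2),
    div_le_iff₀ (by positivity), abs_le]
  rw [abs_le] at e1 e2
  rw [show (-η d) ^ 3 = -(η d) ^ 3 by ring] at e2
  constructor <;> linarith [e1.1, e1.2, e2.1, e2.2]

theorem abs_sd_sub_sub_le {J : Finset ι} {d : ι} (hη : ∀ d, 0 < η d) (hd : d ∉ J)
    (g : ℕ → (ι → ℝ) → ℝ)
    (hg : ∀ j < 6, HasPartial Y d (region Y η J) (g j) (g (j + 1)))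
    (hC : ∀ p ∈ region Y η J, |g 6 p| ≤ C) {p : ι → ℝ}
    (hp : p ∈ region Y η (insert d J)) :
    |sd η d (g 0) p - g 2 p - η d ^ 2 / 12 * g 4 p| ≤ 2 * C * η d ^ 4 := by
  obtain ⟨h1, h2, h3⟩ := region_insert_step hη hp
  have e1 := taylor_region hd 6 g hg hC h3 h1
  have e2 := taylor_region hd 6 g hg hC h3 h2
  have hpos := hη d
  simp only [Finset.sum_range_succ, Finset.sum_range_zero, add_sub_cancel_left, abs_of_pos hpos,
    sub_sub_cancel_left, abs_neg] at e1 e2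
  norm_num [Nat.factorial] at e1 e2
  have : sd η d (g 0) p - g 2 p - η d ^ 2 / 12 * g 4 p
      = (g 0 (update p d (p d + η d)) - 2 * g 0 p + g 0 (update p d (p d - η d))
        - η d ^ 2 * g 2 p - η d ^ 4 / 12 * g 4 p) / η d ^ 2 := by
    rw [CompactWave.sd]; field_simp
  rw [this, abs_div, abs_of_pos (by positivity : 0 < η d ^ 2),
    div_le_iff₀ (by positivity), abs_le]
  rw [abs_le] at e1 e2
  rw [show (-η d) ^ 3 = -(η d) ^ 3 by ring,
    show (-η d) ^ 5 = -(η d) ^ 5 by ring] at e2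
  constructor <;> linarith [e1.1, e1.2, e2.1, e2.2]

/-- Second difference quotients in distinct directions are bounded by the derivatives. -/
theorem Jet.abs_sdL_le (hη : ∀ d, 0 < η d) (l : List ι) (hl : l.Nodup) :
    ∀ {w : (ι → ℝ) → ℝ}, Jet Y C (2 * l.length) w →
      ∀ p ∈ region Y η l.toFinset, |sdL η l w p| ≤ 2 ^ l.length * C := by
  induction l with
  | nil =>
    intro w h p hp
    simpa [CompactWave.sdL] using h p (region_subset_cbox _ hp)
  | cons d l ih =>
    intro w h p hp
    rw [List.nodup_cons] at hl
    rw [List.toFinset_cons] at hp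
    rw [List.length_cons, pow_succ']
    have h' : Jet Y C (2 * l.length + 2) w := h
    rw [mul_assoc]
    exact abs_sd_le hη (by simpa using hl.1) (fun j => sdL η l ((partialD Y d)^[j] w))
      (fun j hj => sdL_chain hη hl.2 hl.1 h' j (by omega)) (ih hl.2 (h'.iterate 2)) hp

/-- Each direction of `l` costs two derivatives and `d` costs four; with one direction in `l` this
uses up exactly six. -/
theorem Jet.abs_sd_sdL_sub_le (hη : ∀ d, 0 < η d) {l : List ι} {d : ι} (hl : l.Nodup)
    (hd : d ∉ l) {w : (ι → ℝ) → ℝ} (h : Jet Y C (2 * l.length + 4) w) {p : ι → ℝ}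
    (hp : p ∈ region Y η (insert d l.toFinset)) :
    |CompactWave.sd η d (sdL η l w) p - sdL η l (partialD Y d (partialD Y d w)) p|
      ≤ 2 * (2 ^ l.length * C) * η d ^ 2 :=
  CompactWave.abs_sd_sub_le hη (by simpa using hd)
    (fun j => sdL η l ((partialD Y d)^[j] w))
    (fun j hj => sdL_chain hη hl hd h j (by omega))
    (Jet.abs_sdL_le hη l hl (h.iterate 4)) hp

theorem Jet.abs_sd_sub_sub_le (hη : ∀ d, 0 < η d) {d : ι} {w : (ι → ℝ) → ℝ} (h : Jet Y C 6 w)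
    {p : ι → ℝ} (hp : p ∈ region Y η {d}) :
    |CompactWave.sd η d w p - (partialD Y d)^[2] w p
      - η d ^ 2 / 12 * (partialD Y d)^[4] w p| ≤ 2 * C * η d ^ 4 :=
  CompactWave.abs_sd_sub_sub_le hη (J := ∅) (by simp)
    (fun j => (partialD Y d)^[j] w)
    (fun j hj => sdL_chain hη (l := []) List.nodup_nil List.not_mem_nil h j hj)
    (fun p hp => Jet.bound (k := 0) (Jet.iterate 6 (by simpa using h)) p
      (region_subset_cbox _ hp)) (by simpa using hp)

theorem Jet.abs_fdq_sdL_sub_le (hη : ∀ d, 0 < η d) {l : List ι} {d : ι} (hl : l.Nodup)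
    (hd : d ∉ l) {w : (ι → ℝ) → ℝ} (h : Jet Y C (2 * l.length + 3) w) {p : ι → ℝ}
    (hp : p ∈ region Y η l.toFinset) (hpd : p d + η d ∈ Icc 0 (Y d)) :
    |fdq η d (sdL η l w) p - sdL η l (partialD Y d w) p
      - η d / 2 * sdL η l ((partialD Y d)^[2] w) p|
      ≤ 2 ^ l.length * C * η d ^ 2 := by
  have e1 := taylor_region (by simpa using hd) 3
    (fun j => sdL η l ((partialD Y d)^[j] w))
    (fun j hj => sdL_chain hη hl hd h j (by omega))
    (Jet.abs_sdL_le hη l hl (h.iterate 3)) hp hpd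
  have hpos := hη d
  simp only [Finset.sum_range_succ, Finset.sum_range_zero, add_sub_cancel_left,
    abs_of_pos hpos] at e1
  have e3 : fdq η d (sdL η l w) p - sdL η l (partialD Y d w) p
      - η d / 2 * sdL η l ((partialD Y d)^[2] w) p
      = (sdL η l w (update p d (p d + η d)) - (sdL η l w p
        + sdL η l (partialD Y d w) p * η d
        + sdL η l ((partialD Y d)^[2] w) p * η d ^ 2 / 2)) / η d := by
    rw [fdq]; field_simp; ring
  rw [e3, abs_div, abs_of_pos hpos, div_le_iff₀ hpos]
  norm_num [Nat.factorial] at e1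
  rw [show 2 ^ l.length * C * η d ^ 2 * η d = 2 ^ l.length * C * η d ^ 3 by ring]
  exact e1

/-- At `t = 0` only a forward quotient is available; nothing cancels, so the terms up to the fourth
derivative are kept and have to be matched by the initial equation of the scheme. -/
theorem Jet.abs_fdq_taylor_le (hη : ∀ d, 0 < η d) {d : ι} {w : (ι → ℝ) → ℝ}
    (h : Jet Y C 5 w) {p : ι → ℝ} (hp : p ∈ cbox Y) (hpd : p d + η d ∈ Icc 0 (Y d)) :
    |fdq η d w p - partialD Y d w p
      - η d / 2 * (partialD Y d)^[2] w p
      - η d ^ 2 / 6 * (partialD Y d)^[3] w p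
      - η d ^ 3 / 24 * (partialD Y d)^[4] w p| ≤ C * η d ^ 4 := by
  rw [← region_empty (η := η)] at hp
  have e1 := taylor_region (C := C) (J := ∅) (by simp) 5
    (fun j => (partialD Y d)^[j] w)
    (fun j hj => sdL_chain hη (l := []) List.nodup_nil List.not_mem_nil h j hj)
    (fun p hp => Jet.bound (k := 0) (Jet.iterate 5 (by simpa using h)) p
      (region_subset_cbox _ hp)) hp hpd
  have hpos := hη d
  simp only [Finset.sum_range_succ, Finset.sum_range_zero, add_sub_cancel_left,
    abs_of_pos hpos] at e1
  have e3 : fdq η d w p - partialD Y d w p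
      - η d / 2 * (partialD Y d)^[2] w p
      - η d ^ 2 / 6 * (partialD Y d)^[3] w p
      - η d ^ 3 / 24 * (partialD Y d)^[4] w p
      = (w (update p d (p d + η d)) - (w p + partialD Y d w p * η d
        + (partialD Y d)^[2] w p * η d ^ 2 / 2
        + (partialD Y d)^[3] w p * η d ^ 3 / 6
        + (partialD Y d)^[4] w p * η d ^ 4 / 24)) / η d := by
    rw [fdq]; field_simp; ring
  rw [e3, abs_div, abs_of_pos hpos, div_le_iff₀ hpos]
  norm_num [Nat.factorial] at e1
  rw [show C * η d ^ 4 * η d = C * η d ^ 5 by ring]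
  exact e1

end

end CompactWave

namespace CompactWave

noncomputable section

open Set Function Filter Topology

/-! ### Partial derivatives of smooth functions -/

section Smooth

variable {ι : Type*} {Y : ι → ℝ}

theorem convex_cbox : Convex ℝ (cbox Y) := convex_pi fun _ _ => convex_Icc _ _

theorem isCompact_cbox : IsCompact (cbox Y) := isCompact_univ_pi fun _ => isCompact_Icc

theorem uniqueDiffOn_cbox [Fintype ι] (hY : ∀ d, 0 < Y d) : UniqueDiffOn ℝ (cbox Y) :=
  UniqueDiffOn.univ_pi fun d => uniqueDiffOn_Icc (hY d)

variable [DecidableEq ι]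

theorem partialD_congr {d : ι} {w w' : (ι → ℝ) → ℝ} (h : EqOn w w' (cbox Y)) :
    EqOn (partialD Y d w) (partialD Y d w') (cbox Y) := by
  intro p hp
  refine derivWithin_congr (fun r hr => h ?_) (by simpa using h hp)
  intro e _
  by_cases he : e = d
  · subst he; simpa using hr
  · simpa [he] using hp e

theorem partialD_update (d : ι) (w : (ι → ℝ) → ℝ) (p : ι → ℝ) (r : ℝ) :
    partialD Y d w (update p d r) = derivWithin (fun s => w (update p d s)) (Icc 0 (Y d)) r := by
  simp [partialD]

theorem iteratedDerivWithin_two_update (d : ι) (w : (ι → ℝ) → ℝ) (p : ι → ℝ) :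
    iteratedDerivWithin 2 (fun r => w (update p d r)) (Icc 0 (Y d)) (p d)
      = partialD Y d (partialD Y d w) p := by
  rw [iteratedDerivWithin_succ, partialD]
  refine congrArg (fun φ => derivWithin φ (Icc 0 (Y d)) (p d)) (funext fun r => ?_)
  rw [iteratedDerivWithin_one, partialD_update]

theorem iteratedDeriv_two_update {d : ι} (w : (ι → ℝ) → ℝ) {p : ι → ℝ}
    (hp : p d ∈ Ioo 0 (Y d)) :
    iteratedDeriv 2 (fun r => w (update p d r)) (p d) = partialD Y d (partialD Y d w) p := by
  rw [iteratedDeriv_succ, iteratedDeriv_one]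
  have h : deriv (fun r => w (update p d r)) =ᶠ[𝓝 (p d)]
      fun r => partialD Y d w (update p d r) := by
    filter_upwards [isOpen_Ioo.mem_nhds hp] with r hr
    rw [partialD_update, derivWithin_of_mem_nhds (Icc_mem_nhds hr.1 hr.2)]
  rw [h.deriv_eq, partialD, derivWithin_of_mem_nhds (Icc_mem_nhds hp.1 hp.2)]

variable [Fintype ι]

theorem hasPartial_fderivWithin {w : (ι → ℝ) → ℝ} (hw : DifferentiableOn ℝ w (cbox Y)) (d : ι) :
    HasPartial Y d (cbox Y) w (fun p => fderivWithin ℝ w (cbox Y) p (Pi.single d 1)) := by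
  intro p hp
  have h1 : HasFDerivWithinAt w (fderivWithin ℝ w (cbox Y) p) (cbox Y) (update p d (p d)) := by
    rw [update_eq_self]
    exact (hw p hp).hasFDerivWithinAt
  refine h1.comp_hasDerivWithinAt (p d) (hasDerivAt_update p d (p d)).hasDerivWithinAt ?_
  intro r hr e _
  by_cases he : e = d
  · subst he; simpa using hr
  · simpa [he] using hp e

theorem partialD_eq_fderivWithin (hY : ∀ d, 0 < Y d) {w : (ι → ℝ) → ℝ}
    (hw : DifferentiableOn ℝ w (cbox Y)) (d : ι) :
    EqOn (partialD Y d w) (fun p => fderivWithin ℝ w (cbox Y) p (Pi.single d 1)) (cbox Y) :=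
  fun p hp => (hasPartial_fderivWithin hw d p hp).derivWithin
    (uniqueDiffOn_Icc (hY d) _ (hp d trivial))

theorem contDiffOn_partialD (hY : ∀ d, 0 < Y d) {k : ℕ} {w : (ι → ℝ) → ℝ}
    (hw : ContDiffOn ℝ (k + 1 : ℕ) w (cbox Y)) (d : ι) :
    ContDiffOn ℝ k (partialD Y d w) (cbox Y) := by
  have hd : DifferentiableOn ℝ w (cbox Y) := hw.differentiableOn (by simp)
  refine ContDiffOn.congr ?_ (partialD_eq_fderivWithin hY hd d)
  exact (hw.fderivWithin (uniqueDiffOn_cbox hY) (m := k) (by norm_cast)).clm_apply contDiffOn_const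

theorem partialD_comm (hY : ∀ d, 0 < Y d) {w : (ι → ℝ) → ℝ}
    (hw : ContDiffOn ℝ 2 w (cbox Y)) (d e : ι) :
    EqOn (partialD Y d (partialD Y e w)) (partialD Y e (partialD Y d w)) (cbox Y) := by
  have hU := uniqueDiffOn_cbox hY
  have hd : DifferentiableOn ℝ w (cbox Y) := hw.differentiableOn (by simp)
  have hw' : ContDiffOn ℝ (1 + 1 : ℕ) w (cbox Y) := by exact_mod_cast hw
  have hfd : DifferentiableOn ℝ (fderivWithin ℝ w (cbox Y)) (cbox Y) :=
    (hw.fderivWithin hU (m := 1) (by norm_num)).differentiableOn (by simp)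
  have key : ∀ d e, ∀ p ∈ cbox Y, partialD Y d (partialD Y e w) p
      = fderivWithin ℝ (fderivWithin ℝ w (cbox Y)) (cbox Y) p (Pi.single d 1) (Pi.single e 1) := by
    intro d e p hp
    rw [partialD_eq_fderivWithin hY
      ((contDiffOn_partialD hY hw' e).differentiableOn (by simp)) d hp]
    simp only
    rw [fderivWithin_congr (partialD_eq_fderivWithin hY hd e)
        (partialD_eq_fderivWithin hY hd e hp),
      fderivWithin_clm_apply (hU p hp) (hfd p hp) (by fun_prop)]
    simp
  intro p hp
  rw [key d e p hp, key e d p hp]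
  -- The second derivative is symmetric also on the faces, since every point of the box is a limit
  -- of interior points.
  have hcl : p ∈ closure (interior (cbox Y)) := by
    rw [convex_cbox.closure_interior_eq_closure_of_nonempty_interior]
    · exact subset_closure hp
    · rw [cbox, interior_pi_set finite_univ]
      refine ⟨fun d => Y d / 2, fun d _ => ?_⟩
      simp only [interior_Icc]
      constructor <;> linarith [hY d]
  exact (hw p hp).isSymmSndFDerivWithinAt (by simp) hU hcl hp _ _

/-- Continuous derivatives are bounded on the compact box, and `max C₀ (∑ e, |C e|)` dominates the
finitely many constants at once. -/
theorem exists_jet (hY : ∀ d, 0 < Y d) (k : ℕ) : ∀ {w : (ι → ℝ) → ℝ},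
    ContDiffOn ℝ k w (cbox Y) → ∃ C, Jet Y C k w := by
  have hbd : ∀ w : (ι → ℝ) → ℝ, ContinuousOn w (cbox Y) → ∃ C, ∀ p ∈ cbox Y, |w p| ≤ C :=
    fun w hw => isCompact_cbox.exists_bound_of_continuousOn hw
  induction k with
  | zero => exact fun {w} hw => hbd w hw.continuousOn
  | succ k ih =>
    intro w hw
    obtain ⟨C₀, hC₀⟩ := hbd w hw.continuousOn
    choose C hC using fun d => ih (contDiffOn_partialD hY hw d)
    have hle : ∀ d, C d ≤ max C₀ (∑ e, |C e|) := fun d =>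
      (le_abs_self _).trans ((Finset.single_le_sum (f := fun e => |C e|)
        (fun e _ => abs_nonneg _) (Finset.mem_univ d)).trans (le_max_right _ _))
    refine ⟨max C₀ (∑ e, |C e|), fun p hp => (hC₀ p hp).trans (le_max_left _ _), fun d => ⟨?_, ?_⟩⟩
    · have hd : DifferentiableOn ℝ w (cbox Y) := hw.differentiableOn (by simp)
      intro p hp
      rw [partialD_eq_fderivWithin hY hd d hp]
      exact hasPartial_fderivWithin hd d p hp
    · exact (hC d).mono (hle d)

end Smooth

/-! ### Space-time as a coordinate box -/

variable {n : ℕ}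

/-- The point of space-time with the coordinates `x` and `t`; the time direction is `none`. -/
def stPoint (x : Fin n → ℝ) (t : ℝ) : Option (Fin n) → ℝ := fun o => o.elim t x

/-- A function of `(x, t)` as a function of the space-time point. -/
def stFun (w : (Fin n → ℝ) → ℝ → ℝ) : (Option (Fin n) → ℝ) → ℝ :=
  fun p => w (fun i => p (some i)) (p none)

/-- The lengths of the edges of the space-time cylinder. -/
def stBox (X : Fin n → ℝ) (T : ℝ) : Option (Fin n) → ℝ := fun o => o.elim T X

@[simp] theorem stPoint_none (x : Fin n → ℝ) (t : ℝ) : stPoint x t none = t := rfl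

@[simp] theorem stPoint_some (x : Fin n → ℝ) (t : ℝ) (i : Fin n) : stPoint x t (some i) = x i :=
  rfl

@[simp] theorem stFun_stPoint (w : (Fin n → ℝ) → ℝ → ℝ) (x : Fin n → ℝ) (t : ℝ) :
    stFun w (stPoint x t) = w x t := rfl

theorem stPoint_mem {X : Fin n → ℝ} {T : ℝ} {x : Fin n → ℝ} {t : ℝ} (hx : x ∈ closedBox X)
    (ht : t ∈ Icc 0 T) : stPoint x t ∈ cbox (stBox X T) := by
  rintro (_ | i) _
  · exact ht
  · exact hx i trivial

theorem update_stPoint_none (x : Fin n → ℝ) (t r : ℝ) :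
    update (stPoint x t) none r = stPoint x r := by
  funext o; cases o <;> simp

theorem update_stPoint_some (x : Fin n → ℝ) (t : ℝ) (i : Fin n) (r : ℝ) :
    update (stPoint x t) (some i) r = stPoint (update x i r) t := by
  funext o
  rcases o with _ | j
  · simp
  · by_cases h : j = i
    · subst h; simp
    · simp [h]

theorem stBox_pos {X : Fin n → ℝ} {T : ℝ} (hX : ∀ i, 0 < X i) (hT : 0 < T) :
    ∀ d, 0 < stBox X T d := by
  rintro (_ | i)
  exacts [hT, hX i]

theorem continuous_stPoint : Continuous fun q : (Fin n → ℝ) × ℝ => stPoint q.1 q.2 := by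
  refine continuous_pi fun o => ?_
  rcases o with _ | i
  · exact continuous_snd
  · exact (continuous_apply i).comp continuous_fst

theorem contDiffOn_stFun {X : Fin n → ℝ} {T : ℝ} {k : WithTop ℕ∞} {u : (Fin n → ℝ) → ℝ → ℝ}
    (hu : ContDiffOn ℝ k (fun p : (Fin n → ℝ) × ℝ => u p.1 p.2) (closedBox X ×ˢ Icc 0 T)) :
    ContDiffOn ℝ k (stFun u) (cbox (stBox X T)) := by
  have hlin : ContDiff ℝ k
      (fun p : Option (Fin n) → ℝ => ((fun i => p (some i), p none) : (Fin n → ℝ) × ℝ)) :=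
    (contDiff_pi.2 fun i => contDiff_apply ℝ ℝ (some i)).prodMk (contDiff_apply ℝ ℝ none)
  exact hu.comp hlin.contDiffOn fun p hp => ⟨fun i _ => hp (some i) trivial, hp none trivial⟩

theorem closure_box {X : Fin n → ℝ} (hX : ∀ i, 0 < X i) : closure (box X) = closedBox X := by
  rw [box, closure_pi_set, closedBox]
  simp only [closure_Ioo (hX _).ne]

/-- The wave operator applied to a function of the space-time point. -/
def waveOp (a X : Fin n → ℝ) (T : ℝ) (w : (Option (Fin n) → ℝ) → ℝ) : (Option (Fin n) → ℝ) → ℝ :=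
  fun p => partialD (stBox X T) none (partialD (stBox X T) none w) p
    - ∑ i, a i ^ 2 * partialD (stBox X T) (some i) (partialD (stBox X T) (some i) w) p

/-! ### The data expressed through the solution, up to the boundary. -/

section IBVP

variable {a X : Fin n → ℝ} {T : ℝ} {f g : (Fin n → ℝ) → ℝ → ℝ} {u₀ u₁ : (Fin n → ℝ) → ℝ}
  {u : (Fin n → ℝ) → ℝ → ℝ}

theorem contDiffOn_waveOp (hX : ∀ i, 0 < X i) (hT : 0 < T) {k : ℕ} {w : (Option (Fin n) → ℝ) → ℝ}
    (hw : ContDiffOn ℝ (k + 2 : ℕ) w (cbox (stBox X T))) :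
    ContDiffOn ℝ k (waveOp a X T w) (cbox (stBox X T)) := by
  have hY := stBox_pos hX hT
  have h2 : ∀ d, ContDiffOn ℝ k (partialD (stBox X T) d (partialD (stBox X T) d w))
      (cbox (stBox X T)) := fun d => contDiffOn_partialD hY (contDiffOn_partialD hY hw d) d
  exact (h2 none).sub (ContDiffOn.sum fun i _ => contDiffOn_const.mul (h2 (some i)))

/-- The equation is posed in the open cylinder, which is dense in the closed one, and both sides are
continuous there. From here on the smoothness of `u` replaces any smoothness of `f`. -/
theorem IsIBVPSolution.rhs_eq (hX : ∀ i, 0 < X i) (hT : 0 < T)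
    (hf : ContinuousOn (fun p : (Fin n → ℝ) × ℝ => f p.1 p.2) (closedBox X ×ˢ Icc 0 T))
    (hsm : ContDiffOn ℝ 2 (stFun u) (cbox (stBox X T)))
    (hu : IsIBVPSolution a X T f g u₀ u₁ u) {x : Fin n → ℝ} (hx : x ∈ closedBox X) {t : ℝ}
    (ht : t ∈ Icc 0 T) : f x t = waveOp a X T (stFun u) (stPoint x t) := by
  have hcont : ContinuousOn (fun q : (Fin n → ℝ) × ℝ => waveOp a X T (stFun u) (stPoint q.1 q.2))
      (closedBox X ×ˢ Icc 0 T) := by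
    have := (contDiffOn_waveOp (a := a) hX hT (k := 0) (by exact_mod_cast hsm)).continuousOn
    exact this.comp continuous_stPoint.continuousOn fun q hq => stPoint_mem hq.1 hq.2
  have hint : EqOn (fun q : (Fin n → ℝ) × ℝ => f q.1 q.2)
      (fun q => waveOp a X T (stFun u) (stPoint q.1 q.2)) (box X ×ˢ Ioo 0 T) := by
    rintro ⟨x, t⟩ ⟨hx, ht⟩
    simp only
    rw [← hu.pde x hx t ht, waveOp]
    congr 1
    · rw [← iteratedDeriv_two_update (Y := stBox X T) (d := none) (p := stPoint x t) _ ht]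
      simp only [update_stPoint_none]
      rfl
    · refine Finset.sum_congr rfl fun i _ => ?_
      rw [← iteratedDeriv_two_update (Y := stBox X T) (d := some i) (p := stPoint x t) _
        (hx i trivial)]
      simp only [update_stPoint_some]
      rfl
  have hcl : closure (box X ×ˢ Ioo 0 T) = closedBox X ×ˢ Icc 0 T := by
    rw [closure_prod_eq, closure_box hX, closure_Ioo hT.ne]
  exact hint.of_subset_closure hf hcont (by rw [← hcl]; exact subset_closure) hcl.ge
    (⟨hx, ht⟩ : (x, t) ∈ closedBox X ×ˢ Icc 0 T)

/-- The one-sided derivatives at `t = 0` depend only on the values on `[0, T]`, where `f` coincides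
with the wave operator of `u`; hence continuity of `f` is enough. -/
theorem IsIBVPSolution.fD0_eq (hX : ∀ i, 0 < X i) (hT : 0 < T)
    (hf : ContinuousOn (fun p : (Fin n → ℝ) × ℝ => f p.1 p.2) (closedBox X ×ˢ Icc 0 T))
    (hsm : ContDiffOn ℝ 2 (stFun u) (cbox (stBox X T)))
    (hu : IsIBVPSolution a X T f g u₀ u₁ u) {x : Fin n → ℝ} (hx : x ∈ closedBox X) (ht : ℝ) :
    fD0 T ht f x = waveOp a X T (stFun u) (stPoint x 0)
      + ht / 3 * partialD (stBox X T) none (waveOp a X T (stFun u)) (stPoint x 0)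
      + ht ^ 2 / 12 * partialD (stBox X T) none
          (partialD (stBox X T) none (waveOp a X T (stFun u))) (stPoint x 0) := by
  have h0 : (0 : ℝ) ∈ Icc 0 T := left_mem_Icc.2 hT.le
  have heq : EqOn (f x) (fun r => waveOp a X T (stFun u) (update (stPoint x 0) none r))
      (Icc 0 T) := fun r hr => by
    simp only [update_stPoint_none]
    exact hu.rhs_eq hX hT hf hsm hx hr
  rw [fD0, hu.rhs_eq hX hT hf hsm hx h0, derivWithin_congr heq (heq h0),
    iteratedDerivWithin_congr heq h0,
    ← iteratedDerivWithin_two_update none (waveOp a X T (stFun u)) (stPoint x 0)]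
  rfl

theorem IsIBVPSolution.initial_eq (hX : ∀ i, 0 < X i) (hT : 0 < T)
    (hu₀ : ContinuousOn u₀ (closedBox X))
    (hsm : ContinuousOn (stFun u) (cbox (stBox X T)))
    (hu : IsIBVPSolution a X T f g u₀ u₁ u) {x : Fin n → ℝ} (hx : x ∈ closedBox X) :
    u x 0 = u₀ x := by
  have h0 : (0 : ℝ) ∈ Icc 0 T := left_mem_Icc.2 hT.le
  have hcont : ContinuousOn (fun x => u x 0) (closedBox X) :=
    hsm.comp (f := fun x => stPoint x 0)
      (continuous_stPoint.comp
        (by fun_prop : Continuous fun x : Fin n → ℝ => (x, (0 : ℝ)))).continuousOn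
      fun x hx => stPoint_mem hx h0
  exact EqOn.of_subset_closure (s := box X) (fun x hx => hu.initial x hx) hcont hu₀
    (by rw [← closure_box hX]; exact subset_closure) (closure_box hX).ge hx

theorem IsIBVPSolution.initialVelocity_eq (hX : ∀ i, 0 < X i) (hT : 0 < T)
    (hu₁ : ContinuousOn u₁ (closedBox X))
    (hsm : ContDiffOn ℝ 2 (stFun u) (cbox (stBox X T)))
    (hu : IsIBVPSolution a X T f g u₀ u₁ u) {x : Fin n → ℝ} (hx : x ∈ closedBox X) :
    u₁ x = partialD (stBox X T) none (stFun u) (stPoint x 0) := by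
  have h0 : (0 : ℝ) ∈ Icc 0 T := left_mem_Icc.2 hT.le
  have h1 := (contDiffOn_partialD (stBox_pos hX hT) (k := 1) (by exact_mod_cast hsm)
    none).continuousOn
  have hcont : ContinuousOn (fun x => partialD (stBox X T) none (stFun u) (stPoint x 0))
      (closedBox X) :=
    h1.comp (f := fun x => stPoint x 0)
      (continuous_stPoint.comp
        (by fun_prop : Continuous fun x : Fin n → ℝ => (x, (0 : ℝ)))).continuousOn
      fun x hx => stPoint_mem hx h0
  refine EqOn.of_subset_closure (s := box X) (fun x hx => ?_) hu₁ hcont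
    (by rw [← closure_box hX]; exact subset_closure) (closure_box hX).ge hx
  rw [← hu.initialVelocity x hx, partialD]
  simp only [update_stPoint_none]
  rfl

/-- Continuity in time extends the condition to the ends of the interval; `t = T` is needed at the
last time level. -/
theorem IsIBVPSolution.boundary_eq (hT : 0 < T)
    (hg : ContinuousOn (fun p : (Fin n → ℝ) × ℝ => g p.1 p.2) (frontier (box X) ×ˢ Icc 0 T))
    (hsm : ContinuousOn (stFun u) (cbox (stBox X T)))
    (hu : IsIBVPSolution a X T f g u₀ u₁ u) {x : Fin n → ℝ} (hx : x ∈ closedBox X)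
    (hx' : x ∈ frontier (box X)) {t : ℝ} (ht : t ∈ Icc 0 T) : u x t = g x t := by
  have h1 : ContinuousOn (u x) (Icc 0 T) :=
    hsm.comp (f := fun t => stPoint x t)
      (continuous_stPoint.comp (by fun_prop : Continuous fun t : ℝ => (x, t))).continuousOn
      fun t ht => stPoint_mem hx ht
  have h2 : ContinuousOn (g x) (Icc 0 T) :=
    hg.comp (f := fun t => (x, t)) (by fun_prop) fun t ht => ⟨hx', ht⟩
  exact EqOn.of_subset_closure (s := Ioo 0 T) (fun t ht => hu.boundary x hx' t ht) h1 h2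
    Ioo_subset_Icc_self (closure_Ioo hT.ne).ge ht

end IBVP

end

end CompactWave

namespace CompactWave

noncomputable section

open MvPolynomial

/-! ### Polynomials in commuting operators -/

section Aeval

variable {σ A : Type*} [Ring A] [Algebra ℝ A]

/-- Evaluation of real polynomials at a family of commuting elements of an algebra. -/
def commAeval (T : σ → A) (hT : ∀ i j, Commute (T i) (T j)) : MvPolynomial σ ℝ →ₐ[ℝ] A :=
  -- The commuting family generates a commutative subalgebra, in which polynomials can be evaluated.
  letI : CommRing (Algebra.adjoin ℝ (Set.range T)) :=
    { (inferInstance : Ring (Algebra.adjoin ℝ (Set.range T))) with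
      mul_comm := (Algebra.isMulCommutative_adjoin ℝ (s := Set.range T) (by
        rintro _ ⟨i, rfl⟩ _ ⟨j, rfl⟩
        exact hT i j)).is_comm.comm }
  (Algebra.adjoin ℝ (Set.range T)).val.comp
    (aeval fun i => ⟨T i, Algebra.subset_adjoin ⟨i, rfl⟩⟩)

@[simp] theorem commAeval_X (T : σ → A) (hT : ∀ i j, Commute (T i) (T j)) (i : σ) :
    commAeval T hT (X i) = T i := by
  simp [commAeval]

theorem commAeval_prod (T : σ → A) (hT : ∀ i j, Commute (T i) (T j)) {ι : Type*} (S : Finset ι)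
    (F : ι → MvPolynomial σ ℝ) :
    commAeval T hT (∏ l ∈ S, F l) = (S.toList.map fun l => commAeval T hT (F l)).prod := by
  rw [← Finset.prod_map_toList, map_list_prod, List.map_map]
  rfl

end Aeval

variable {n : ℕ}

theorem lam_commute (h : Fin n → ℝ) (i j : Fin n) : Commute (lam h i) (lam h j) := by
  refine LinearMap.ext fun w => funext fun k => ?_
  change ((_ : ℝ) - 2 * _ + _) / _ = (_ - 2 * _ + _) / _
  simp only [lam, LinearMap.coe_mk, AddHom.coe_mk]
  rw [add_right_comm k (Pi.single j 1) (Pi.single i 1), sub_right_comm k (Pi.single j 1),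
    add_sub_right_comm k (Pi.single j 1) (Pi.single i 1),
    ← add_sub_right_comm k (Pi.single i 1) (Pi.single j 1)]
  ring

/-- The mesh operator obtained by the substitution of `Λ_i` for the variables. -/
def polyOp (h : Fin n → ℝ) : MvPolynomial (Fin n) ℝ →ₐ[ℝ] MeshOp n :=
  commAeval (lam h) (lam_commute h)

@[simp] theorem polyOp_X (h : Fin n → ℝ) (i : Fin n) : polyOp h (X i) = lam h i :=
  commAeval_X _ _ i

theorem opProd_polyOp (h : Fin n → ℝ) (S : Finset (Fin n)) (F : Fin n → MvPolynomial (Fin n) ℝ) :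
    opProd S (fun l => polyOp h (F l)) = polyOp h (∏ l ∈ S, F l) := by
  have : ∏ l ∈ S, F l = ∏ l, if l ∈ S then F l else 1 := by
    rw [Finset.prod_ite_mem, Finset.univ_inter]
  rw [this, Fin.prod_univ_def, map_list_prod, List.map_map, opProd]
  congr 1
  refine List.map_congr_left fun l _ => ?_
  simp only [Function.comp]
  split_ifs <;> simp

/-! ### Symbols of the operators of the schemes -/

/-- The symbol of `s_{kN}`. -/
def s1NPoly (h : Fin n → ℝ) (k : Fin n) : MvPolynomial (Fin n) ℝ := 1 + (h k ^ 2 / 12) • X k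

/-- The symbol of `s_N`. -/
def sNPoly (h : Fin n → ℝ) : MvPolynomial (Fin n) ℝ := 1 + ∑ i, (h i ^ 2 / 12) • X i

/-- The symbol of `A_N`. -/
def aNPoly (a h : Fin n → ℝ) : MvPolynomial (Fin n) ℝ :=
  -∑ i, a i ^ 2 • ((1 + ∑ j ∈ Finset.univ.erase i, (h j ^ 2 / 12) • X j) * X i)

/-- The symbol of `s̄_N`. -/
def sBarPoly (h : Fin n → ℝ) : MvPolynomial (Fin n) ℝ := ∏ k, s1NPoly h k

/-- The symbol of `Ā_N`. -/
def aBarPoly (a h : Fin n → ℝ) : MvPolynomial (Fin n) ℝ :=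
  -∑ i, a i ^ 2 • ((∏ k ∈ Finset.univ.erase i, s1NPoly h k) * X i)

/-- The symbol of `B̄_N`. -/
def bBarPoly (a h : Fin n → ℝ) (ht : ℝ) : MvPolynomial (Fin n) ℝ :=
  ∏ k, (s1NPoly h k - (ht ^ 2 / 12 * a k ^ 2) • X k)

/-- The symbol of `R`. -/
def rPoly (a h : Fin n → ℝ) (ht : ℝ) : MvPolynomial (Fin n) ℝ :=
  ∑ S ∈ (Finset.univ : Finset (Finset (Fin n))).filter (fun S => 2 ≤ S.card),
    ((ht ^ 2 / 12) ^ S.card * ∏ i ∈ S, a i ^ 2) •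
      ((∏ k ∈ Sᶜ, s1NPoly h k) * ∏ i ∈ S, -X i)

theorem s1N_eq (h : Fin n → ℝ) : s1N h = fun k => polyOp h (s1NPoly h k) := by
  funext k
  simp [s1NPoly, s1N]

theorem sN_eq (h : Fin n → ℝ) : sN h = polyOp h (sNPoly h) := by
  simp [sNPoly, sN]

theorem opAN_eq (a h : Fin n → ℝ) : opAN a h = polyOp h (aNPoly a h) := by
  simp [aNPoly, opAN, sNhat]

theorem sBarN_eq (h : Fin n → ℝ) : sBarN h = polyOp h (sBarPoly h) := by
  rw [sBarN, s1N_eq, opProd_polyOp, sBarPoly]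

theorem opABarN_eq (a h : Fin n → ℝ) : opABarN a h = polyOp h (aBarPoly a h) := by
  simp only [opABarN, sBarNhat, s1N_eq, opProd_polyOp, aBarPoly, map_neg, map_sum, map_smul,
    map_mul, polyOp_X]

theorem opBBarN_eq (a h : Fin n → ℝ) (ht : ℝ) : opBBarN a h ht = polyOp h (bBarPoly a h ht) := by
  have : opB1N a h ht
      = fun k => polyOp h (s1NPoly h k - (ht ^ 2 / 12 * a k ^ 2) • X k) := by
    funext k
    simp only [opB1N, s1N_eq, map_sub, map_smul, polyOp_X]
  rw [opBBarN, this, opProd_polyOp, bBarPoly]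

theorem opR_eq (a h : Fin n → ℝ) (ht : ℝ) : opR a h ht = polyOp h (rPoly a h ht) := by
  have : (fun i => -lam h i) = fun i => polyOp h (-X i) := by
    funext i; simp
  simp only [opR, s1N_eq, this, opProd_polyOp, rPoly, map_sum, map_smul, map_mul]

/-- The symbol of the operator `P` of a scheme. -/
def Scheme.pPoly (a h : Fin n → ℝ) (ht : ℝ) : Scheme → MvPolynomial (Fin n) ℝ
  | .oneDim => sBarPoly h + (ht ^ 2 / 12) • aBarPoly a h
  | .plain => sNPoly h + (ht ^ 2 / 12) • aNPoly a h
  | .mixed => sBarPoly h + (ht ^ 2 / 12) • aNPoly a h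
  | .product => sBarPoly h + (ht ^ 2 / 12) • aBarPoly a h
  | .splitting => bBarPoly a h ht

/-- The symbol of the operator `A` of a scheme. -/
def Scheme.aPoly (a h : Fin n → ℝ) : Scheme → MvPolynomial (Fin n) ℝ
  | .oneDim => aBarPoly a h
  | .plain => aNPoly a h
  | .mixed => aNPoly a h
  | .product => aBarPoly a h
  | .splitting => aBarPoly a h

/-- The symbol of the operator `B_h` of the energy norm of a scheme. -/
def Scheme.bPoly (a h : Fin n → ℝ) (ht : ℝ) : Scheme → MvPolynomial (Fin n) ℝ
  | .oneDim => sBarPoly h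
  | .plain => sNPoly h
  | .mixed => sBarPoly h
  | .product => sBarPoly h
  | .splitting => sBarPoly h + rPoly a h ht

theorem Scheme.normA_eq (S : Scheme) (a h : Fin n → ℝ) : S.normA a h = polyOp h (S.aPoly a h) := by
  cases S <;> simp [Scheme.normA, Scheme.aPoly, opAN_eq, opABarN_eq]

theorem Scheme.normB_eq (S : Scheme) (a h : Fin n → ℝ) (ht : ℝ) :
    S.normB a h ht = polyOp h (S.bPoly a h ht) := by
  cases S <;> simp [Scheme.normB, Scheme.bPoly, sN_eq, sBarN_eq, opR_eq]

/-- The one-dimensional scheme carries the symbols of the product scheme; the two agree only for `n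
= 1`, which is where admissibility enters here and in `Scheme.opP_eq`. -/
theorem Scheme.opA_eq (S : Scheme) (hS : S.Admissible n) (a h : Fin n → ℝ) :
    S.opA a h = polyOp h (S.aPoly a h) := by
  cases S
  case oneDim =>
    obtain rfl : n = 1 := hS
    simp [Scheme.opA, Scheme.aPoly, aBarPoly]
  all_goals simp [Scheme.opA, Scheme.aPoly, opAN_eq, opABarN_eq]

theorem Scheme.opP_eq (S : Scheme) (hS : S.Admissible n) (a h : Fin n → ℝ) (ht : ℝ) :
    S.opP a h ht = polyOp h (S.pPoly a h ht) := by
  cases S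
  case oneDim =>
    obtain rfl : n = 1 := hS
    simp only [Scheme.opP, Scheme.pPoly, aBarPoly, sBarPoly, s1NPoly, Finset.univ_unique,
      Finset.sum_singleton, Finset.prod_singleton, map_add, map_smul, map_neg, map_one, polyOp_X,
      Finset.erase_singleton, Finset.prod_empty, one_mul]
    module
  all_goals simp [Scheme.opP, Scheme.pPoly, opAN_eq, opABarN_eq, sN_eq, sBarN_eq, opBBarN_eq]

/-! ### The factorized operator -/

theorem filter_card_lt_two {ι : Type*} [DecidableEq ι] (S : Finset ι) :
    S.powerset.filter (fun U => ¬ 2 ≤ U.card) = insert ∅ (S.image fun i => {i}) := by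
  ext U
  simp only [Finset.mem_filter, Finset.mem_powerset, Finset.mem_insert, Finset.mem_image]
  constructor
  · rintro ⟨hU, hc⟩
    rcases Nat.lt_or_ge U.card 1 with h0 | h1
    · exact Or.inl (Finset.card_eq_zero.1 (by omega))
    · obtain ⟨i, rfl⟩ := Finset.card_eq_one.1 (by omega : U.card = 1)
      exact Or.inr ⟨i, by simpa using hU, rfl⟩
  · rintro (rfl | ⟨i, hi, rfl⟩) <;> simp [*]

/-- Expand the product of `s_{kN} + (h_t²/12) a_k² (-Λ_k)` over the set of indices at which the
second summand is taken: the empty set gives `s̄_N`, the singletons give `(h_t²/12) Ā_N`, and the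
larger sets make up `R`. -/
theorem bBarPoly_eq (a h : Fin n → ℝ) (ht : ℝ) :
    bBarPoly a h ht = sBarPoly h + rPoly a h ht + (ht ^ 2 / 12) • aBarPoly a h := by
  have hfac : ∀ k, s1NPoly h k - (ht ^ 2 / 12 * a k ^ 2) • X k
      = (ht ^ 2 / 12 * a k ^ 2) • (-X k) + s1NPoly h k := fun k => by module
  have hterm : ∀ S : Finset (Fin n),
      (∏ i ∈ S, (ht ^ 2 / 12 * a i ^ 2) • (-X i : MvPolynomial (Fin n) ℝ))
        * ∏ k ∈ Finset.univ \ S, s1NPoly h k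
      = ((ht ^ 2 / 12) ^ S.card * ∏ i ∈ S, a i ^ 2) •
        ((∏ k ∈ Sᶜ, s1NPoly h k) * ∏ i ∈ S, -X i) := fun S => by
    rw [Finset.prod_smul, Finset.prod_mul_distrib, Finset.prod_const, smul_mul_assoc,
      ← Finset.compl_eq_univ_sdiff, mul_comm (∏ i ∈ S, -X i)]
  rw [bBarPoly, Finset.prod_congr rfl fun k _ => hfac k, Finset.prod_add,
    Finset.sum_congr rfl fun S _ => hterm S, Finset.powerset_univ,
    ← Finset.sum_filter_add_sum_filter_not _ (fun S : Finset (Fin n) => 2 ≤ S.card)]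
  rw [← rPoly]
  have hsmall : (Finset.univ : Finset (Finset (Fin n))).filter (fun S => ¬ 2 ≤ S.card)
      = insert ∅ (Finset.univ.image fun i => {i}) := by
    rw [← filter_card_lt_two, Finset.powerset_univ]
  rw [hsmall, Finset.sum_insert (by simp), Finset.sum_image (fun i _ j _ hij => by simpa using hij)]
  simp only [Finset.card_empty, pow_zero, Finset.prod_empty, mul_one, one_smul, Finset.compl_empty,
    Finset.card_singleton, pow_one, Finset.prod_singleton]
  rw [← sBarPoly, aBarPoly, smul_neg, Finset.smul_sum, ← Finset.sum_neg_distrib]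
  have : ∀ i : Fin n, ({i} : Finset (Fin n))ᶜ = Finset.univ.erase i := fun i => by
    ext; simp
  simp only [this, mul_neg, smul_neg, smul_smul]
  ring

/-- The structure common to all schemes, on which the energy method rests. -/
theorem Scheme.pPoly_eq (S : Scheme) (a h : Fin n → ℝ) (ht : ℝ) :
    S.pPoly a h ht = S.bPoly a h ht + (ht ^ 2 / 12) • S.aPoly a h := by
  cases S
  case splitting => exact bBarPoly_eq a h ht
  all_goals rfl

end

end CompactWave

namespace CompactWave

noncomputable section

open MvPolynomial

/-! ### Positivity of polynomials in commuting symmetric operators -/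

section Spectral

variable {σ V : Type*} [NormedAddCommGroup V] [InnerProductSpace ℝ V]

theorem commAeval_isSymmetric (T : σ → Module.End ℝ V) (hT : ∀ i j, Commute (T i) (T j))
    (hsymm : ∀ i, (T i).IsSymmetric) (q : MvPolynomial σ ℝ) : (commAeval T hT q).IsSymmetric := by
  induction q using MvPolynomial.induction_on with
  | C c =>
    rw [← MvPolynomial.algebraMap_eq, AlgHom.commutes]
    intro v w
    simp [Module.algebraMap_end_apply, inner_smul_left, inner_smul_right]
  | add p q hp hq =>
    rw [map_add]
    exact hp.add hq
  | mul_X p i hp =>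
    rw [map_mul, commAeval_X]
    refine hp.mul_of_commute (hsymm i) ?_
    rw [← commAeval_X T hT i]
    exact (Commute.all p (X i)).map (commAeval T hT)

theorem commAeval_eigenvector (T : σ → Module.End ℝ V) (hT : ∀ i j, Commute (T i) (T j))
    (γ : σ → ℝ) {v : V} (hv : ∀ i, T i v = γ i • v) (q : MvPolynomial σ ℝ) :
    commAeval T hT q v = eval γ q • v := by
  induction q using MvPolynomial.induction_on with
  | C c =>
    rw [← MvPolynomial.algebraMap_eq, AlgHom.commutes]
    simp [Module.algebraMap_end_apply, MvPolynomial.algebraMap_eq]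
  | add p q hp hq => rw [map_add, LinearMap.add_apply, hp, hq, map_add, add_smul]
  | mul_X p i hp =>
    rw [map_mul, commAeval_X, Module.End.mul_apply, hv i, map_smul, hp, map_mul, eval_X, smul_smul,
      mul_comm]

/-- Commuting symmetric operators are simultaneously diagonalizable with orthogonal joint
eigenspaces, so the quadratic form is the sum of the squared norms of the components of `v`,
weighted with the values of `q` at the joint eigenvalues. -/
theorem inner_commAeval_nonneg [FiniteDimensional ℝ V] (T : σ → Module.End ℝ V)
    (hT : ∀ i j, Commute (T i) (T j)) (hsymm : ∀ i, (T i).IsSymmetric) {D : Set (σ → ℝ)}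
    (hD : ∀ γ : σ → ℝ, ∀ v : V, v ≠ 0 → (∀ i, T i v = γ i • v) → γ ∈ D)
    {q : MvPolynomial σ ℝ} (hq : ∀ γ ∈ D, 0 ≤ eval γ q) (v : V) :
    0 ≤ inner ℝ (commAeval T hT q v) v := by
  classical
  let G : (σ → ℝ) → Submodule ℝ V := fun γ => ⨅ i, Module.End.eigenspace (T i) (γ i)
  have hmem : ∀ γ, ∀ x : G γ, ∀ i, T i x = γ i • (x : V) := fun γ x i =>
    Module.End.mem_eigenspace_iff.1 ((Submodule.mem_iInf _).1 x.2 i)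
  have hv : v ∈ ⨆ γ, G γ := by
    rw [LinearMap.IsSymmetric.iSup_iInf_eq_top_of_commute hsymm fun i j _ => hT i j]
    trivial
  obtain ⟨x, rfl⟩ := (Submodule.mem_iSup_iff_exists_dfinsupp' G v).1 hv
  have hfam := LinearMap.IsSymmetric.orthogonalFamily_iInf_eigenspaces (T := T) hsymm
  have e1 : (x.sum fun _ y => (y : V)) = ∑ γ ∈ x.support, (G γ).subtypeₗᵢ (x γ) := rfl
  have e2 : commAeval T hT q (x.sum fun _ y => (y : V))
      = ∑ γ ∈ x.support, (G γ).subtypeₗᵢ (eval γ q • x γ) := by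
    rw [e1, map_sum]
    refine Finset.sum_congr rfl fun γ _ => ?_
    exact commAeval_eigenvector T hT γ (hmem γ (x γ)) q
  rw [e2, e1, hfam.inner_sum]
  refine Finset.sum_nonneg fun γ hγ => ?_
  rw [inner_smul_left]
  refine mul_nonneg ?_ real_inner_self_nonneg
  refine hq γ (hD γ (x γ) ?_ (hmem γ (x γ)))
  simpa using hγ

end Spectral

/-! ### Mesh operators on functions that vanish on the boundary -/

variable {n : ℕ}

/-- Multi-indices of the closed mesh that are internal in the directions of `J`. -/
def meshRegion (N : Fin n → ℕ) (J : Finset (Fin n)) : Set (Fin n → ℤ) :=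
  {k | ∀ l, (0 ≤ k l ∧ k l ≤ N l) ∧ (l ∈ J → 1 ≤ k l ∧ k l + 1 ≤ N l)}

theorem mem_meshRegion_empty {N : Fin n → ℕ} {k : Fin n → ℤ} :
    k ∈ meshRegion N ∅ ↔ k ∈ closedMesh N := by
  simp [meshRegion, closedMesh, Pi.le_def, forall_and]

theorem mem_meshRegion_univ {N : Fin n → ℕ} {k : Fin n → ℤ} :
    k ∈ meshRegion N Finset.univ ↔ k ∈ innerMesh N := by
  simp only [meshRegion, innerMesh, Finset.mem_Icc, Pi.le_def, Set.mem_ofPred_eq, Finset.mem_univ,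
    forall_true_left, ← forall_and]
  exact forall_congr' fun l => by omega

theorem meshRegion_anti {N : Fin n → ℕ} {J J' : Finset (Fin n)} (h : J ⊆ J') :
    meshRegion N J' ⊆ meshRegion N J :=
  fun _ hk l => ⟨(hk l).1, fun hl => (hk l).2 (h hl)⟩

theorem meshRegion_insert_step {N : Fin n → ℕ} {J : Finset (Fin n)} {l : Fin n} (hl : l ∉ J)
    {k : Fin n → ℤ} (hk : k ∈ meshRegion N (insert l J)) :
    k ∈ meshRegion N J ∧ k + Pi.single l 1 ∈ meshRegion N J ∧
      k - Pi.single l 1 ∈ meshRegion N J := by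
  refine ⟨meshRegion_anti (Finset.subset_insert l J) hk, fun j => ?_, fun j => ?_⟩ <;>
  · have hj := hk j
    by_cases h : j = l
    · subst h
      have := hj.2 (Finset.mem_insert_self j J)
      simp only [Pi.add_apply, Pi.sub_apply, Pi.single_eq_same]
      exact ⟨by omega, fun h => absurd h hl⟩
    · simp only [Pi.add_apply, Pi.sub_apply, Pi.single_eq_of_ne h, add_zero, sub_zero]
      exact ⟨hj.1, fun h' => hj.2 (Finset.mem_insert_of_mem h')⟩

/-- Functions on the internal mesh. -/
abbrev InnerFn (N : Fin n → ℕ) : Type := EuclideanSpace ℝ (innerMesh N)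

/-- Restriction of a mesh function to the internal mesh. -/
def resFn (N : Fin n → ℕ) : MeshFn n →ₗ[ℝ] InnerFn N where
  toFun w := WithLp.toLp 2 fun k => w k
  map_add' _ _ := rfl
  map_smul' _ _ := rfl

/-- Extension of a function on the internal mesh by zero. -/
def extFn (N : Fin n → ℕ) : InnerFn N →ₗ[ℝ] MeshFn n where
  toFun v := fun k => if hk : k ∈ innerMesh N then v ⟨k, hk⟩ else 0
  map_add' v w := by
    funext k
    by_cases hk : k ∈ innerMesh N <;> simp [hk]
  map_smul' c v := by
    funext k
    by_cases hk : k ∈ innerMesh N <;> simp [hk]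

@[simp] theorem resFn_apply (N : Fin n → ℕ) (w : MeshFn n) (k : innerMesh N) :
    resFn N w k = w k := rfl

theorem extFn_apply_mem {N : Fin n → ℕ} (v : InnerFn N) {k : Fin n → ℤ} (hk : k ∈ innerMesh N) :
    extFn N v k = v ⟨k, hk⟩ := dif_pos hk

theorem extFn_apply_notMem {N : Fin n → ℕ} (v : InnerFn N) {k : Fin n → ℤ}
    (hk : k ∉ innerMesh N) : extFn N v k = 0 := dif_neg hk

theorem extFn_resFn {N : Fin n → ℕ} {w : MeshFn n} (hw : ∀ k ∈ boundaryMesh N, w k = 0) :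
    ∀ k ∈ closedMesh N, w k = extFn N (resFn N w) k := by
  intro k hk
  by_cases h : k ∈ innerMesh N
  · rw [extFn_apply_mem _ h]; rfl
  · rw [extFn_apply_notMem _ h]
    exact hw k (Finset.mem_sdiff.2 ⟨hk, h⟩)

theorem resFn_extFn {N : Fin n → ℕ} (v : InnerFn N) : resFn N (extFn N v) = v := by
  ext k
  exact extFn_apply_mem v k.2

/-- The operator `Λ_l` with zero boundary values. -/
def lamInner (h : Fin n → ℝ) (N : Fin n → ℕ) (l : Fin n) : Module.End ℝ (InnerFn N) :=
  resFn N ∘ₗ lam h l ∘ₗ extFn N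

/-- If the node is not internal, some index in another direction lies on the boundary. Both
neighbours along `l` share that index, so all the values involved vanish. -/
theorem lam_extFn {h : Fin n → ℝ} {N : Fin n → ℕ} {l : Fin n} (v : InnerFn N) {k : Fin n → ℤ}
    (hk : k ∈ meshRegion N {l}) : lam h l (extFn N v) k = extFn N (lamInner h N l v) k := by
  by_cases hki : k ∈ innerMesh N
  · rw [extFn_apply_mem _ hki]; rfl
  · rw [extFn_apply_notMem _ hki]
    obtain ⟨j, hj⟩ : ∃ j, ¬ (1 ≤ k j ∧ k j + 1 ≤ N j) := by
      by_contra! hcon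
      exact hki (mem_meshRegion_univ.1 fun l => ⟨(hk l).1, fun _ => hcon l⟩)
    have hjl : j ≠ l := by
      rintro rfl
      exact hj ((hk j).2 (by simp))
    have hout : ∀ k' : Fin n → ℤ, k' j = k j → extFn N v k' = 0 := fun k' hk' => by
      refine extFn_apply_notMem _ fun hmem => hj ?_
      rw [← hk']
      exact (mem_meshRegion_univ.2 hmem j).2 (Finset.mem_univ j)
    simp only [lam, LinearMap.coe_mk, AddHom.coe_mk]
    rw [hout k rfl, hout _ (by simp [hjl]), hout _ (by simp [hjl])]
    simp

theorem lam_congr {h : Fin n → ℝ} {N : Fin n → ℕ} {J : Finset (Fin n)} {l : Fin n} (hl : l ∉ J)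
    {w w' : MeshFn n} (hw : ∀ k ∈ meshRegion N J, w k = w' k) {k : Fin n → ℤ}
    (hk : k ∈ meshRegion N (insert l J)) : lam h l w k = lam h l w' k := by
  obtain ⟨h0, h1, h2⟩ := meshRegion_insert_step hl hk
  simp only [lam, LinearMap.coe_mk, AddHom.coe_mk, hw _ h0, hw _ h1, hw _ h2]

/-- Products of one-dimensional operators in distinct directions agree with the products of the
operators with zero boundary values. -/
theorem prod_lam_eq_prod_lamInner {h : Fin n → ℝ} {N : Fin n → ℕ} (α β : Fin n → ℝ)
    (L : List (Fin n)) (hL : L.Nodup) {w : MeshFn n} {v : InnerFn N}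
    (hw : ∀ k ∈ closedMesh N, w k = extFn N v k) :
    ∀ k ∈ meshRegion N L.toFinset, (L.map fun l => α l • 1 + β l • lam h l).prod w k
      = extFn N ((L.map fun l => α l • 1 + β l • lamInner h N l).prod v) k := by
  induction L with
  | nil =>
    intro k hk
    simpa using hw k (mem_meshRegion_empty.1 (by simpa using hk))
  | cons l L ih =>
    intro k hk
    rw [List.nodup_cons] at hL
    rw [List.toFinset_cons] at hk
    have hl : l ∉ L.toFinset := by simpa using hL.1
    simp only [List.map_cons, List.prod_cons, Module.End.mul_apply, LinearMap.add_apply,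
      LinearMap.smul_apply, Module.End.one_apply, Pi.add_apply, Pi.smul_apply, map_add, map_smul]
    rw [ih hL.2 k (meshRegion_insert_step hl hk).1, lam_congr hl (ih hL.2) hk,
      lam_extFn _ (meshRegion_anti (by simp) hk)]

/-- The extension by zero between the two factors prevents a direct appeal to `lam_commute`; for
distinct directions that extension changes nothing at the nodes in use. -/
theorem lamInner_commute (h : Fin n → ℝ) (N : Fin n → ℕ) (i j : Fin n) :
    Commute (lamInner h N i) (lamInner h N j) := by
  by_cases hij : i = j
  · rw [hij]
  have key : ∀ i j : Fin n, i ≠ j → ∀ v : InnerFn N, ∀ k : innerMesh N,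
      (lamInner h N i * lamInner h N j) v k = (lam h i * lam h j) (extFn N v) k := by
    intro i j hij v k
    have := prod_lam_eq_prod_lamInner (h := h) (fun _ => 0) (fun _ => 1) [i, j] (by simpa using hij)
      (w := extFn N v) (v := v) (fun _ _ => rfl) k
      (meshRegion_anti (Finset.subset_univ _) (mem_meshRegion_univ.2 k.2))
    rw [extFn_apply_mem _ k.2] at this
    simpa using this.symm
  refine LinearMap.ext fun v => ?_
  ext k
  rw [key i j hij, key j i (Ne.symm hij), (lam_commute h i j).eq]

/-- The operator on functions on the internal mesh with a given symbol. -/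
def polyInner (h : Fin n → ℝ) (N : Fin n → ℕ) :
    MvPolynomial (Fin n) ℝ →ₐ[ℝ] Module.End ℝ (InnerFn N) :=
  commAeval (lamInner h N) (lamInner_commute h N)

/-- The polynomials whose mesh operators, on functions that vanish on the boundary of the mesh,
reduce to operators on functions on the internal mesh. -/
def compatible (h : Fin n → ℝ) (N : Fin n → ℕ) : Submodule ℝ (MvPolynomial (Fin n) ℝ) where
  carrier := {q | ∀ w : MeshFn n, (∀ k ∈ boundaryMesh N, w k = 0) →
    resFn N (polyOp h q w) = polyInner h N q (resFn N w)}
  add_mem' hp hq w hw := by simp [hp w hw, hq w hw]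
  zero_mem' w _ := by simp
  smul_mem' c q hq w hw := by simp [hq w hw]

theorem prod_mem_compatible (h : Fin n → ℝ) (N : Fin n → ℕ) (α β : Fin n → ℝ)
    (S : Finset (Fin n)) : ∏ l ∈ S, (α l • 1 + β l • X l) ∈ compatible h N := by
  intro w hw
  ext k
  rw [resFn_apply, polyOp, polyInner, commAeval_prod, commAeval_prod]
  have := prod_lam_eq_prod_lamInner (h := h) α β S.toList S.nodup_toList (extFn_resFn hw) k
    (meshRegion_anti (Finset.subset_univ _) (mem_meshRegion_univ.2 k.2))
  rw [extFn_apply_mem _ k.2] at this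
  simpa using this

/-- On disjoint index sets the coefficients can be merged by cases, which leaves a single product
with each direction used once. -/
theorem prod_mul_prod_mem_compatible (h : Fin n → ℝ) (N : Fin n → ℕ) (α β α' β' : Fin n → ℝ)
    {S S' : Finset (Fin n)} (hS : Disjoint S S') :
    (∏ l ∈ S, (α l • 1 + β l • X l)) * ∏ l ∈ S', (α' l • 1 + β' l • X l) ∈ compatible h N := by
  classical
  have h1 : ∏ l ∈ S, (α l • 1 + β l • X l : MvPolynomial (Fin n) ℝ)
      = ∏ l ∈ S, ((if l ∈ S then α l else α' l) • 1 + (if l ∈ S then β l else β' l) • X l) :=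
    Finset.prod_congr rfl fun l hl => by simp [hl]
  have h2 : ∏ l ∈ S', (α' l • 1 + β' l • X l : MvPolynomial (Fin n) ℝ)
      = ∏ l ∈ S', ((if l ∈ S then α l else α' l) • 1 + (if l ∈ S then β l else β' l) • X l) :=
    Finset.prod_congr rfl fun l hl => by simp [Finset.disjoint_right.1 hS hl]
  rw [h1, h2, ← Finset.prod_union hS]
  exact prod_mem_compatible h N _ _ _

theorem one_mem_compatible (h : Fin n → ℝ) (N : Fin n → ℕ) : 1 ∈ compatible h N := by
  simpa using prod_mem_compatible h N (fun _ => 0) (fun _ => 0) ∅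

theorem X_mem_compatible (h : Fin n → ℝ) (N : Fin n → ℕ) (i : Fin n) : X i ∈ compatible h N := by
  simpa using prod_mem_compatible h N (fun _ => 0) (fun _ => 1) {i}

theorem s1NPoly_eq (h : Fin n → ℝ) :
    s1NPoly h = fun k => (1 : ℝ) • (1 : MvPolynomial (Fin n) ℝ) + (h k ^ 2 / 12) • X k := by
  funext k
  rw [s1NPoly, one_smul]

theorem sBarPoly_mem (h : Fin n → ℝ) (N : Fin n → ℕ) : sBarPoly h ∈ compatible h N := by
  rw [sBarPoly, s1NPoly_eq]
  exact prod_mem_compatible h N (fun _ => 1) (fun k => h k ^ 2 / 12) _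

theorem sNPoly_mem (h : Fin n → ℝ) (N : Fin n → ℕ) : sNPoly h ∈ compatible h N :=
  add_mem (one_mem_compatible h N)
    (sum_mem fun i _ => Submodule.smul_mem _ _ (X_mem_compatible h N i))

theorem aBarPoly_mem (a h : Fin n → ℝ) (N : Fin n → ℕ) : aBarPoly a h ∈ compatible h N := by
  refine neg_mem (sum_mem fun i _ => Submodule.smul_mem _ _ ?_)
  rw [s1NPoly_eq]
  simpa using prod_mul_prod_mem_compatible h N (fun _ => 1) (fun k => h k ^ 2 / 12) (fun _ => 0)
    (fun _ => 1) (S := Finset.univ.erase i) (S' := {i}) (by simp)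

theorem aNPoly_mem (a h : Fin n → ℝ) (N : Fin n → ℕ) : aNPoly a h ∈ compatible h N := by
  refine neg_mem (sum_mem fun i _ => Submodule.smul_mem _ _ ?_)
  rw [add_mul, one_mul, Finset.sum_mul]
  refine add_mem (X_mem_compatible h N i) (sum_mem fun j hj => ?_)
  rw [smul_mul_assoc]
  refine Submodule.smul_mem _ _ ?_
  simpa using prod_mul_prod_mem_compatible h N (fun _ => 0) (fun k => 1) (fun _ => 0)
    (fun _ => 1) (S := {j}) (S' := {i}) (by simpa using Finset.ne_of_mem_erase hj)

theorem rPoly_mem (a h : Fin n → ℝ) (ht : ℝ) (N : Fin n → ℕ) : rPoly a h ht ∈ compatible h N := by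
  refine sum_mem fun S _ => Submodule.smul_mem _ _ ?_
  rw [s1NPoly_eq]
  simpa using prod_mul_prod_mem_compatible h N (fun _ => 1) (fun k => h k ^ 2 / 12) (fun _ => 0)
    (fun _ => -1) (S := Sᶜ) (S' := S) disjoint_compl_left

theorem Scheme.aPoly_mem (S : Scheme) (a h : Fin n → ℝ) (N : Fin n → ℕ) :
    S.aPoly a h ∈ compatible h N := by
  cases S
  exacts [aBarPoly_mem a h N, aNPoly_mem a h N, aNPoly_mem a h N, aBarPoly_mem a h N,
    aBarPoly_mem a h N]

theorem Scheme.bPoly_mem (S : Scheme) (a h : Fin n → ℝ) (ht : ℝ) (N : Fin n → ℕ) :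
    S.bPoly a h ht ∈ compatible h N := by
  cases S
  exacts [sBarPoly_mem h N, sNPoly_mem h N, sBarPoly_mem h N, sBarPoly_mem h N,
    add_mem (sBarPoly_mem h N) (rPoly_mem a h ht N)]

theorem Scheme.pPoly_mem (S : Scheme) (a h : Fin n → ℝ) (ht : ℝ) (N : Fin n → ℕ) :
    S.pPoly a h ht ∈ compatible h N := by
  rw [Scheme.pPoly_eq]
  exact add_mem (S.bPoly_mem a h ht N) (Submodule.smul_mem _ _ (S.aPoly_mem a h N))

/-! ### The spectrum of the second difference operators -/

theorem inner_resFn (N : Fin n → ℕ) (w w' : MeshFn n) :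
    inner ℝ (resFn N w) (resFn N w') = ∑ k ∈ innerMesh N, w k * w' k := by
  rw [PiLp.inner_apply, ← Finset.sum_coe_sort (innerMesh N)]
  refine Finset.sum_congr rfl fun k _ => ?_
  simp [mul_comm]

/-- Extension by zero turns both sides into sums over the whole lattice, which are invariant under
translation. -/
theorem sum_shift {N : Fin n → ℕ} (v v' : InnerFn N) (e : Fin n → ℤ) :
    ∑ k ∈ innerMesh N, extFn N v (k + e) * extFn N v' k
      = ∑ k ∈ innerMesh N, extFn N v k * extFn N v' (k - e) := by
  rw [← finsum_eq_sum_of_support_subset (s := innerMesh N)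
      (fun k => extFn N v (k + e) * extFn N v' k),
    ← finsum_eq_sum_of_support_subset (s := innerMesh N)
      (fun k => extFn N v k * extFn N v' (k - e)),
    ← finsum_comp_equiv (Equiv.addRight e) (f := fun k => extFn N v k * extFn N v' (k - e))]
  · simp
  · intro k hk
    by_contra hcon
    exact hk (by simp [extFn_apply_notMem v hcon])
  · intro k hk
    by_contra hcon
    exact hk (by simp [extFn_apply_notMem v' hcon])

theorem lamInner_isSymmetric (h : Fin n → ℝ) (N : Fin n → ℕ) (l : Fin n) :
    (lamInner h N l).IsSymmetric := by
  intro v v'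
  have h1 : inner ℝ (lamInner h N l v) v'
      = ∑ k ∈ innerMesh N, lam h l (extFn N v) k * extFn N v' k := by
    rw [← inner_resFn, resFn_extFn]; rfl
  have h2 : inner ℝ v (lamInner h N l v')
      = ∑ k ∈ innerMesh N, extFn N v k * lam h l (extFn N v') k := by
    rw [← inner_resFn, resFn_extFn]; rfl
  rw [h1, h2]
  have e1 := sum_shift v v' (Pi.single l 1)
  have e2 := sum_shift v v' (-Pi.single l 1)
  simp only [← sub_eq_add_neg, sub_neg_eq_add] at e2
  have l1 : ∀ k, lam h l (extFn N v) k * extFn N v' k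
      = (extFn N v (k + Pi.single l 1) * extFn N v' k - 2 * (extFn N v k * extFn N v' k)
        + extFn N v (k - Pi.single l 1) * extFn N v' k) / h l ^ 2 := fun k => by
    simp only [lam, LinearMap.coe_mk, AddHom.coe_mk]; ring
  have l2 : ∀ k, extFn N v k * lam h l (extFn N v') k
      = (extFn N v k * extFn N v' (k + Pi.single l 1) - 2 * (extFn N v k * extFn N v' k)
        + extFn N v k * extFn N v' (k - Pi.single l 1)) / h l ^ 2 := fun k => by
    simp only [lam, LinearMap.coe_mk, AddHom.coe_mk]; ring
  simp only [l1, l2, ← Finset.sum_div, Finset.sum_add_distrib, Finset.sum_sub_distrib, e1, e2]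
  ring

/-- At a node where `|v|` is maximal, `(h_l² γ + 2) v` is the sum of two neighbouring values,
neither larger in modulus; hence `|h_l² γ + 2| ≤ 2`. -/
theorem lamInner_eigenvalue {h : Fin n → ℝ} {N : Fin n → ℕ} {l : Fin n} (hl : 0 < h l) {γ : ℝ}
    {v : InnerFn N} (hv : v ≠ 0) (hγ : lamInner h N l v = γ • v) :
    -4 ≤ h l ^ 2 * γ ∧ h l ^ 2 * γ ≤ 0 := by
  obtain ⟨k₀, hk₀⟩ : ∃ k, v k ≠ 0 := by
    by_contra! hcon
    exact hv (by ext k; simpa using hcon k)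
  obtain ⟨k, -, hk⟩ := Finset.exists_max_image Finset.univ (fun k => |v k|) ⟨k₀, Finset.mem_univ _⟩
  have hpos : 0 < |v k| := (abs_pos.2 hk₀).trans_le (hk k₀ (Finset.mem_univ _))
  have hle : ∀ k', |extFn N v k'| ≤ |v k| := fun k' => by
    by_cases hk' : k' ∈ innerMesh N
    · rw [extFn_apply_mem _ hk']; exact hk _ (Finset.mem_univ _)
    · rw [extFn_apply_notMem _ hk', abs_zero]; exact hpos.le
  have heq : (extFn N v (k.1 + Pi.single l 1) - 2 * v k + extFn N v (k.1 - Pi.single l 1)) / h l ^ 2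
      = γ * v k := by
    have := congrArg (fun y : InnerFn N => y k) hγ
    simp only [lamInner, LinearMap.comp_apply, resFn_apply, lam, LinearMap.coe_mk,
      AddHom.coe_mk, extFn_apply_mem v k.2, PiLp.smul_apply, smul_eq_mul] at this
    exact this
  have hsum : (h l ^ 2 * γ + 2) * v k
      = extFn N v (k.1 + Pi.single l 1) + extFn N v (k.1 - Pi.single l 1) := by
    rw [div_eq_iff (by positivity)] at heq
    linarith
  have habs : |h l ^ 2 * γ + 2| * |v k| ≤ 2 * |v k| := by
    rw [← abs_mul, hsum]
    refine (abs_add_le _ _).trans ?_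
    linarith [hle (k.1 + Pi.single l 1), hle (k.1 - Pi.single l 1)]
  have := abs_le.1 (le_of_mul_le_mul_right habs hpos)
  constructor <;> linarith [this.1, this.2]

/-- A polynomial that is nonnegative on the box `∏ [-4 / h_l², 0]` defines a nonnegative
operator. -/
theorem inner_polyInner_nonneg {h : Fin n → ℝ} (hh : ∀ l, 0 < h l) (N : Fin n → ℕ)
    {q : MvPolynomial (Fin n) ℝ}
    (hq : ∀ γ : Fin n → ℝ, (∀ l, -4 ≤ h l ^ 2 * γ l ∧ h l ^ 2 * γ l ≤ 0) → 0 ≤ eval γ q)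
    (v : InnerFn N) : 0 ≤ inner ℝ (polyInner h N q v) v :=
  inner_commAeval_nonneg (lamInner h N) (lamInner_commute h N) (lamInner_isSymmetric h N)
    (D := {γ | ∀ l, -4 ≤ h l ^ 2 * γ l ∧ h l ^ 2 * γ l ≤ 0})
    (fun _ _ hv hγ l => lamInner_eigenvalue (hh l) hv (hγ l)) hq v

theorem polyInner_isSymmetric (h : Fin n → ℝ) (N : Fin n → ℕ) (q : MvPolynomial (Fin n) ℝ) :
    (polyInner h N q).IsSymmetric :=
  commAeval_isSymmetric _ _ (lamInner_isSymmetric h N) q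

end

end CompactWave

namespace CompactWave

noncomputable section

open MvPolynomial

/-! ### The energy estimate -/

/-- This amounts to cancelling `s + r` in `(s - r) (s + r) ≤ K (s + r)`; it is positive whenever the
conclusion fails. -/
theorem le_add_of_sq_sub_sq_le {r s K : ℝ} (hr : 0 ≤ r) (hK : 0 ≤ K)
    (h : s ^ 2 - r ^ 2 ≤ K * (s + r)) : s ≤ r + K := by
  by_contra! hcon
  nlinarith [mul_pos (by linarith : 0 < s - r - K) (by linarith : 0 < s + r)]

/-- Stability in the energy norm of a three-level method
`P Λ_t e + A e = ψ`, `P δ_t e⁰ = ψ⁰`, `e⁰ = 0`. -/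
theorem energy_le {V : Type*} [NormedAddCommGroup V] [InnerProductSpace ℝ V]
    {D A : Module.End ℝ V} (hDs : D.IsSymmetric) (hAs : A.IsSymmetric) {τ c Ψ : ℝ} (hτ : 0 < τ)
    (hc : 0 < c) (hΨ : 0 ≤ Ψ) (hD : ∀ v, c ^ 2 * ‖v‖ ^ 2 ≤ inner ℝ (D v) v)
    (hA : ∀ v, 0 ≤ inner ℝ (A v) v) (e : ℕ → V) (M : ℕ) (he : e 0 = 0)
    (h0 : ‖(D + (τ ^ 2 / 4) • A) (τ⁻¹ • (e 1 - e 0))‖ ≤ Ψ)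
    (hstep : ∀ j, j + 2 ≤ M →
      ‖(D + (τ ^ 2 / 4) • A) ((τ ^ 2)⁻¹ • (e (j + 2) - (2 : ℝ) • e (j + 1) + e j))
        + A (e (j + 1))‖ ≤ Ψ) (j : ℕ) (hj : j + 1 ≤ M) :
    inner ℝ (D (τ⁻¹ • (e (j + 1) - e j))) (τ⁻¹ • (e (j + 1) - e j))
      + inner ℝ (A ((2 : ℝ)⁻¹ • (e j + e (j + 1)))) ((2 : ℝ)⁻¹ • (e j + e (j + 1)))
      ≤ (Ψ / c * (1 + j * τ)) ^ 2 := by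
  set x : ℕ → V := fun j => τ⁻¹ • (e (j + 1) - e j) with hx
  set s : ℕ → V := fun j => (2 : ℝ)⁻¹ • (e j + e (j + 1)) with hs
  set E : ℕ → ℝ := fun j => inner ℝ (D (x j)) (x j) + inner ℝ (A (s j)) (s j) with hE
  have hxE : ∀ j, c * ‖x j‖ ≤ √(E j) := fun j => by
    refine Real.le_sqrt_of_sq_le ?_
    rw [mul_pow]
    linarith [hD (x j), hA (s j)]
  have hE0 : ∀ j, 0 ≤ E j := fun j =>
    add_nonneg (le_trans (by positivity) (hD (x j))) (hA (s j))
  have key : √(E j) ≤ Ψ / c * (1 + j * τ) := by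
    induction j with
    | zero =>
      -- Since `e 0 = 0`, the initial energy is the quadratic form of `D + (τ²/4) A` at `x 0`, which
      -- the first hypothesis on the residual controls.
      have hs0 : s 0 = (τ / 2) • x 0 := by
        simp only [hs, hx, he, smul_smul]
        rw [zero_add, sub_zero]
        congr 1
        field_simp
      have h1 : E 0 = inner ℝ ((D + (τ ^ 2 / 4) • A) (x 0)) (x 0) := by
        simp only [hE, hs0, map_smul, inner_smul_left, inner_smul_right, LinearMap.add_apply,
          LinearMap.smul_apply, inner_add_left, RCLike.conj_to_real]
        ring
      have h2 : √(E 0) ^ 2 ≤ Ψ * ‖x 0‖ := by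
        rw [Real.sq_sqrt (hE0 0), h1]
        refine (real_inner_le_norm _ _).trans ?_
        gcongr
      have h3 : ‖x 0‖ ≤ √(E 0) / c := by
        rw [le_div_iff₀ hc]; linarith [hxE 0]
      have h4 : √(E 0) ^ 2 - (0 : ℝ) ^ 2 ≤ Ψ / c * (√(E 0) + 0) := by
        have := mul_le_mul_of_nonneg_left h3 hΨ
        calc √(E 0) ^ 2 - (0 : ℝ) ^ 2 ≤ Ψ * (√(E 0) / c) := by linarith
          _ = _ := by ring
      simpa using le_add_of_sq_sub_sq_le le_rfl (by positivity) h4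
    | succ j ih =>
      have ih' := ih (by omega)
      set ψ := (D + (τ ^ 2 / 4) • A) ((τ ^ 2)⁻¹ • (e (j + 2) - (2 : ℝ) • e (j + 1) + e j))
        + A (e (j + 1)) with hψ
      have hτ' := hτ.ne'
      have e1 : (τ ^ 2)⁻¹ • (e (j + 2) - (2 : ℝ) • e (j + 1) + e j) = τ⁻¹ • (x (j + 1) - x j) := by
        simp only [hx, ← smul_sub, smul_smul, pow_two, mul_inv]
        congr 1
        module
      -- The part `(τ²/4) A` of the upper operator joins `A (e (j + 1))`, so that `A` acts on the
      -- mean of two half-level averages.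
      have e2 : e (j + 1) + (τ ^ 2 / 4) • (τ ^ 2)⁻¹ • (e (j + 2) - (2 : ℝ) • e (j + 1) + e j)
          = (2 : ℝ)⁻¹ • (s (j + 1) + s j) := by
        rw [smul_smul, show τ ^ 2 / 4 * (τ ^ 2)⁻¹ = 4⁻¹ by field_simp]
        simp only [hs]
        module
      have e3 : ψ = τ⁻¹ • D (x (j + 1) - x j) + (2 : ℝ)⁻¹ • A (s (j + 1) + s j) := by
        rw [← map_smul A, ← e2, map_add, map_smul A, hψ, LinearMap.add_apply, LinearMap.smul_apply,
          e1, map_smul D]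
        abel
      -- The test vector is written in two ways, one for the `D` part of `ψ` and one for the `A`
      -- part; by symmetry each pairing is then a difference of two values of a quadratic form.
      have d1 : e (j + 2) - e j = τ • (x (j + 1) + x j) := by
        simp only [hx, ← smul_add, smul_smul, mul_inv_cancel₀ hτ', one_smul]
        abel
      have d2 : e (j + 2) - e j = (2 : ℝ) • (s (j + 1) - s j) := by
        simp only [hs]
        module
      have hid : E (j + 1) - E j = inner ℝ ψ (e (j + 2) - e j) := by
        have h1 : inner ℝ (D (x (j + 1))) (x j) = inner ℝ (D (x j)) (x (j + 1)) := by
          rw [hDs, real_inner_comm]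
        have h2 : inner ℝ (A (s (j + 1))) (s j) = inner ℝ (A (s j)) (s (j + 1)) := by
          rw [hAs, real_inner_comm]
        rw [e3, inner_add_left]
        nth_rewrite 1 [d1]
        rw [d2]
        simp only [hE, map_sub, map_add, inner_smul_left, inner_smul_right, inner_add_left,
          inner_add_right, inner_sub_left, inner_sub_right, RCLike.conj_to_real, h1, h2]
        field_simp
        ring
      have hle : E (j + 1) - E j ≤ Ψ * (τ * (‖x (j + 1)‖ + ‖x j‖)) := by
        rw [hid]
        refine (real_inner_le_norm _ _).trans ?_
        refine mul_le_mul (hstep j hj) ?_ (norm_nonneg _) hΨ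
        rw [d1, norm_smul, Real.norm_of_nonneg hτ.le]
        gcongr
        exact norm_add_le _ _
      have hsum : ‖x (j + 1)‖ + ‖x j‖ ≤ (√(E (j + 1)) + √(E j)) / c := by
        rw [le_div_iff₀ hc]
        linarith [hxE (j + 1), hxE j]
      have hfin : √(E (j + 1)) ^ 2 - √(E j) ^ 2 ≤ Ψ / c * τ * (√(E (j + 1)) + √(E j)) := by
        rw [Real.sq_sqrt (hE0 _), Real.sq_sqrt (hE0 _)]
        calc E (j + 1) - E j ≤ Ψ * (τ * (‖x (j + 1)‖ + ‖x j‖)) := hle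
          _ ≤ Ψ * (τ * ((√(E (j + 1)) + √(E j)) / c)) := by gcongr
          _ = _ := by ring
      have := le_add_of_sq_sub_sq_le (Real.sqrt_nonneg _) (by positivity) hfin
      push_cast
      linarith
  calc E j = √(E j) ^ 2 := (Real.sq_sqrt (hE0 j)).symm
    _ ≤ _ := pow_le_pow_left₀ (Real.sqrt_nonneg _) key 2

/-! ### Inequalities between the symbols -/

variable {n : ℕ} {a h : Fin n → ℝ} {ht : ℝ} {γ : Fin n → ℝ}

theorem eval_s1NPoly (k : Fin n) : eval γ (s1NPoly h k) = 1 + h k ^ 2 / 12 * γ k := by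
  simp [s1NPoly, smul_eval]

theorem eval_s1NPoly_ge (hγ : ∀ l, -4 ≤ h l ^ 2 * γ l ∧ h l ^ 2 * γ l ≤ 0) (k : Fin n) :
    2 / 3 ≤ eval γ (s1NPoly h k) := by
  rw [eval_s1NPoly]
  linarith [(hγ k).1]

theorem symbol_nonpos (hh : ∀ l, 0 < h l) (hγ : ∀ l, -4 ≤ h l ^ 2 * γ l ∧ h l ^ 2 * γ l ≤ 0)
    (k : Fin n) : γ k ≤ 0 :=
  nonpos_of_mul_nonpos_right (hγ k).2 (pow_pos (hh k) 2)

theorem prod_s1NPoly_nonneg (hγ : ∀ l, -4 ≤ h l ^ 2 * γ l ∧ h l ^ 2 * γ l ≤ 0)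
    (S : Finset (Fin n)) : 0 ≤ ∏ k ∈ S, eval γ (s1NPoly h k) :=
  Finset.prod_nonneg fun k _ => le_trans (by norm_num) (eval_s1NPoly_ge hγ k)

theorem eval_aBarPoly : eval γ (aBarPoly a h)
    = ∑ i, a i ^ 2 * ((∏ k ∈ Finset.univ.erase i, eval γ (s1NPoly h k)) * -γ i) := by
  simp [aBarPoly, smul_eval]

theorem eval_aNPoly : eval γ (aNPoly a h)
    = ∑ i, a i ^ 2 * ((1 + ∑ j ∈ Finset.univ.erase i, h j ^ 2 / 12 * γ j) * -γ i) := by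
  simp [aNPoly, smul_eval]

theorem eval_sBarPoly : eval γ (sBarPoly h) = ∏ k, eval γ (s1NPoly h k) := by
  simp [sBarPoly]

theorem eval_sNPoly : eval γ (sNPoly h) = 1 + ∑ i, h i ^ 2 / 12 * γ i := by
  simp [sNPoly, smul_eval]

theorem eval_rPoly_nonneg (hh : ∀ l, 0 < h l)
    (hγ : ∀ l, -4 ≤ h l ^ 2 * γ l ∧ h l ^ 2 * γ l ≤ 0) : 0 ≤ eval γ (rPoly a h ht) := by
  rw [rPoly, map_sum]
  refine Finset.sum_nonneg fun S _ => ?_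
  simp only [smul_eval, map_mul, map_prod, map_neg, eval_X]
  refine mul_nonneg (by positivity) (mul_nonneg (prod_s1NPoly_nonneg hγ _) ?_)
  exact Finset.prod_nonneg fun i _ => neg_nonneg.2 (symbol_nonpos hh hγ i)

theorem eval_aBarPoly_nonneg (hh : ∀ l, 0 < h l)
    (hγ : ∀ l, -4 ≤ h l ^ 2 * γ l ∧ h l ^ 2 * γ l ≤ 0) : 0 ≤ eval γ (aBarPoly a h) := by
  rw [eval_aBarPoly]
  exact Finset.sum_nonneg fun i _ => mul_nonneg (sq_nonneg _)
    (mul_nonneg (prod_s1NPoly_nonneg hγ _) (neg_nonneg.2 (symbol_nonpos hh hγ i)))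

theorem eval_aNPoly_nonneg (hn : n ≤ 4) (hh : ∀ l, 0 < h l)
    (hγ : ∀ l, -4 ≤ h l ^ 2 * γ l ∧ h l ^ 2 * γ l ≤ 0) : 0 ≤ eval γ (aNPoly a h) := by
  rw [eval_aNPoly]
  refine Finset.sum_nonneg fun i _ => mul_nonneg (sq_nonneg _)
    (mul_nonneg ?_ (neg_nonneg.2 (symbol_nonpos hh hγ i)))
  -- Each of the `n - 1` terms is at least `-4/12`, so the bracket stays nonnegative as long as `n ≤
  -- 4`.
  have h1 : (Finset.univ.erase i).card • (-(1 / 3) : ℝ)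
      ≤ ∑ j ∈ Finset.univ.erase i, h j ^ 2 / 12 * γ j :=
    Finset.card_nsmul_le_sum _ _ _ fun j _ => by linarith [(hγ j).1]
  rw [Finset.card_erase_of_mem (Finset.mem_univ i), Finset.card_univ, Fintype.card_fin,
    nsmul_eq_mul] at h1
  have h2 : ((n - 1 : ℕ) : ℝ) ≤ 3 := by exact_mod_cast (by omega : n - 1 ≤ 3)
  linarith

/-- The product over `S` is at most 1, so the new factor `1 + y i` lowers it by no more than `-y i`.
-/
theorem one_add_sum_le_prod_one_add_of_neg {ι : Type*} (S : Finset ι) (y : ι → ℝ)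
    (hy : ∀ i, -1 ≤ y i ∧ y i ≤ 0) :
    1 + ∑ i ∈ S, y i ≤ ∏ i ∈ S, (1 + y i) := by
  classical
  induction S using Finset.induction_on with
  | empty => simp
  | insert i S hi ih =>
    rw [Finset.sum_insert hi, Finset.prod_insert hi]
    have h1 : ∏ i ∈ S, (1 + y i) ≤ 1 :=
      Finset.prod_le_one (fun i _ => by linarith [(hy i).1]) fun i _ => by linarith [(hy i).2]
    nlinarith [(hy i).1, (hy i).2]

/-- Carries the bound by `s̄_N` over to the scheme `mixed`, which combines `A_N` with `s̄_N`. -/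
theorem eval_aNPoly_le (hh : ∀ l, 0 < h l)
    (hγ : ∀ l, -4 ≤ h l ^ 2 * γ l ∧ h l ^ 2 * γ l ≤ 0) :
    eval γ (aNPoly a h) ≤ eval γ (aBarPoly a h) := by
  rw [eval_aNPoly, eval_aBarPoly]
  refine Finset.sum_le_sum fun i _ => mul_le_mul_of_nonneg_left
    (mul_le_mul_of_nonneg_right ?_ (neg_nonneg.2 (symbol_nonpos hh hγ i))) (sq_nonneg _)
  simp only [eval_s1NPoly]
  exact one_add_sum_le_prod_one_add_of_neg _ _ fun j =>
    ⟨by linarith [(hγ j).1], by linarith [(hγ j).2]⟩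

theorem eval_aBarPoly_le (hh : ∀ l, 0 < h l)
    (hγ : ∀ l, -4 ≤ h l ^ 2 * γ l ∧ h l ^ 2 * γ l ≤ 0) :
    eval γ (aBarPoly a h) ≤ 6 * (∑ i, a i ^ 2 / h i ^ 2) * eval γ (sBarPoly h) := by
  rw [eval_aBarPoly, eval_sBarPoly, mul_assoc, Finset.sum_mul, Finset.mul_sum]
  refine Finset.sum_le_sum fun i _ => ?_
  rw [← Finset.mul_prod_erase Finset.univ _ (Finset.mem_univ i)]
  set q := ∏ k ∈ Finset.univ.erase i, eval γ (s1NPoly h k) with hq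
  have hq0 : 0 ≤ q := prod_s1NPoly_nonneg hγ _
  have hpos := pow_pos (hh i) 2
  -- Equality holds at `h_i² γ_i = -4`; this is the origin of the constant 6.
  have h1 : -γ i ≤ 6 / h i ^ 2 * eval γ (s1NPoly h i) := by
    rw [div_mul_eq_mul_div, le_div_iff₀ hpos, eval_s1NPoly]
    linarith [(hγ i).1]
  calc a i ^ 2 * (q * -γ i) ≤ a i ^ 2 * (q * (6 / h i ^ 2 * eval γ (s1NPoly h i))) := by gcongr
    _ = _ := by ring

/-- Each factor is even at least `2/3`. The weaker base `1/3` also serves `s_N` for `n = 2`, whose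
lower bound `1/3` is below `(2/3)²`. -/
theorem eval_sBarPoly_ge (hγ : ∀ l, -4 ≤ h l ^ 2 * γ l ∧ h l ^ 2 * γ l ≤ 0) :
    (1 / 3 : ℝ) ^ n ≤ eval γ (sBarPoly h) := by
  rw [eval_sBarPoly]
  calc (1 / 3 : ℝ) ^ n = ∏ _k : Fin n, (1 / 3 : ℝ) := by simp
    _ ≤ _ := Finset.prod_le_prod (fun _ _ => by norm_num) fun k _ =>
      le_trans (by norm_num) (eval_s1NPoly_ge hγ k)

/-! ### Symbol inequalities for the individual schemes. -/

namespace Scheme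

variable {S : Scheme}

theorem eval_aPoly_nonneg (hS : S.Admissible n) (hh : ∀ l, 0 < h l)
    (hγ : ∀ l, -4 ≤ h l ^ 2 * γ l ∧ h l ^ 2 * γ l ≤ 0) : 0 ≤ eval γ (S.aPoly a h) := by
  cases S
  case plain => exact eval_aNPoly_nonneg (by simp only [Admissible] at hS; omega) hh hγ
  case mixed => exact eval_aNPoly_nonneg (by simp only [Admissible] at hS; omega) hh hγ
  all_goals exact eval_aBarPoly_nonneg hh hγ

theorem eval_bPoly_ge (hS : S.Admissible n) (hh : ∀ l, 0 < h l)
    (hγ : ∀ l, -4 ≤ h l ^ 2 * γ l ∧ h l ^ 2 * γ l ≤ 0) :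
    (1 / 3 : ℝ) ^ n ≤ eval γ (S.bPoly a h ht) := by
  cases S
  case plain =>
    obtain rfl : n = 2 := hS
    simp only [bPoly, eval_sNPoly, Fin.sum_univ_two]
    linarith [(hγ 0).1, (hγ 1).1]
  case splitting =>
    rw [bPoly, map_add]
    linarith [eval_sBarPoly_ge hγ, eval_rPoly_nonneg (a := a) (ht := ht) hh hγ]
  all_goals exact eval_sBarPoly_ge hγ

/-- Multiplied by `h_t²/6` and combined with the step condition, this gives `(h_t²/6) A_h ≤ (1 -
ε_0²) B_h`, the coercivity needed in the energy estimate. -/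
theorem eval_aPoly_le (hS : S.Admissible n) (hh : ∀ l, 0 < h l)
    (hγ : ∀ l, -4 ≤ h l ^ 2 * γ l ∧ h l ^ 2 * γ l ≤ 0) :
    eval γ (S.aPoly a h) ≤ 6 * (S.C0 * ∑ i, a i ^ 2 / h i ^ 2) * eval γ (S.bPoly a h ht) := by
  cases S
  case plain =>
    obtain rfl : n = 2 := hS
    have h01 : (Finset.univ.erase 0 : Finset (Fin 2)) = {1} := by decide
    have h10 : (Finset.univ.erase 1 : Finset (Fin 2)) = {0} := by decide
    simp only [aPoly, bPoly, eval_sNPoly, eval_aNPoly, Fin.sum_univ_two, C0, h01, h10,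
      Finset.sum_singleton]
    -- Here `c = h_i²`, and `y` is the contribution of the other direction. Equality holds at `c x =
    -- -4`, `y = -1/3`, and `8 = 6 · 4/3` accounts for `C_0 = 4/3`.
    have key : ∀ x y c : ℝ, 0 < c → (-4 ≤ c * x ∧ c * x ≤ 0) → (-1 / 3 ≤ y ∧ y ≤ 0) →
        (1 + y) * -x ≤ 8 / c * (1 + (c / 12 * x + y)) := by
      intro x y c hc hx hy
      rw [div_mul_eq_mul_div, le_div_iff₀ hc]
      nlinarith [mul_nonneg (by linarith [hx.1] : 0 ≤ c * x + 4)
        (by linarith [hy.1] : 0 ≤ y + 1 / 3)]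
    have k0 := key (γ 0) (h 1 ^ 2 / 12 * γ 1) (h 0 ^ 2) (pow_pos (hh 0) 2) (hγ 0)
      ⟨by linarith [(hγ 1).1], by linarith [(hγ 1).2]⟩
    have k1 := key (γ 1) (h 0 ^ 2 / 12 * γ 0) (h 1 ^ 2) (pow_pos (hh 1) 2) (hγ 1)
      ⟨by linarith [(hγ 0).1], by linarith [(hγ 0).2]⟩
    have k0' := mul_le_mul_of_nonneg_left k0 (sq_nonneg (a 0))
    have k1' := mul_le_mul_of_nonneg_left k1 (sq_nonneg (a 1))
    refine (add_le_add k0' k1').trans (le_of_eq ?_)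
    ring
  -- The symbol of `R` is nonnegative, so `R` only enlarges the right-hand side.
  case splitting =>
    have h1 := eval_aBarPoly_le (a := a) hh hγ
    have h2 := eval_rPoly_nonneg (a := a) (ht := ht) hh hγ
    have h3 : 0 ≤ ∑ i, a i ^ 2 / h i ^ 2 := Finset.sum_nonneg fun i _ => by positivity
    simp only [aPoly, bPoly, C0, map_add, one_mul]
    nlinarith [mul_nonneg h3 h2]
  case mixed =>
    simp only [aPoly, bPoly, C0, one_mul]
    exact (eval_aNPoly_le hh hγ).trans (eval_aBarPoly_le hh hγ)
  all_goals
    simp only [aPoly, bPoly, C0, one_mul]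
    exact eval_aBarPoly_le hh hγ

end Scheme

end

end CompactWave

namespace CompactWave

noncomputable section

open Set Function

/-! ### Consistency: expansions at a point -/

section Aux

theorem abs_mul_le_mul {c x c' x' : ℝ} (hc : 0 ≤ c) (hcc : c ≤ c') (hx : |x| ≤ x') :
    |c * x| ≤ c' * x' := by
  rw [abs_mul, abs_of_nonneg hc]
  exact mul_le_mul hcc hx (abs_nonneg _) (hc.trans hcc)

theorem abs_sum_le_card_mul {ι : Type*} (s : Finset ι) {x : ι → ℝ} {K : ℝ}
    (hx : ∀ i ∈ s, |x i| ≤ K) : |∑ i ∈ s, x i| ≤ s.card * K := by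
  refine (Finset.abs_sum_le_sum_abs _ _).trans ?_
  rw [← nsmul_eq_mul]
  exact Finset.sum_le_card_nsmul _ _ _ hx

theorem sum_erase_le {n : ℕ} (i : Fin n) {x : Fin n → ℝ} {K : ℝ} (hK : 0 ≤ K)
    (hx : ∀ j ∈ Finset.univ.erase i, |x j| ≤ K) : |∑ j ∈ Finset.univ.erase i, x j| ≤ n * K := by
  refine (abs_sum_le_card_mul _ hx).trans ?_
  gcongr
  exact (Finset.card_le_univ _).trans (by simp)

end Aux

/-! ### Linearity and commutation of difference quotients and derivatives. -/

section Linear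

variable {ι : Type*} [DecidableEq ι] {η Y : ι → ℝ}

theorem sd_sub (d : ι) (w w' : (ι → ℝ) → ℝ) : sd η d (w - w') = sd η d w - sd η d w' := by
  funext p; simp only [sd, Pi.sub_apply]; ring

theorem sd_smul (d : ι) (c : ℝ) (w : (ι → ℝ) → ℝ) : sd η d (c • w) = c • sd η d w := by
  funext p; simp only [sd, Pi.smul_apply, smul_eq_mul]; ring

theorem sd_sum (d : ι) {κ : Type*} (s : Finset κ) (w : κ → (ι → ℝ) → ℝ) :
    sd η d (∑ i ∈ s, w i) = ∑ i ∈ s, sd η d (w i) := by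
  funext p
  simp only [sd, Finset.sum_apply, Finset.mul_sum, ← Finset.sum_sub_distrib,
    ← Finset.sum_add_distrib, Finset.sum_div]

theorem sd_comm {d e : ι} (hde : d ≠ e) (w : (ι → ℝ) → ℝ) :
    sd η d (sd η e w) = sd η e (sd η d w) := by
  funext p
  simp only [sd, update_of_ne hde, update_of_ne hde.symm, update_comm hde]
  ring

theorem fdq_sd_comm {d e : ι} (hde : d ≠ e) (w : (ι → ℝ) → ℝ) :
    sd η d (fdq η e w) = fdq η e (sd η d w) := by
  funext p
  simp only [sd, fdq, update_of_ne hde, update_of_ne hde.symm, update_comm hde]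
  ring

theorem Jet.abs_fdq_sdL_le {C : ℝ} (hη : ∀ d, 0 < η d) {l : List ι} {d : ι} (hl : l.Nodup)
    (hd : d ∉ l) {w : (ι → ℝ) → ℝ} (h : Jet Y C (2 * l.length + 1) w) {p : ι → ℝ}
    (hp : p ∈ region Y η l.toFinset) (hpd : p d + η d ∈ Icc 0 (Y d)) :
    |fdq η d (sdL η l w) p| ≤ 2 ^ l.length * C := by
  have e1 := taylor_region (by simpa using hd) 1
    (fun j => sdL η l ((partialD Y d)^[j] w))
    (fun j hj => sdL_chain hη hl hd h j (by omega))
    (Jet.abs_sdL_le hη l hl (h.iterate 1)) hp hpd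
  have hpos := hη d
  rw [fdq, abs_div, abs_of_pos hpos, div_le_iff₀ hpos]
  simpa [abs_of_pos hpos] using e1

theorem HasPartial.eqOn {d : ι} (hd : 0 < Y d) {w w' : (ι → ℝ) → ℝ}
    (h : HasPartial Y d (cbox Y) w w') : EqOn (partialD Y d w) w' (cbox Y) :=
  fun p hp => (h p hp).derivWithin (uniqueDiffOn_Icc hd _ (hp d trivial))

theorem HasPartial.sub {d : ι} {s : Set (ι → ℝ)} {w w' v v' : (ι → ℝ) → ℝ}
    (h : HasPartial Y d s w w') (h' : HasPartial Y d s v v') :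
    HasPartial Y d s (w - v) (w' - v') := fun p hp => (h p hp).sub (h' p hp)

theorem HasPartial.smul {d : ι} {s : Set (ι → ℝ)} {w w' : (ι → ℝ) → ℝ} (c : ℝ)
    (h : HasPartial Y d s w w') : HasPartial Y d s (c • w) (c • w') :=
  fun p hp => (h p hp).const_mul c

theorem HasPartial.sum {d : ι} {s : Set (ι → ℝ)} {κ : Type*} (t : Finset κ)
    {w w' : κ → (ι → ℝ) → ℝ} (h : ∀ i ∈ t, HasPartial Y d s (w i) (w' i)) :
    HasPartial Y d s (∑ i ∈ t, w i) (∑ i ∈ t, w' i) := fun p hp => by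
  have := HasDerivWithinAt.fun_sum fun i hi => h i hi p hp
  simpa only [Finset.sum_apply] using this

theorem partialD_partialD_comm [Fintype ι] (hY : ∀ d, 0 < Y d) {w : (ι → ℝ) → ℝ}
    (hw : ContDiffOn ℝ 3 w (cbox Y)) (d e : ι) :
    EqOn (partialD Y d (partialD Y e (partialD Y e w)))
      (partialD Y e (partialD Y e (partialD Y d w))) (cbox Y) := by
  have h1 : ContDiffOn ℝ 2 (partialD Y e w) (cbox Y) := by
    exact_mod_cast contDiffOn_partialD hY (k := 2) (by exact_mod_cast hw) e
  exact (partialD_comm hY h1 d e).trans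
    (partialD_congr (partialD_comm hY (hw.of_le (by norm_num)) d e))

end Linear

/-! ### Algebra of the wave operator and of the residuals. -/

variable {n : ℕ} {a X : Fin n → ℝ} {T : ℝ}

theorem waveOp_eq (a X : Fin n → ℝ) (T : ℝ) (w : (Option (Fin n) → ℝ) → ℝ) : waveOp a X T w
    = (partialD (stBox X T) none)^[2] w
      - ∑ i, a i ^ 2 • (partialD (stBox X T) (some i))^[2] w := by
  funext p
  simp [waveOp]

theorem sd_waveOp (η : Option (Fin n) → ℝ) (d : Option (Fin n)) (w : (Option (Fin n) → ℝ) → ℝ)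
    (p : Option (Fin n) → ℝ) : sd η d (waveOp a X T w) p
    = sd η d ((partialD (stBox X T) none)^[2] w) p
      - ∑ i, a i ^ 2 * sd η d ((partialD (stBox X T) (some i))^[2] w) p := by
  simp only [waveOp_eq, sd_sub, sd_sum, sd_smul, Pi.sub_apply, Finset.sum_apply, Pi.smul_apply,
    smul_eq_mul]

theorem partialD_waveOp (hX : ∀ i, 0 < X i) (hT : 0 < T) {w : (Option (Fin n) → ℝ) → ℝ}
    {k : ℕ} (hw : ContDiffOn ℝ (k + 3 : ℕ) w (cbox (stBox X T))) :
    EqOn (partialD (stBox X T) none (waveOp a X T w))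
      (waveOp a X T (partialD (stBox X T) none w)) (cbox (stBox X T)) := by
  have hY := stBox_pos hX hT
  have hw3 : ContDiffOn ℝ 3 w (cbox (stBox X T)) := hw.of_le (by norm_cast; omega)
  obtain ⟨C, hC⟩ := exists_jet hY 3 (by exact_mod_cast hw3)
  have h1 : ∀ d, HasPartial (stBox X T) none (cbox (stBox X T))
      ((partialD (stBox X T) d)^[2] w)
      (partialD (stBox X T) none ((partialD (stBox X T) d)^[2] w)) := fun d =>
    (Jet.iterate (k := 1) 2 hC).hasPartial none
  have h2 := HasPartial.eqOn (hY none)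
    ((h1 none).sub (HasPartial.sum Finset.univ fun i _ => (h1 (some i)).smul (a i ^ 2)))
  rw [← waveOp_eq] at h2
  intro p hp
  rw [h2 hp]
  simp only [waveOp, Pi.sub_apply, Finset.sum_apply, Pi.smul_apply, smul_eq_mul,
    iterate_succ, iterate_zero, comp_apply, id_eq]
  congr 1
  refine Finset.sum_congr rfl fun i _ => ?_
  rw [partialD_partialD_comm hY hw3 none (some i) hp]

theorem sum_mul_sum_eq_diag_add_erase (w A : Fin n → ℝ) (s : Fin n → Fin n → ℝ) :
    ∑ j, w j * ∑ i, A i * s j i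
      = ∑ i, A i * (w i * s i i + ∑ j ∈ Finset.univ.erase i, w j * s j i) := by
  have h : ∀ i, w i * s i i + ∑ j ∈ Finset.univ.erase i, w j * s j i = ∑ j, w j * s j i :=
    fun i => Finset.add_sum_erase _ (fun j => w j * s j i) (Finset.mem_univ i)
  simp only [h, Finset.mul_sum]
  rw [Finset.sum_comm]
  exact Finset.sum_congr rfl fun i _ => Finset.sum_congr rfl fun j _ => by ring

/-- The letters are values at one point: `s` marks a difference quotient, `d` a derivative, and `w
i`, `τ`, `A i` stand for `h_i²/12`, `h_t²/12`, `a_i²`. The diagonal of the double sum `sdii`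
supplies the correction of `Λ_i u` by the fourth derivative, its off-diagonal part matches `Λ_j Λ_i
u`; the fourth derivatives inserted on the right cancel. Every bracket on the right is then an error
of replacing a quotient by derivatives. -/
theorem residual_identity (st dtt d4t stdtt τ : ℝ)
    (w A sit si sdtt dii d4 stdii : Fin n → ℝ) (sij sdii : Fin n → Fin n → ℝ) :
    st + ∑ i, (w i - τ * A i) * sit i
      + (-∑ i, A i * (si i + ∑ j ∈ Finset.univ.erase i, w j * sij j i))
      - ((dtt - ∑ i, A i * dii i) + τ * (stdtt - ∑ i, A i * stdii i)
        + ∑ j, w j * (sdtt j - ∑ i, A i * sdii j i))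
    = ((st - dtt - τ * d4t) - τ * (stdtt - d4t)) + ∑ i, w i * (sit i - sdtt i)
      - τ * ∑ i, A i * (sit i - stdii i)
      - ∑ i, A i * (((si i - dii i - w i * d4 i) - w i * (sdii i i - d4 i))
        + ∑ j ∈ Finset.univ.erase i, w j * (sij j i - sdii j i)) := by
  have hdbl := sum_mul_sum_eq_diag_add_erase w A sdii
  have hA : ∑ i, τ * A i * sit i = τ * ∑ i, A i * sit i := by
    rw [Finset.mul_sum]
    exact Finset.sum_congr rfl fun i _ => by ring
  simp only [mul_sub, sub_mul, mul_add, Finset.sum_sub_distrib, Finset.sum_add_distrib] at hdbl ⊢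
  linear_combination hdbl - hA

/-- The weights `1/3` and `1/12` in `f_d`, times `t/2`, become `1/6` and `1/24`, the Taylor
coefficients of the forward quotient. The remaining spatial terms with `t²` combine into the three
errors in the last sum. -/
theorem initial_residual_identity (ft dt dtt d3t d4t t : ℝ)
    (w A sif sidt si sdtt dii d4 diit diitt : Fin n → ℝ) (sij sdii : Fin n → Fin n → ℝ) :
    ft + ∑ i, (w i - t ^ 2 / 12 * A i) * sif i
      + t / 2 * (-∑ i, A i * (si i + ∑ j ∈ Finset.univ.erase i, w j * sij j i))
      - (dt + ∑ i, w i * sidt i + t ^ 2 / 12 * ∑ i, A i * sidt i)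
      - t / 2 * ((dtt - ∑ i, A i * dii i) + t / 3 * (d3t - ∑ i, A i * diit i)
        + t ^ 2 / 12 * (d4t - ∑ i, A i * diitt i)
        + ∑ j, w j * (sdtt j - ∑ i, A i * sdii j i))
    = (ft - dt - t / 2 * dtt - t ^ 2 / 6 * d3t - t ^ 3 / 24 * d4t)
      + ∑ i, w i * (sif i - sidt i - t / 2 * sdtt i)
      - t / 2 * ∑ i, A i * (((si i - dii i - w i * d4 i) - w i * (sdii i i - d4 i))
        + ∑ j ∈ Finset.univ.erase i, w j * (sij j i - sdii j i))
      - t ^ 2 / 12 * ∑ i, A i * ((sif i - sidt i - t / 2 * sdtt i) + 2 * (sidt i - diit i)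
        + t / 2 * (sdtt i - diitt i)) := by
  have hdbl := sum_mul_sum_eq_diag_add_erase w A sdii
  have hA : ∑ i, t ^ 2 / 12 * A i * sif i = t ^ 2 / 12 * ∑ i, A i * sif i := by
    rw [Finset.mul_sum]
    exact Finset.sum_congr rfl fun i _ => by ring
  have hB : ∑ i, w i * (t / 2 * sdtt i) = t / 2 * ∑ i, w i * sdtt i := by
    rw [Finset.mul_sum]
    exact Finset.sum_congr rfl fun i _ => by ring
  have hE : ∀ (c : ℝ) (x : Fin n → ℝ), ∑ i, A i * (c * x i) = c * ∑ i, A i * x i := by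
    intro c x
    rw [Finset.mul_sum]
    exact Finset.sum_congr rfl fun i _ => by ring
  simp only [mul_sub, sub_mul, mul_add, Finset.sum_sub_distrib, Finset.sum_add_distrib, hE]
    at hdbl ⊢
  linear_combination (t / 2) * hdbl - hA + hB

/-! ### Bounds for the residuals at a point. -/

section Estimates

variable {C α H : ℝ} {h : Fin n → ℝ} {ht : ℝ} {U : (Option (Fin n) → ℝ) → ℝ}
  {p : Option (Fin n) → ℝ}

/-- The spatial part of the residual. -/
theorem abs_space_residual_le (hC : 0 ≤ C) (hη : ∀ d, 0 < stBox h ht d)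
    (hH : ∀ d, stBox h ht d ≤ H) (ha : ∀ i, a i ^ 2 ≤ α) (hU : Jet (stBox X T) C 6 U)
    (hp : p ∈ region (stBox X T) (stBox h ht) (Finset.univ.erase none)) :
    |∑ i, a i ^ 2 * (((sd (stBox h ht) (some i) U p - (partialD (stBox X T) (some i))^[2] U p
        - h i ^ 2 / 12 * (partialD (stBox X T) (some i))^[4] U p)
      - h i ^ 2 / 12 * (sd (stBox h ht) (some i) ((partialD (stBox X T) (some i))^[2] U) p
        - (partialD (stBox X T) (some i))^[4] U p))
      + ∑ j ∈ Finset.univ.erase i, h j ^ 2 / 12 *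
        (sd (stBox h ht) (some j) (sd (stBox h ht) (some i) U) p
          - sd (stBox h ht) (some j) ((partialD (stBox X T) (some i))^[2] U) p))|
      ≤ n * (α * (3 * (C * H ^ 4) + n * (C * H ^ 4))) := by
  have hh : ∀ i, 0 < h i := fun i => hη (some i)
  have hhH : ∀ i, h i ≤ H := fun i => hH (some i)
  have hreg : ∀ J : Finset (Option (Fin n)), none ∉ J → p ∈ region (stBox X T) (stBox h ht) J :=
    fun J hJ => region_anti (fun d hd => by
      simp only [Finset.mem_erase, Finset.mem_univ, and_true]
      rintro rfl
      exact hJ hd) hp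
  refine (abs_sum_le_card_mul (K := α * (3 * (C * H ^ 4) + n * (C * H ^ 4))) _ fun i _ => ?_).trans
    (by simp)
  have hhi := hh i
  have hhiH := hhH i
  have hH0 : 0 ≤ H := hhi.le.trans hhiH
  refine abs_mul_le_mul (sq_nonneg _) (ha i) ((abs_add_le _ _).trans (add_le_add ?_ ?_))
  · have e1 := hU.abs_sd_sub_sub_le hη (hreg {some i} (by simp))
    have e2 := Jet.abs_sd_sdL_sub_le hη (l := []) (d := some i) List.nodup_nil List.not_mem_nil
      (Jet.iterate (d := some i) (k := 4) 2 hU) (hreg (insert (some i) ∅) (by simp))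
    have e3 := abs_mul_le_mul (c := h i ^ 2 / 12) (by positivity)
      (by gcongr : h i ^ 2 / 12 ≤ H ^ 2 / 12) e2
    have e4 : 2 * C * stBox h ht (some i) ^ 4 ≤ 2 * C * H ^ 4 := by gcongr; exact hhiH
    have e5 : H ^ 2 / 12 * (2 * (2 ^ ([] : List (Option (Fin n))).length * C)
        * stBox h ht (some i) ^ 2) ≤ H ^ 2 / 12 * (2 * C * H ^ 2) := by
      simp only [List.length_nil, pow_zero, one_mul]
      gcongr
      exact hhiH
    have e6 : 0 ≤ C * H ^ 4 := by positivity
    calc _ ≤ _ := abs_sub _ _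
      _ ≤ 2 * C * H ^ 4 + H ^ 2 / 12 * (2 * C * H ^ 2) :=
        add_le_add (e1.trans e4) (e3.trans e5)
      _ ≤ 3 * (C * H ^ 4) := by nlinarith
  · refine sum_erase_le i (by positivity) fun j hj => ?_
    have hji : j ≠ i := Finset.ne_of_mem_erase hj
    have hj0 := hh j
    have hjH := hhH j
    have e1 := Jet.abs_sd_sdL_sub_le hη (l := [some j]) (d := some i) (List.nodup_singleton _)
      (by simpa using hji.symm) hU (hreg _ (by simp))
    rw [show sdL (stBox h ht) [some j] U = sd (stBox h ht) (some j) U from rfl,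
      sd_comm (by simpa using hji.symm)] at e1
    have e2 := abs_mul_le_mul (c := h j ^ 2 / 12) (by positivity)
      (by gcongr : h j ^ 2 / 12 ≤ H ^ 2 / 12) e1
    refine e2.trans ?_
    have e3 : stBox h ht (some i) ^ 2 ≤ H ^ 2 := pow_le_pow_left₀ (hη _).le (hH _) 2
    have e6 : 0 ≤ C * H ^ 4 := by positivity
    calc H ^ 2 / 12 * (2 * (2 ^ [some j].length * C) * stBox h ht (some i) ^ 2)
        ≤ H ^ 2 / 12 * (2 * (2 ^ [some j].length * C) * H ^ 2) := by gcongr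
      _ ≤ C * H ^ 4 := by simp only [List.length_singleton, pow_one]; nlinarith

theorem abs_main_residual_le (hC : 0 ≤ C) (hα : 0 ≤ α) (hη : ∀ d, 0 < stBox h ht d)
    (hH : ∀ d, stBox h ht d ≤ H) (ha : ∀ i, a i ^ 2 ≤ α) (hU : Jet (stBox X T) C 6 U)
    (hp : p ∈ region (stBox X T) (stBox h ht) Finset.univ) :
    |sd (stBox h ht) none U p
      + ∑ i, (h i ^ 2 / 12 - ht ^ 2 / 12 * a i ^ 2)
        * sd (stBox h ht) (some i) (sd (stBox h ht) none U) p
      + (-∑ i, a i ^ 2 * (sd (stBox h ht) (some i) U p + ∑ j ∈ Finset.univ.erase i, h j ^ 2 / 12 *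
        sd (stBox h ht) (some j) (sd (stBox h ht) (some i) U) p))
      - (waveOp a X T U p + ht ^ 2 / 12 * sd (stBox h ht) none (waveOp a X T U) p
        + ∑ j, h j ^ 2 / 12 * sd (stBox h ht) (some j) (waveOp a X T U) p)|
      ≤ (3 + n + n * α + n * (α * (3 + n))) * (C * H ^ 4) := by
  have hsp := abs_space_residual_le hC hη hH ha hU (region_anti (Finset.subset_univ _) hp)
  have hreg : ∀ J : Finset (Option (Fin n)), p ∈ region (stBox X T) (stBox h ht) J :=
    fun J => region_anti (Finset.subset_univ _) hp
  have ht0 : 0 < ht := hη none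
  have htH : ht ≤ H := hH none
  have hH0 : 0 ≤ H := ht0.le.trans htH
  have hCH : 0 ≤ C * H ^ 4 := by positivity
  have htime : |(sd (stBox h ht) none U p - (partialD (stBox X T) none)^[2] U p
        - ht ^ 2 / 12 * (partialD (stBox X T) none)^[4] U p)
      - ht ^ 2 / 12 * (sd (stBox h ht) none ((partialD (stBox X T) none)^[2] U) p
        - (partialD (stBox X T) none)^[4] U p)| ≤ 3 * (C * H ^ 4) := by
    have e1 := hU.abs_sd_sub_sub_le hη (hreg {none})
    have e2 := Jet.abs_sd_sdL_sub_le hη (l := []) (d := none) List.nodup_nil List.not_mem_nil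
      (Jet.iterate (d := none) (k := 4) 2 hU) (hreg (insert none ∅))
    have e3 := abs_mul_le_mul (c := ht ^ 2 / 12) (by positivity)
      (by gcongr : ht ^ 2 / 12 ≤ H ^ 2 / 12) e2
    have e4 : 2 * C * stBox h ht none ^ 4 ≤ 2 * C * H ^ 4 := by gcongr; exact htH
    have e5 : H ^ 2 / 12 * (2 * (2 ^ ([] : List (Option (Fin n))).length * C)
        * stBox h ht none ^ 2) ≤ H ^ 2 / 12 * (2 * C * H ^ 2) := by
      simp only [List.length_nil, pow_zero, one_mul]
      gcongr
      exact htH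
    calc _ ≤ _ := abs_sub _ _
      _ ≤ 2 * C * H ^ 4 + H ^ 2 / 12 * (2 * C * H ^ 2) :=
        add_le_add (e1.trans e4) (e3.trans e5)
      _ ≤ 3 * (C * H ^ 4) := by nlinarith
  have hsq : ∀ d, stBox h ht d ^ 2 ≤ H ^ 2 := fun d => pow_le_pow_left₀ (hη d).le (hH d) 2
  have hsqs : ∀ i, h i ^ 2 ≤ H ^ 2 := fun i => hsq (some i)
  have hsqt : ht ^ 2 ≤ H ^ 2 := hsq none
  have hmix1 : |∑ i, h i ^ 2 / 12 * (sd (stBox h ht) (some i) (sd (stBox h ht) none U) p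
      - sd (stBox h ht) (some i) ((partialD (stBox X T) none)^[2] U) p)| ≤ n * (C * H ^ 4) := by
    refine (abs_sum_le_card_mul (K := C * H ^ 4) _ fun i _ => ?_).trans (by simp)
    have e1 := Jet.abs_sd_sdL_sub_le hη (l := [some i]) (d := none) (List.nodup_singleton _)
      (by simp) hU (hreg _)
    rw [show sdL (stBox h ht) [some i] U = sd (stBox h ht) (some i) U from rfl,
      sd_comm (by simp)] at e1
    have e2 := abs_mul_le_mul (c := h i ^ 2 / 12) (by positivity)
      (by linarith [hsqs i] : h i ^ 2 / 12 ≤ H ^ 2 / 12) e1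
    refine e2.trans ?_
    calc H ^ 2 / 12 * (2 * (2 ^ [some i].length * C) * stBox h ht none ^ 2)
        ≤ H ^ 2 / 12 * (2 * (2 ^ [some i].length * C) * H ^ 2) := by gcongr; exact htH
      _ ≤ C * H ^ 4 := by simp only [List.length_singleton, pow_one]; nlinarith
  -- Here the quotient in time is kept and the one in space is replaced by a derivative, the reverse
  -- of `hmix1`.
  have hmix2 : |ht ^ 2 / 12 * ∑ i, a i ^ 2 * (sd (stBox h ht) (some i) (sd (stBox h ht) none U) p
      - sd (stBox h ht) none ((partialD (stBox X T) (some i))^[2] U) p)|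
      ≤ n * α * (C * H ^ 4) := by
    have e0 : |∑ i, a i ^ 2 * (sd (stBox h ht) (some i) (sd (stBox h ht) none U) p
      - sd (stBox h ht) none ((partialD (stBox X T) (some i))^[2] U) p)|
      ≤ n * (α * (4 * C * H ^ 2)) := by
      refine (abs_sum_le_card_mul (K := α * (4 * C * H ^ 2)) _ fun i _ => ?_).trans (by simp)
      have e1 := Jet.abs_sd_sdL_sub_le hη (l := [none]) (d := some i) (List.nodup_singleton _)
        (by simp) hU (hreg _)
      refine abs_mul_le_mul (sq_nonneg _) (ha i) (e1.trans ?_)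
      calc 2 * (2 ^ [(none : Option (Fin n))].length * C) * stBox h ht (some i) ^ 2
          ≤ 2 * (2 ^ [(none : Option (Fin n))].length * C) * H ^ 2 := by
            gcongr
            exacts [(hη _).le, hH _]
        _ ≤ 4 * C * H ^ 2 := by simp only [List.length_singleton, pow_one]; linarith
    have e2 := abs_mul_le_mul (c := ht ^ 2 / 12) (by positivity)
      (by linarith : ht ^ 2 / 12 ≤ H ^ 2 / 12) e0
    refine e2.trans ?_
    have : 0 ≤ n * α * (C * H ^ 4) := by positivity
    calc H ^ 2 / 12 * (n * (α * (4 * C * H ^ 2))) = n * α * (C * H ^ 4) / 3 := by ring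
      _ ≤ _ := by linarith
  have hid := residual_identity (sd (stBox h ht) none U p) ((partialD (stBox X T) none)^[2] U p)
    ((partialD (stBox X T) none)^[4] U p)
    (sd (stBox h ht) none ((partialD (stBox X T) none)^[2] U) p) (ht ^ 2 / 12)
    (fun i => h i ^ 2 / 12) (fun i => a i ^ 2)
    (fun i => sd (stBox h ht) (some i) (sd (stBox h ht) none U) p)
    (fun i => sd (stBox h ht) (some i) U p)
    (fun i => sd (stBox h ht) (some i) ((partialD (stBox X T) none)^[2] U) p)
    (fun i => (partialD (stBox X T) (some i))^[2] U p)
    (fun i => (partialD (stBox X T) (some i))^[4] U p)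
    (fun i => sd (stBox h ht) none ((partialD (stBox X T) (some i))^[2] U) p)
    (fun j i => sd (stBox h ht) (some j) (sd (stBox h ht) (some i) U) p)
    (fun j i => sd (stBox h ht) (some j) ((partialD (stBox X T) (some i))^[2] U) p)
  simp only [sd_waveOp]
  rw [show waveOp a X T U p = (partialD (stBox X T) none)^[2] U p
    - ∑ i, a i ^ 2 * (partialD (stBox X T) (some i))^[2] U p from rfl, hid]
  refine (abs_sub _ _).trans ((add_le_add ((abs_sub _ _).trans (add_le_add ((abs_add_le _ _).trans
    (add_le_add htime hmix1)) hmix2)) hsp).trans (le_of_eq ?_))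
  ring

/-- Where `h_t` occurs to a higher power than the fourth order requires, the surplus factor is
bounded through `T`. -/
theorem abs_initial_residual_le (hX : ∀ i, 0 < X i) (hT : 0 < T) (hC : 0 ≤ C) (hα : 0 ≤ α)
    (hη : ∀ d, 0 < stBox h ht d) (hH : ∀ d, stBox h ht d ≤ H) (htT : ht ≤ T)
    (ha : ∀ i, a i ^ 2 ≤ α) (hU : Jet (stBox X T) C 6 U)
    (hUs : ContDiffOn ℝ 6 U (cbox (stBox X T)))
    (hp : p ∈ region (stBox X T) (stBox h ht) (Finset.univ.erase none)) (hp0 : p none = 0) :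
    |fdq (stBox h ht) none U p
      + ∑ i, (h i ^ 2 / 12 - ht ^ 2 / 12 * a i ^ 2)
        * sd (stBox h ht) (some i) (fdq (stBox h ht) none U) p
      + ht / 2 * (-∑ i, a i ^ 2 * (sd (stBox h ht) (some i) U p
        + ∑ j ∈ Finset.univ.erase i, h j ^ 2 / 12 *
          sd (stBox h ht) (some j) (sd (stBox h ht) (some i) U) p))
      - (partialD (stBox X T) none U p
        + ∑ i, h i ^ 2 / 12 * sd (stBox h ht) (some i) (partialD (stBox X T) none U) p
        + ht ^ 2 / 12 * ∑ i, a i ^ 2 * sd (stBox h ht) (some i) (partialD (stBox X T) none U) p)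
      - ht / 2 * (waveOp a X T U p + ht / 3 * partialD (stBox X T) none (waveOp a X T U) p
        + ht ^ 2 / 12 * partialD (stBox X T) none (partialD (stBox X T) none (waveOp a X T U)) p
        + ∑ j, h j ^ 2 / 12 * sd (stBox h ht) (some j) (waveOp a X T U) p)|
      ≤ (1 + n + T * (n * (α * (3 + n))) + n * α * (1 + T)) * (C * H ^ 4) := by
  have hsp := abs_space_residual_le hC hη hH ha hU hp
  have hreg : ∀ J : Finset (Option (Fin n)), none ∉ J → p ∈ region (stBox X T) (stBox h ht) J :=
    fun J hJ => region_anti (fun d hd => by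
      simp only [Finset.mem_erase, Finset.mem_univ, and_true]
      rintro rfl
      exact hJ hd) hp
  have hpQ : p ∈ cbox (stBox X T) := region_subset_cbox _ hp
  have ht0 : 0 < ht := hη none
  have htH : ht ≤ H := hH none
  have hH0 : 0 ≤ H := ht0.le.trans htH
  have hCH : 0 ≤ C * H ^ 4 := by positivity
  have hsq : ∀ d, stBox h ht d ^ 2 ≤ H ^ 2 := fun d => pow_le_pow_left₀ (hη d).le (hH d) 2
  have hsqs : ∀ i, h i ^ 2 ≤ H ^ 2 := fun i => hsq (some i)
  have hsqt : ht ^ 2 ≤ H ^ 2 := hsq none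
  have hstep : p none + stBox h ht none ∈ Icc 0 (stBox X T none) := by
    rw [hp0, zero_add]
    exact ⟨ht0.le, htT⟩
  have htime := (Jet.abs_fdq_taylor_le hη (d := none) (hU.of_le (by norm_num)) hpQ hstep).trans
    (mul_le_mul_of_nonneg_left (pow_le_pow_left₀ (hη none).le (hH none) 4) hC)
  have hf : ∀ i, |sd (stBox h ht) (some i) (fdq (stBox h ht) none U) p
      - sd (stBox h ht) (some i) (partialD (stBox X T) none U) p
      - ht / 2 * sd (stBox h ht) (some i) ((partialD (stBox X T) none)^[2] U) p|
      ≤ 2 * C * H ^ 2 := by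
    intro i
    have e1 := Jet.abs_fdq_sdL_sub_le hη (l := [some i]) (d := none) (List.nodup_singleton _)
      (by simp) (hU.of_le (by simp)) (hreg _ (by simp)) hstep
    rw [show sdL (stBox h ht) [some i] U = sd (stBox h ht) (some i) U from rfl,
      ← fdq_sd_comm (by simp)] at e1
    refine e1.trans ?_
    calc 2 ^ [some i].length * C * stBox h ht none ^ 2 ≤ 2 ^ [some i].length * C * H ^ 2 := by
          gcongr; exact htH
      _ = _ := by simp
  have hmix : |∑ i, h i ^ 2 / 12 * (sd (stBox h ht) (some i) (fdq (stBox h ht) none U) p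
      - sd (stBox h ht) (some i) (partialD (stBox X T) none U) p
      - ht / 2 * sd (stBox h ht) (some i) ((partialD (stBox X T) none)^[2] U) p)|
      ≤ n * (C * H ^ 4) := by
    refine (abs_sum_le_card_mul (K := C * H ^ 4) _ fun i _ => ?_).trans (by simp)
    have e2 := abs_mul_le_mul (c := h i ^ 2 / 12) (by positivity)
      (by linarith [hsqs i] : h i ^ 2 / 12 ≤ H ^ 2 / 12) (hf i)
    refine e2.trans ?_
    nlinarith
  have hdiff : ∀ (i : Fin n) {w : (Option (Fin n) → ℝ) → ℝ}, Jet (stBox X T) C 4 w →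
      |sd (stBox h ht) (some i) w p - (partialD (stBox X T) (some i))^[2] w p| ≤ 2 * C * H ^ 2 := by
    intro i w hw
    have e1 := Jet.abs_sd_sdL_sub_le hη (l := []) (d := some i) List.nodup_nil List.not_mem_nil
      hw (hreg (insert (some i) ∅) (by simp))
    refine e1.trans ?_
    simp only [List.length_nil, pow_zero, one_mul]
    gcongr
    exacts [(hη _).le, hH _]
  have hlast : |ht ^ 2 / 12 * ∑ i, a i ^ 2 *
      ((sd (stBox h ht) (some i) (fdq (stBox h ht) none U) p
          - sd (stBox h ht) (some i) (partialD (stBox X T) none U) p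
          - ht / 2 * sd (stBox h ht) (some i) ((partialD (stBox X T) none)^[2] U) p)
        + 2 * (sd (stBox h ht) (some i) (partialD (stBox X T) none U) p
          - (partialD (stBox X T) (some i))^[2] (partialD (stBox X T) none U) p)
        + ht / 2 * (sd (stBox h ht) (some i) ((partialD (stBox X T) none)^[2] U) p
          - (partialD (stBox X T) (some i))^[2] ((partialD (stBox X T) none)^[2] U) p))|
      ≤ n * α * (1 + T) * (C * H ^ 4) := by
    have e0 : ∀ x y z : ℝ, |x| ≤ 2 * C * H ^ 2 → |y| ≤ 2 * C * H ^ 2 → |z| ≤ 2 * C * H ^ 2 →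
        |x + 2 * y + ht / 2 * z| ≤ (6 + T) * (C * H ^ 2) := by
      intro x y z hx hy hz
      have h1 := abs_mul_le_mul (c := ht / 2) (by positivity) (by linarith : ht / 2 ≤ T / 2) hz
      have h2 : |2 * y| ≤ 2 * (2 * C * H ^ 2) := abs_mul_le_mul (by norm_num) le_rfl hy
      refine ((abs_add_le _ _).trans (add_le_add ((abs_add_le _ _).trans
        (add_le_add hx h2)) h1)).trans (le_of_eq ?_)
      ring
    have e1 := abs_mul_le_mul (c := ht ^ 2 / 12) (by positivity)
      (by linarith : ht ^ 2 / 12 ≤ H ^ 2 / 12)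
      (abs_sum_le_card_mul (K := α * ((6 + T) * (C * H ^ 2))) Finset.univ fun i _ =>
        abs_mul_le_mul (sq_nonneg (a i)) (ha i) (e0 _ _ _ (hf i)
          (hdiff i ((hU.deriv none).of_le (by norm_num)))
          (hdiff i (Jet.iterate (d := none) (k := 4) 2 hU))))
    refine e1.trans ?_
    simp only [Finset.card_univ, Fintype.card_fin]
    have : 0 ≤ n * α * (C * H ^ 4) := by positivity
    calc H ^ 2 / 12 * (n * (α * ((6 + T) * (C * H ^ 2))))
        = (6 + T) / 12 * (n * α * (C * H ^ 4)) := by ring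
      _ ≤ (1 + T) * (n * α * (C * H ^ 4)) := by gcongr; linarith
      _ = _ := by ring
  -- Time derivatives of `f` become wave operators of time derivatives of `u`, the form in which
  -- they enter the identity.
  have hw1 : partialD (stBox X T) none (waveOp a X T U) p
      = waveOp a X T (partialD (stBox X T) none U) p :=
    partialD_waveOp hX hT (k := 3) (by exact_mod_cast hUs) hpQ
  have hw2 : partialD (stBox X T) none (partialD (stBox X T) none (waveOp a X T U)) p
      = waveOp a X T ((partialD (stBox X T) none)^[2] U) p := by
    rw [partialD_congr (partialD_waveOp hX hT (k := 3) (by exact_mod_cast hUs)) hpQ]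
    exact partialD_waveOp hX hT (k := 2)
      (contDiffOn_partialD (stBox_pos hX hT) (by exact_mod_cast hUs) none) hpQ
  have hid := initial_residual_identity (fdq (stBox h ht) none U p)
    (partialD (stBox X T) none U p) ((partialD (stBox X T) none)^[2] U p)
    ((partialD (stBox X T) none)^[3] U p) ((partialD (stBox X T) none)^[4] U p) ht
    (fun i => h i ^ 2 / 12) (fun i => a i ^ 2)
    (fun i => sd (stBox h ht) (some i) (fdq (stBox h ht) none U) p)
    (fun i => sd (stBox h ht) (some i) (partialD (stBox X T) none U) p)
    (fun i => sd (stBox h ht) (some i) U p)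
    (fun i => sd (stBox h ht) (some i) ((partialD (stBox X T) none)^[2] U) p)
    (fun i => (partialD (stBox X T) (some i))^[2] U p)
    (fun i => (partialD (stBox X T) (some i))^[4] U p)
    (fun i => (partialD (stBox X T) (some i))^[2] (partialD (stBox X T) none U) p)
    (fun i => (partialD (stBox X T) (some i))^[2] ((partialD (stBox X T) none)^[2] U) p)
    (fun j i => sd (stBox h ht) (some j) (sd (stBox h ht) (some i) U) p)
    (fun j i => sd (stBox h ht) (some j) ((partialD (stBox X T) (some i))^[2] U) p)
  have hwave : ∀ w, waveOp a X T w p = (partialD (stBox X T) none)^[2] w p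
    - ∑ i, a i ^ 2 * (partialD (stBox X T) (some i))^[2] w p := fun w => rfl
  have hsp' := abs_mul_le_mul (c := ht / 2) (by positivity) (by linarith : ht / 2 ≤ T) hsp
  simp only [sd_waveOp]
  rw [hw1, hw2, hwave U, hwave (partialD (stBox X T) none U),
    hwave ((partialD (stBox X T) none)^[2] U)]
  refine (le_of_eq (congrArg abs hid)).trans ?_
  refine (abs_sub _ _).trans ((add_le_add ((abs_sub _ _).trans (add_le_add ((abs_add_le _ _).trans
    (add_le_add htime hmix)) hsp')) hlast).trans (le_of_eq ?_))
  ring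

end Estimates

end

end CompactWave

namespace CompactWave

noncomputable section

open MvPolynomial

variable {n : ℕ}

/-! ### Remainders of the products of one-dimensional operators -/

theorem prod_one_add_eq {ι R : Type*} [DecidableEq ι] [CommRing R] (S : Finset ι) (f : ι → R) :
    ∏ i ∈ S, (1 + f i)
      = 1 + ∑ i ∈ S, f i + ∑ U ∈ S.powerset.filter (fun U => 2 ≤ U.card), ∏ i ∈ U, f i := by
  rw [Finset.prod_one_add,
    ← Finset.sum_filter_add_sum_filter_not _ (fun U : Finset ι => 2 ≤ U.card),
    filter_card_lt_two, Finset.sum_insert (by simp),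
    Finset.sum_image (fun i _ j _ hij => by simpa using hij)]
  simp only [Finset.prod_empty, Finset.prod_singleton]
  ring

/-- A factor `c Λ_l` with `|c| ≤ h_l²` is bounded by 4 in the maximum norm without any smoothness;
it costs one layer of nodes in the direction `l`. -/
theorem abs_smul_lam_le {h : Fin n → ℝ} (hh : ∀ l, 0 < h l) {N : Fin n → ℕ} {J : Finset (Fin n)}
    {l : Fin n} (hl : l ∉ J) {c B : ℝ} (hc : |c| ≤ h l ^ 2) {w : MeshFn n}
    (hw : ∀ k ∈ meshRegion N J, |w k| ≤ B) {k : Fin n → ℤ}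
    (hk : k ∈ meshRegion N (insert l J)) : |c * lam h l w k| ≤ 4 * B := by
  obtain ⟨h0, h1, h2⟩ := meshRegion_insert_step hl hk
  have hpos := pow_pos (hh l) 2
  have e : c * lam h l w k
      = c / h l ^ 2 * (w (k + Pi.single l 1) - 2 * w k + w (k - Pi.single l 1)) := by
    simp only [lam, LinearMap.coe_mk, AddHom.coe_mk]; ring
  have e1 : |c / h l ^ 2| ≤ 1 := by
    rw [abs_div, abs_of_pos hpos, div_le_one hpos]
    exact hc
  have e2 : |w (k + Pi.single l 1) - 2 * w k + w (k - Pi.single l 1)| ≤ 4 * B := by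
    have := abs_le.1 (hw _ h0)
    have := abs_le.1 (hw _ h1)
    have := abs_le.1 (hw _ h2)
    rw [abs_le]
    constructor <;> linarith
  rw [e, abs_mul]
  calc _ ≤ 1 * (4 * B) := mul_le_mul e1 e2 (abs_nonneg _) zero_le_one
    _ = _ := one_mul _

theorem abs_polyOp_prod_le {h : Fin n → ℝ} (hh : ∀ l, 0 < h l) {N : Fin n → ℕ} {c : Fin n → ℝ}
    (hc : ∀ l, |c l| ≤ h l ^ 2) {J : Finset (Fin n)} {B : ℝ} {w : MeshFn n}
    (hw : ∀ k ∈ meshRegion N J, |w k| ≤ B) (U : Finset (Fin n)) (hU : Disjoint U J) :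
    ∀ k ∈ meshRegion N (U ∪ J), |polyOp h (∏ l ∈ U, c l • X l) w k| ≤ 4 ^ U.card * B := by
  induction U using Finset.induction_on with
  | empty => simpa using hw
  | insert l U hl ih =>
    rw [Finset.disjoint_insert_left] at hU
    intro k hk
    rw [Finset.insert_union] at hk
    rw [Finset.prod_insert hl, Finset.card_insert_of_notMem hl, pow_succ', mul_assoc]
    have := abs_smul_lam_le hh (by simp [hl, hU.1]) (hc l) (ih hU.2) hk
    simpa using this

/-- The product of the operators `I + c_l Λ_l` differs from its linear part by terms of the
fourth order. -/
theorem abs_prod_remainder_le {h : Fin n → ℝ} (hh : ∀ l, 0 < h l) {H : ℝ} (hH : ∀ l, h l ≤ H)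
    {N : Fin n → ℕ} {c : Fin n → ℝ} (hc : ∀ l, |c l| ≤ h l ^ 2) {J S : Finset (Fin n)}
    (hJS : Disjoint J S) {B : ℝ} (hB : 0 ≤ B) {G : MeshFn n}
    (hG : ∀ i ∈ S, ∀ j ∈ S, i ≠ j → ∀ k ∈ meshRegion N (insert i (insert j J)),
      |lam h i (lam h j G) k| ≤ B) {k : Fin n → ℤ} (hk : k ∈ innerMesh N) :
    |polyOp h (∏ l ∈ S, (1 + c l • X l)) G k - (G k + ∑ l ∈ S, c l * lam h l G k)|
      ≤ 8 ^ n * (B * H ^ 4) := by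
  have e1 : polyOp h (∏ l ∈ S, (1 + c l • X l)) G k - (G k + ∑ l ∈ S, c l * lam h l G k)
      = ∑ U ∈ S.powerset.filter (fun U => 2 ≤ U.card), polyOp h (∏ l ∈ U, c l • X l) G k := by
    rw [prod_one_add_eq]
    simp only [map_add, map_one, map_sum, LinearMap.add_apply, Module.End.one_apply,
      LinearMap.sum_apply, Pi.add_apply, Finset.sum_apply, map_smul, polyOp_X,
      LinearMap.smul_apply, Pi.smul_apply, smul_eq_mul]
    ring
  have hterm : ∀ U ∈ S.powerset.filter (fun U => 2 ≤ U.card),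
      |polyOp h (∏ l ∈ U, c l • X l) G k| ≤ 4 ^ n * (B * H ^ 4) := by
    intro U hU
    rw [Finset.mem_filter, Finset.mem_powerset] at hU
    -- Two factors are kept as `c_i c_j Λ_i Λ_j G` and provide `H^4`; the others are bounded by 4
    -- each.
    obtain ⟨i, hi, j, hj, hij⟩ := Finset.one_lt_card.1 hU.2
    have hH0 : 0 ≤ H := (hh i).le.trans (hH i)
    set U' := (U.erase i).erase j with hU'
    have hj' : j ∈ U.erase i := Finset.mem_erase.2 ⟨hij.symm, hj⟩
    have hprod : ∏ l ∈ U, c l • X l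
        = (∏ l ∈ U', c l • X l) * ((c i • X i) * (c j • X j) : MvPolynomial (Fin n) ℝ) := by
      rw [← Finset.mul_prod_erase U _ hi, ← Finset.mul_prod_erase (U.erase i) _ hj']
      ring
    have hw : ∀ k ∈ meshRegion N (insert i (insert j J)),
        |polyOp h ((c i • X i) * (c j • X j)) G k| ≤ B * H ^ 4 := by
      intro k hk
      have e2 : polyOp h ((c i • X i) * (c j • X j)) G k
          = (c i * c j) * lam h i (lam h j G) k := by
        simp only [map_mul, map_smul, polyOp_X, Module.End.mul_apply, LinearMap.smul_apply,
          Pi.smul_apply, smul_eq_mul]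
        ring
      rw [e2, abs_mul, abs_mul, mul_comm B]
      have hc2 : ∀ l, |c l| ≤ H ^ 2 := fun l =>
        (hc l).trans (pow_le_pow_left₀ (hh l).le (hH l) 2)
      refine mul_le_mul ?_ (hG i (hU.1 hi) j (hU.1 hj) hij k hk) (abs_nonneg _) (by positivity)
      calc |c i| * |c j| ≤ H ^ 2 * H ^ 2 :=
            mul_le_mul (hc2 i) (hc2 j) (abs_nonneg _) (by positivity)
        _ = H ^ 4 := by ring
    have hdisj : Disjoint U' (insert i (insert j J)) := by
      rw [Finset.disjoint_left]
      intro l hl hl'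
      simp only [hU', Finset.mem_erase] at hl
      simp only [Finset.mem_insert] at hl'
      rcases hl' with h1 | h1 | h1
      · exact hl.2.1 h1
      · exact hl.1 h1
      · exact Finset.disjoint_left.1 hJS h1 (hU.1 hl.2.2)
    rw [hprod, map_mul, Module.End.mul_apply]
    refine (abs_polyOp_prod_le hh hc hw U' hdisj k
      (meshRegion_anti (Finset.subset_univ _) (mem_meshRegion_univ.2 hk))).trans ?_
    have hcard : U'.card ≤ n := (Finset.card_le_univ _).trans (by simp)
    gcongr
    norm_num
  rw [e1]
  refine (abs_sum_le_card_mul _ hterm).trans ?_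
  have hcard : (S.powerset.filter (fun U => 2 ≤ U.card)).card ≤ 2 ^ n := by
    refine (Finset.card_filter_le _ _).trans ?_
    rw [Finset.card_powerset]
    exact Nat.pow_le_pow_right (by norm_num) ((Finset.card_le_univ _).trans (by simp))
  have hcard' : ((S.powerset.filter (fun U => 2 ≤ U.card)).card : ℝ) ≤ 2 ^ n := by
    exact_mod_cast hcard
  have hH4 : 0 ≤ H ^ 4 := by positivity
  -- At most `2^n` subsets contribute at most `4^n` times the basic bound each.
  calc _ ≤ 2 ^ n * (4 ^ n * (B * H ^ 4)) := by gcongr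
    _ = _ := by rw [← mul_assoc, ← mul_pow]; norm_num

theorem polyOp_aNPoly_apply (a h : Fin n → ℝ) (G : MeshFn n) (k : Fin n → ℤ) :
    polyOp h (aNPoly a h) G k
      = -∑ i, a i ^ 2 * (lam h i G k
        + ∑ j ∈ Finset.univ.erase i, h j ^ 2 / 12 * lam h j (lam h i G) k) := by
  simp [aNPoly, add_mul, mul_add]

theorem polyOp_sNPoly_apply (h : Fin n → ℝ) (G : MeshFn n) (k : Fin n → ℤ) :
    polyOp h (sNPoly h) G k = G k + ∑ i, h i ^ 2 / 12 * lam h i G k := by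
  simp [sNPoly]

/-- `J = {l}` reserves the direction already used by `Λ_l G`. The weight `a_l²` stays inside the
bounded quantity so that the lemma can also be applied with `a_l h_t` in place of `a_l`. -/
theorem abs_aBarPoly_sub_le {a h : Fin n → ℝ} (hh : ∀ l, 0 < h l) {H : ℝ} (hH : ∀ l, h l ≤ H)
    {N : Fin n → ℕ} {B : ℝ} (hB : 0 ≤ B) {G : MeshFn n}
    (hG : ∀ l i j, l ≠ i → l ≠ j → i ≠ j → ∀ k ∈ meshRegion N {i, j, l},
      |a l ^ 2 * lam h i (lam h j (lam h l G)) k| ≤ B) {k : Fin n → ℤ} (hk : k ∈ innerMesh N) :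
    |polyOp h (aBarPoly a h) G k - polyOp h (aNPoly a h) G k| ≤ n * (8 ^ n * (B * H ^ 4)) := by
  have e1 : polyOp h (aBarPoly a h) G k - polyOp h (aNPoly a h) G k
      = ∑ l, -(polyOp h (∏ i ∈ Finset.univ.erase l, (1 + (h i ^ 2 / 12) • X i))
          (a l ^ 2 • lam h l G) k - ((a l ^ 2 • lam h l G) k
          + ∑ i ∈ Finset.univ.erase l, h i ^ 2 / 12 * lam h i (a l ^ 2 • lam h l G) k)) := by
    rw [polyOp_aNPoly_apply]
    simp only [aBarPoly, s1NPoly, map_neg, map_sum, map_smul, map_mul, polyOp_X,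
      LinearMap.neg_apply, LinearMap.sum_apply, LinearMap.smul_apply, Module.End.mul_apply,
      Pi.neg_apply, Finset.sum_apply, Pi.smul_apply, smul_eq_mul, neg_sub, Finset.sum_sub_distrib,
      mul_add, Finset.mul_sum]
    rw [neg_sub_neg]
    congr 1
    exact Finset.sum_congr rfl fun l _ => congrArg _ (Finset.sum_congr rfl fun i _ => by ring)
  rw [e1]
  refine (abs_sum_le_card_mul (K := 8 ^ n * (B * H ^ 4)) _ fun l _ => ?_).trans (by simp)
  rw [abs_neg]
  refine abs_prod_remainder_le hh hH (c := fun i => h i ^ 2 / 12) (fun i => ?_) (J := {l})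
    (by simp) hB (fun i hi j hj hij k hk => ?_) hk
  · have := pow_pos (hh i) 2
    rw [abs_of_pos (by positivity)]
    linarith
  · simpa using hG l i j (Finset.ne_of_mem_erase hi).symm (Finset.ne_of_mem_erase hj).symm hij k hk

theorem Scheme.abs_aPoly_sub_le (S : Scheme) {a h : Fin n → ℝ} (hh : ∀ l, 0 < h l) {H : ℝ}
    (hH : ∀ l, h l ≤ H) {N : Fin n → ℕ} {B : ℝ} (hB : 0 ≤ B) {G : MeshFn n}
    (hG : ∀ l i j, l ≠ i → l ≠ j → i ≠ j → ∀ k ∈ meshRegion N {i, j, l},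
      |a l ^ 2 * lam h i (lam h j (lam h l G)) k| ≤ B) {k : Fin n → ℤ} (hk : k ∈ innerMesh N) :
    |polyOp h (S.aPoly a h) G k - polyOp h (aNPoly a h) G k| ≤ n * (8 ^ n * (B * H ^ 4)) := by
  have hH4 : 0 ≤ H ^ 4 := by positivity
  cases S
  case plain => simp only [Scheme.aPoly, sub_self, abs_zero]; positivity
  case mixed => simp only [Scheme.aPoly, sub_self, abs_zero]; positivity
  all_goals exact abs_aBarPoly_sub_le hh hH hB hG hk

/-- To fourth order all the operators `P` coincide. The deviations come from `s̄_N` against `s_N`,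
from the terms `Λ_j Λ_i` in `A_N`, and from `Ā_N` against `A_N`. -/
theorem Scheme.abs_pPoly_sub_le (S : Scheme) {a h : Fin n → ℝ} {ht : ℝ} (hh : ∀ l, 0 < h l)
    {H : ℝ} (hH : ∀ l, h l ≤ H) (hht : ∀ l, ht ^ 2 * a l ^ 2 ≤ h l ^ 2) {N : Fin n → ℕ} {B : ℝ}
    (hB : 0 ≤ B) {G : MeshFn n}
    (hG : ∀ i j, i ≠ j → ∀ k ∈ meshRegion N {i, j}, |lam h i (lam h j G) k| ≤ B)
    {k : Fin n → ℤ} (hk : k ∈ innerMesh N) :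
    |polyOp h (S.pPoly a h ht) G k
      - (G k + ∑ i, (h i ^ 2 / 12 - ht ^ 2 / 12 * a i ^ 2) * lam h i G k)|
      ≤ (8 ^ n + n * n + n * 8 ^ n) * (B * H ^ 4) := by
  have hBH : 0 ≤ B * H ^ 4 := by positivity
  have hreg : ∀ J, k ∈ meshRegion N J := fun J =>
    meshRegion_anti (Finset.subset_univ _) (mem_meshRegion_univ.2 hk)
  have hsq : ∀ l, h l ^ 2 ≤ H ^ 2 := fun l => pow_le_pow_left₀ (hh l).le (hH l) 2
  have h0 : ∀ l, 0 ≤ ht ^ 2 * a l ^ 2 := fun l => by positivity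
  have hs : |polyOp h (sBarPoly h) G k - polyOp h (sNPoly h) G k| ≤ 8 ^ n * (B * H ^ 4) := by
    rw [polyOp_sNPoly_apply]
    refine abs_prod_remainder_le hh hH (c := fun i => h i ^ 2 / 12) (fun i => ?_) (J := ∅)
      (by simp) hB (fun i _ j _ hij k hk => hG i j hij k (by simpa using hk)) hk
    have := pow_pos (hh i) 2
    rw [abs_of_pos (by positivity)]
    linarith
  have hcross : |∑ i, ∑ j ∈ Finset.univ.erase i,
      ht ^ 2 / 12 * a i ^ 2 * (h j ^ 2 / 12) * lam h j (lam h i G) k| ≤ n * (n * (B * H ^ 4)) := by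
    refine (abs_sum_le_card_mul (K := n * (B * H ^ 4)) _ fun i _ => ?_).trans (by simp)
    refine sum_erase_le i hBH fun j hj => ?_
    rw [mul_comm B]
    refine abs_mul_le_mul (by positivity) ?_ (hG j i (Finset.ne_of_mem_erase hj) k (hreg _))
    have e1 : ht ^ 2 / 12 * a i ^ 2 ≤ H ^ 2 := by linarith [hht i, hsq i, h0 i, sq_nonneg H]
    have e2 : h j ^ 2 / 12 ≤ H ^ 2 := by linarith [hsq j, sq_nonneg H]
    calc _ ≤ H ^ 2 * H ^ 2 := mul_le_mul e1 e2 (by positivity) (by positivity)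
      _ = H ^ 4 := by ring
  have hmain : polyOp h (sNPoly h) G k + ht ^ 2 / 12 * polyOp h (aNPoly a h) G k
      - (G k + ∑ i, (h i ^ 2 / 12 - ht ^ 2 / 12 * a i ^ 2) * lam h i G k)
      = -∑ i, ∑ j ∈ Finset.univ.erase i,
        ht ^ 2 / 12 * a i ^ 2 * (h j ^ 2 / 12) * lam h j (lam h i G) k := by
    rw [polyOp_sNPoly_apply, polyOp_aNPoly_apply]
    simp only [sub_mul, Finset.sum_sub_distrib, mul_add, Finset.sum_add_distrib, mul_neg,
      Finset.mul_sum, ← mul_assoc]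
    ring
  have habar : |ht ^ 2 / 12 * (polyOp h (aBarPoly a h) G k - polyOp h (aNPoly a h) G k)|
      ≤ n * (8 ^ n * (B * H ^ 4)) := by
    -- The difference `Ā_N - A_N` involves three spatial quotients, which on a second difference in
    -- time would cost eight derivatives. Therefore `h_t² a_l² Λ_l` is treated as a bounded
    -- operator, and only two spatial quotients fall on `G`.
    have e1 := abs_aBarPoly_sub_le (a := fun l => a l * ht) hh hH hB (G := (1 / 12 : ℝ) • G)
      (N := N) (fun l i j hli hlj hij k hk => ?_) hk
    · have hA : aBarPoly (fun l => a l * ht) h = ht ^ 2 • aBarPoly a h := by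
        simp only [aBarPoly, smul_neg, Finset.smul_sum, smul_smul]
        exact congrArg _ (Finset.sum_congr rfl fun i _ => by congr 1; ring)
      have hA' : aNPoly (fun l => a l * ht) h = ht ^ 2 • aNPoly a h := by
        simp only [aNPoly, smul_neg, Finset.smul_sum, smul_smul]
        exact congrArg _ (Finset.sum_congr rfl fun i _ => by congr 1; ring)
      rw [hA, hA'] at e1
      simp only [map_smul, LinearMap.smul_apply, Pi.smul_apply, smul_eq_mul] at e1
      refine le_trans (le_of_eq ?_) e1
      congr 1
      ring
    · have e2 : lam h i (lam h j (lam h l ((1 / 12 : ℝ) • G)))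
          = (1 / 12 : ℝ) • lam h l (lam h i (lam h j G)) := by
        have h1 := LinearMap.congr_fun (lam_commute h j l).eq G
        have h2 := LinearMap.congr_fun (lam_commute h i l).eq (lam h j G)
        simp only [Module.End.mul_apply] at h1 h2
        simp only [map_smul, h1, h2]
      rw [e2]
      have e3 := abs_smul_lam_le hh (N := N) (J := {i, j}) (l := l) (by simp [hli, hlj])
        (c := (a l * ht) ^ 2)
        (by rw [abs_of_nonneg (sq_nonneg _), mul_pow]; linarith [hht l]) (hG i j hij)
        (k := k) (meshRegion_anti
          (by intro x; simp only [Finset.mem_insert, Finset.mem_singleton]; tauto) hk)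
      rw [Pi.smul_apply, smul_eq_mul, mul_left_comm, abs_mul, abs_of_pos (by norm_num)]
      linarith
  have hcross' := hcross
  rw [← abs_neg, ← hmain] at hcross'
  -- One bound serves all cases; a deviation that a scheme does not have enters as 0.
  have hfin : ∀ x y z : ℝ, |x| ≤ 8 ^ n * (B * H ^ 4) → |y| ≤ n * (n * (B * H ^ 4)) →
      |z| ≤ n * (8 ^ n * (B * H ^ 4)) →
      |x + y + z| ≤ (8 ^ n + n * n + n * 8 ^ n) * (B * H ^ 4) := fun x y z hx hy hz =>
    ((abs_add_le _ _).trans (add_le_add ((abs_add_le _ _).trans (add_le_add hx hy)) hz)).trans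
      (le_of_eq (by ring))
  have hz : |(0 : ℝ)| ≤ n * (8 ^ n * (B * H ^ 4)) := by rw [abs_zero]; positivity
  have hz' : |(0 : ℝ)| ≤ 8 ^ n * (B * H ^ 4) := by rw [abs_zero]; positivity
  have hz'' : |(0 : ℝ)| ≤ n * (n * (B * H ^ 4)) := by rw [abs_zero]; positivity
  cases S
  case plain =>
    refine le_trans (le_of_eq (congrArg abs ?_)) (hfin _ _ _ hz' hcross' hz)
    simp [Scheme.pPoly]
  case mixed =>
    refine le_trans (le_of_eq (congrArg abs ?_)) (hfin _ _ _ hs hcross' hz)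
    simp only [Scheme.pPoly, map_add, map_smul, LinearMap.add_apply, LinearMap.smul_apply,
      Pi.add_apply, Pi.smul_apply, smul_eq_mul]
    ring
  case splitting =>
    -- Written as a product of factors `I + c_l Λ_l`, the splitting operator is estimated directly,
    -- without `R`.
    have e1 : bBarPoly a h ht
        = ∏ l, (1 + (h l ^ 2 / 12 - ht ^ 2 / 12 * a l ^ 2) • X l : MvPolynomial (Fin n) ℝ) :=
      Finset.prod_congr rfl fun l _ => by rw [s1NPoly]; module
    have e2 : |polyOp h (bBarPoly a h ht) G k
        - (G k + ∑ i, (h i ^ 2 / 12 - ht ^ 2 / 12 * a i ^ 2) * lam h i G k)|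
        ≤ 8 ^ n * (B * H ^ 4) := by
      rw [e1]
      refine abs_prod_remainder_le hh hH (fun i => ?_) (J := ∅)
        (by simp) hB (fun i _ j _ hij k hk => hG i j hij k (by simpa using hk)) hk
      have := pow_pos (hh i) 2
      rw [abs_le]
      constructor <;> linarith [hht i, h0 i]
    refine le_trans (le_of_eq (congrArg abs ?_)) (hfin _ _ _ e2 hz'' hz)
    simp [Scheme.pPoly]
  all_goals
    refine le_trans (le_of_eq (congrArg abs ?_)) (hfin _ _ _ hs hcross' habar)
    simp only [Scheme.pPoly, map_add, map_smul, LinearMap.add_apply, LinearMap.smul_apply,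
      Pi.add_apply, Pi.smul_apply, smul_eq_mul]
    ring

end

end CompactWave

namespace CompactWave

noncomputable section

open Set Function MvPolynomial

variable {n : ℕ}

/-! ### Samples of smooth functions on the mesh -/

/-- The values of a function of the space-time point at the nodes of a time level. -/
def sample (h : Fin n → ℝ) (w : (Option (Fin n) → ℝ) → ℝ) (t : ℝ) : MeshFn n :=
  fun k => w (stPoint (node h k) t)

theorem node_add_single (h : Fin n → ℝ) (k : Fin n → ℤ) (i : Fin n) :
    node h (k + Pi.single i 1) = update (node h k) i (node h k i + h i) := by
  funext j
  by_cases hj : j = i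
  · subst hj; simp [node, add_mul]
  · simp [node, hj]

theorem node_sub_single (h : Fin n → ℝ) (k : Fin n → ℤ) (i : Fin n) :
    node h (k - Pi.single i 1) = update (node h k) i (node h k i - h i) := by
  funext j
  by_cases hj : j = i
  · subst hj; simp [node, sub_mul]
  · simp [node, hj]

/-- Reduces mesh quotients to quotients of functions of the point, to which the pointwise estimates
apply. -/
theorem lam_sample (h : Fin n → ℝ) (ht : ℝ) (i : Fin n) (w : (Option (Fin n) → ℝ) → ℝ) (t : ℝ) :
    lam h i (sample h w t) = sample h (sd (stBox h ht) (some i) w) t := by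
  funext k
  simp only [lam, LinearMap.coe_mk, AddHom.coe_mk, sample, node_add_single, node_sub_single, sd,
    update_stPoint_some]
  rfl

theorem lamT_onMeshT (h : Fin n → ℝ) (ht : ℝ) (u : (Fin n → ℝ) → ℝ → ℝ) {m : ℕ} (hm : 1 ≤ m) :
    lamT ht (onMeshT h ht u) m = sample h (sd (stBox h ht) none (stFun u)) (m * ht) := by
  funext k
  simp only [lamT, onMeshT, sample, sd, update_stPoint_none, stFun_stPoint, stPoint_none, stBox,
    Option.elim]
  push_cast [Nat.cast_sub hm]
  rw [add_mul, sub_mul, one_mul]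

theorem deltaT_onMeshT (h : Fin n → ℝ) (ht : ℝ) (u : (Fin n → ℝ) → ℝ → ℝ) :
    deltaT ht (onMeshT h ht u) 0 = sample h (fdq (stBox h ht) none (stFun u)) 0 := by
  funext k
  simp [deltaT, onMeshT, sample, fdq, update_stPoint_none, stBox]

/-! ### Residuals of the schemes on the exact solution. -/

section Residual

variable {a X h : Fin n → ℝ} {T ht C α H : ℝ} {N : Fin n → ℕ}

theorem steps_pos (hX : ∀ i, 0 < X i) (hN : ∀ i, 1 ≤ N i) (i : Fin n) : 0 < steps X N i :=
  div_pos (hX i) (by exact_mod_cast hN i)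

theorem natCast_mul_steps (hN : ∀ i, 1 ≤ N i) (i : Fin n) : (N i : ℝ) * steps X N i = X i := by
  have : (N i : ℝ) ≠ 0 := by
    have := hN i
    positivity
  rw [steps]
  field_simp

theorem stPoint_node_mem_region (hX : ∀ i, 0 < X i) (hN : ∀ i, 1 ≤ N i) (hh : h = steps X N)
    {J : Finset (Fin n)} {J' : Finset (Option (Fin n))} (hJ : ∀ i, some i ∈ J' → i ∈ J)
    {k : Fin n → ℤ} (hk : k ∈ meshRegion N J) {t : ℝ} (ht' : t ∈ Icc 0 T)
    (htJ : none ∈ J' → t ∈ Icc ht (T - ht)) :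
    stPoint (node h k) t ∈ region (stBox X T) (stBox h ht) J' := by
  rintro (_ | i)
  · exact ⟨ht', htJ⟩
  · have hpos : 0 < h i := hh ▸ steps_pos hX hN i
    have hNh : (N i : ℝ) * h i = X i := hh ▸ natCast_mul_steps hN i
    simp only [stPoint_some, stBox, Option.elim, node, mem_Icc]
    refine ⟨⟨mul_nonneg (by exact_mod_cast (hk i).1.1) hpos.le, ?_⟩, fun hi => ?_⟩
    · rw [← hNh]
      gcongr
      exact_mod_cast (hk i).1.2
    · have h1 := (hk i).2 (hJ i hi)
      have h2 : (1 : ℝ) ≤ k i := by exact_mod_cast h1.1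
      have h3 : (k i : ℝ) + 1 ≤ N i := by exact_mod_cast h1.2
      constructor <;> nlinarith

theorem node_mem_closedBox (hX : ∀ i, 0 < X i) (hN : ∀ i, 1 ≤ N i) (hh : h = steps X N)
    {k : Fin n → ℤ} (hk : k ∈ closedMesh N) : node h k ∈ closedBox X := by
  have := stPoint_node_mem_region (T := 0) (ht := 0) (t := 0) (J' := ∅) hX hN hh (by simp)
    (mem_meshRegion_empty.2 hk) (by simp) (by simp)
  exact fun i _ => (this (some i)).1

theorem node_mem_frontier (hX : ∀ i, 0 < X i) (hN : ∀ i, 1 ≤ N i) (hh : h = steps X N)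
    {k : Fin n → ℤ} (hk : k ∈ boundaryMesh N) : node h k ∈ frontier (box X) := by
  obtain ⟨hk1, hk2⟩ := Finset.mem_sdiff.1 hk
  have hopen : IsOpen (box X) := isOpen_set_pi finite_univ fun i _ => isOpen_Ioo
  rw [frontier, closure_box hX, hopen.interior_eq]
  refine ⟨node_mem_closedBox hX hN hh hk1, fun hbox => hk2 (mem_meshRegion_univ.1 fun i => ?_)⟩
  have hpos : 0 < h i := hh ▸ steps_pos hX hN i
  have hNh : (N i : ℝ) * h i = X i := hh ▸ natCast_mul_steps hN i
  have h1 := hbox i trivial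
  simp only [node, mem_Ioo, ← hNh] at h1
  have h2 : 0 < (k i : ℝ) := pos_of_mul_pos_left h1.1 hpos.le
  have h3 : (k i : ℝ) < N i := lt_of_mul_lt_mul_right h1.2 hpos.le
  have h4 : 0 < k i := by exact_mod_cast h2
  have h5 : k i < N i := by exact_mod_cast h3
  exact ⟨⟨h4.le, h5.le⟩, fun _ => ⟨h4, h5⟩⟩

theorem abs_lam_lam_sample_le (hX : ∀ i, 0 < X i) (hN : ∀ i, 1 ≤ N i) (hh : h = steps X N)
    (hη : ∀ d, 0 < stBox h ht d) {U : (Option (Fin n) → ℝ) → ℝ} (hU : Jet (stBox X T) C 6 U)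
    {t : ℝ} (ht' : t ∈ Icc 0 T) {i j l : Fin n} (hij : i ≠ j) (hil : i ≠ l) (hjl : j ≠ l)
    {k : Fin n → ℤ} (hk : k ∈ meshRegion N {i, j, l}) :
    |lam h i (lam h j (lam h l (sample h U t))) k| ≤ 8 * C := by
  rw [lam_sample h ht, lam_sample h ht, lam_sample h ht]
  have := Jet.abs_sdL_le hη [some i, some j, some l] (by simp [hij, hil, hjl]) hU
    (stPoint (node h k) t)
    (stPoint_node_mem_region hX hN hh (by intro i; simp) hk ht' (by simp))
  norm_num at this
  exact this

theorem abs_lam_lam_sample_sd_le (hX : ∀ i, 0 < X i) (hN : ∀ i, 1 ≤ N i) (hh : h = steps X N)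
    (hη : ∀ d, 0 < stBox h ht d) {U : (Option (Fin n) → ℝ) → ℝ} (hU : Jet (stBox X T) C 6 U)
    {t : ℝ} (ht' : t ∈ Icc ht (T - ht)) {i j : Fin n} (hij : i ≠ j)
    {k : Fin n → ℤ} (hk : k ∈ meshRegion N {i, j}) :
    |lam h i (lam h j (sample h (sd (stBox h ht) none U) t)) k| ≤ 8 * C := by
  have h0 : 0 < ht := hη none
  rw [lam_sample h ht, lam_sample h ht]
  have := Jet.abs_sdL_le hη [some i, some j, none] (by simp [hij]) hU
    (stPoint (node h k) t)
    (stPoint_node_mem_region hX hN hh (by intro i; simp) hk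
      ⟨by linarith [ht'.1], by linarith [ht'.2]⟩ fun _ => ht')
  norm_num at this
  exact this

/-- A forward quotient in time costs one derivative, so five derivatives suffice in all. -/
theorem abs_lam_lam_sample_fdq_le (hX : ∀ i, 0 < X i) (hN : ∀ i, 1 ≤ N i) (hh : h = steps X N)
    (hη : ∀ d, 0 < stBox h ht d) (hC : 0 ≤ C) {U : (Option (Fin n) → ℝ) → ℝ}
    (hU : Jet (stBox X T) C 6 U)
    (htT : ht ≤ T) {i j : Fin n} (hij : i ≠ j)
    {k : Fin n → ℤ} (hk : k ∈ meshRegion N {i, j}) :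
    |lam h i (lam h j (sample h (fdq (stBox h ht) none U) 0)) k| ≤ 8 * C := by
  have h0 : 0 < ht := hη none
  rw [lam_sample h ht, lam_sample h ht, fdq_sd_comm (by simp), fdq_sd_comm (by simp)]
  have := Jet.abs_fdq_sdL_le hη (l := [some i, some j]) (d := none) (by simp [hij]) (by simp)
    (hU.of_le (by simp)) (p := stPoint (node h k) 0)
    (stPoint_node_mem_region hX hN hh (by intro i; simp) hk
      ⟨le_rfl, by linarith⟩ (by simp)) (by simp [stBox, h0.le, htT])
  refine this.trans ?_
  norm_num
  linarith

variable {f g : (Fin n → ℝ) → ℝ → ℝ} {u₀ u₁ : (Fin n → ℝ) → ℝ} {u : (Fin n → ℝ) → ℝ → ℝ}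

theorem Scheme.abs_residual_le (S : Scheme) (hX : ∀ i, 0 < X i) (hT : 0 < T)
    (hf : ContinuousOn (fun p : (Fin n → ℝ) × ℝ => f p.1 p.2) (closedBox X ×ˢ Icc 0 T))
    (hu : IsIBVPSolution a X T f g u₀ u₁ u)
    (hUs : ContDiffOn ℝ 6 (stFun u) (cbox (stBox X T))) (hU : Jet (stBox X T) C 6 (stFun u))
    (hC : 0 ≤ C) (hα : 0 ≤ α) (ha : ∀ i, a i ^ 2 ≤ α) (hN : ∀ i, 1 ≤ N i) (hh : h = steps X N)
    (hη : ∀ d, 0 < stBox h ht d) (hH : ∀ d, stBox h ht d ≤ H)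
    (hht : ∀ l, ht ^ 2 * a l ^ 2 ≤ h l ^ 2) {m : ℕ} (hm : 1 ≤ m) (hmT : ((m : ℝ) + 1) * ht ≤ T)
    {k : Fin n → ℤ} (hk : k ∈ innerMesh N) :
    |polyOp h (S.pPoly a h ht) (lamT ht (onMeshT h ht u) m) k
      + polyOp h (S.aPoly a h) (onMeshT h ht u m) k - rhsN h ht f m k|
      ≤ ((8 ^ n + n * n + n * 8 ^ n) * 8 + n * 8 ^ n * (8 * α)
        + (3 + n + n * α + n * (α * (3 + n)))) * (C * H ^ 4) := by
  have h0 : 0 < ht := hη none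
  have hh0 : ∀ i, 0 < h i := fun i => hη (some i)
  have hhH : ∀ i, h i ≤ H := fun i => hH (some i)
  have hm1 : (1 : ℝ) ≤ m := by exact_mod_cast hm
  have htm : (m : ℝ) * ht ∈ Icc ht (T - ht) := ⟨by nlinarith, by linarith⟩
  have htm' : (m : ℝ) * ht ∈ Icc 0 T := ⟨by linarith [htm.1], by linarith [htm.2]⟩
  have htp : (m : ℝ) * ht + ht ∈ Icc 0 T := ⟨by linarith [htm.1], by linarith [htm.2]⟩
  have htn : (m : ℝ) * ht - ht ∈ Icc 0 T := ⟨by linarith [htm.1], by linarith [htm.2]⟩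
  set U := stFun u with hUdef
  have hkr : k ∈ meshRegion N Finset.univ := mem_meshRegion_univ.2 hk
  have hkc : k ∈ closedMesh N :=
    mem_meshRegion_empty.1 (meshRegion_anti (Finset.empty_subset _) hkr)
  have hf_eq : ∀ {k : Fin n → ℤ}, k ∈ closedMesh N → ∀ {t : ℝ}, t ∈ Icc 0 T →
      f (node h k) t = waveOp a X T U (stPoint (node h k) t) := fun hk _ ht' =>
    hu.rhs_eq hX hT hf (hUs.of_le (by norm_num)) (node_mem_closedBox hX hN hh hk) ht'
  have e1 := S.abs_pPoly_sub_le hh0 hhH hht (N := N) (B := 8 * C) (by positivity)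
    (G := sample h (sd (stBox h ht) none U) (m * ht))
    (fun i j hij k hk => abs_lam_lam_sample_sd_le hX hN hh hη hU htm hij hk) hk
  have e2 := S.abs_aPoly_sub_le (a := a) hh0 hhH (N := N) (B := α * (8 * C)) (by positivity)
    (G := sample h U (m * ht))
    (fun l i j hli hlj hij k hk => abs_mul_le_mul (sq_nonneg _) (ha l)
      (abs_lam_lam_sample_le hX hN hh hη hU htm' hij hli.symm hlj.symm hk)) hk
  have e3 := abs_main_residual_le hC hα hη hH ha hU (p := stPoint (node h k) (m * ht))
    (stPoint_node_mem_region hX hN hh (by simp) hkr htm' fun _ => htm)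
  have hrhs : rhsN h ht f m k = waveOp a X T U (stPoint (node h k) (m * ht))
      + ht ^ 2 / 12 * sd (stBox h ht) none (waveOp a X T U) (stPoint (node h k) (m * ht))
      + ∑ j, h j ^ 2 / 12
        * sd (stBox h ht) (some j) (waveOp a X T U) (stPoint (node h k) (m * ht)) := by
    simp only [rhsN, Pi.add_apply, Pi.smul_apply, smul_eq_mul, Finset.sum_apply]
    congr 1
    · congr 1
      · exact hf_eq hkc htm'
      · rw [lamT_onMeshT h ht f hm]
        simp only [sample, sd, update_stPoint_none, stPoint_none, stFun_stPoint, stBox, Option.elim]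
        rw [hf_eq hkc htp, hf_eq hkc htm', hf_eq hkc htn]
    · refine Finset.sum_congr rfl fun j _ => ?_
      -- `f` is identified with the wave operator on the closed mesh only; at an internal node `Λ_j`
      -- uses no other values.
      rw [lam_congr (J := ∅) (N := N) (by simp) (w := onMeshT h ht f m)
        (w' := sample h (waveOp a X T U) (m * ht))
        (fun k hk => hf_eq (mem_meshRegion_empty.1 hk) htm')
        (meshRegion_anti (Finset.subset_univ _) hkr), lam_sample h ht]
      rfl
  rw [polyOp_aNPoly_apply] at e2
  simp only [lam_sample h ht] at e1 e2
  rw [lamT_onMeshT h ht u hm, ← hUdef, hrhs,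
    show onMeshT h ht u m = sample h U (m * ht) from rfl]
  refine le_trans (le_of_eq (congrArg abs ?_)) (((abs_add_le _ _).trans (add_le_add
    ((abs_add_le _ _).trans (add_le_add e1 e2)) e3)).trans (le_of_eq ?_))
  · simp only [sample]
    ring
  · ring

theorem Scheme.abs_initial_residual_le (S : Scheme) (hX : ∀ i, 0 < X i) (hT : 0 < T)
    (hf : ContinuousOn (fun p : (Fin n → ℝ) × ℝ => f p.1 p.2) (closedBox X ×ˢ Icc 0 T))
    (hu₁ : ContinuousOn u₁ (closedBox X)) (hu : IsIBVPSolution a X T f g u₀ u₁ u)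
    (hUs : ContDiffOn ℝ 6 (stFun u) (cbox (stBox X T))) (hU : Jet (stBox X T) C 6 (stFun u))
    (hC : 0 ≤ C) (hα : 0 ≤ α) (ha : ∀ i, a i ^ 2 ≤ α) (hN : ∀ i, 1 ≤ N i) (hh : h = steps X N)
    (hη : ∀ d, 0 < stBox h ht d) (hH : ∀ d, stBox h ht d ≤ H) (htT : ht ≤ T)
    (hht : ∀ l, ht ^ 2 * a l ^ 2 ≤ h l ^ 2) {K : ℝ} {fd : MeshFn n}
    {k : Fin n → ℤ} (hk : k ∈ innerMesh N)
    (hfd : |fd k - fD0 T ht f (node h k)| ≤ K * ht ^ 3) :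
    |polyOp h (S.pPoly a h ht) (deltaT ht (onMeshT h ht u) 0) k
      + ht / 2 * polyOp h (S.aPoly a h) (onMeshT h ht u 0) k
      - (initN a h ht u₁ k + ht / 2 * rhsN0 h f fd k)|
      ≤ (((8 ^ n + n * n + n * 8 ^ n) * 8 + T * (n * 8 ^ n * (8 * α))
        + (1 + n + T * (n * (α * (3 + n))) + n * α * (1 + T))) * C + |K|) * H ^ 4 := by
  have h0 : 0 < ht := hη none
  have h0H : ht ≤ H := hH none
  have hh0 : ∀ i, 0 < h i := fun i => hη (some i)
  have hhH : ∀ i, h i ≤ H := fun i => hH (some i)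
  have ht00 : (0 : ℝ) ∈ Icc 0 T := ⟨le_rfl, hT.le⟩
  have hUs2 : ContDiffOn ℝ 2 (stFun u) (cbox (stBox X T)) := hUs.of_le (by norm_num)
  set U := stFun u with hUdef
  have hkr : k ∈ meshRegion N Finset.univ := mem_meshRegion_univ.2 hk
  have hkc : k ∈ closedMesh N :=
    mem_meshRegion_empty.1 (meshRegion_anti (Finset.empty_subset _) hkr)
  have hf_eq : ∀ {k : Fin n → ℤ}, k ∈ closedMesh N →
      f (node h k) 0 = waveOp a X T U (stPoint (node h k) 0) := fun hk =>
    hu.rhs_eq hX hT hf hUs2 (node_mem_closedBox hX hN hh hk) ht00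
  have hu₁_eq : ∀ {k : Fin n → ℤ}, k ∈ closedMesh N →
      u₁ (node h k) = partialD (stBox X T) none U (stPoint (node h k) 0) := fun hk =>
    hu.initialVelocity_eq hX hT hu₁ hUs2 (node_mem_closedBox hX hN hh hk)
  have e1 := S.abs_pPoly_sub_le hh0 hhH hht (N := N) (B := 8 * C) (by positivity)
    (G := sample h (fdq (stBox h ht) none U) 0)
    (fun i j hij k hk => abs_lam_lam_sample_fdq_le hX hN hh hη hC hU htT hij hk) hk
  have e2 := S.abs_aPoly_sub_le (a := a) hh0 hhH (N := N) (B := α * (8 * C)) (by positivity)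
    (G := sample h U 0)
    (fun l i j hli hlj hij k hk => abs_mul_le_mul (sq_nonneg _) (ha l)
      (abs_lam_lam_sample_le hX hN hh hη hU ht00 hij hli.symm hlj.symm hk)) hk
  have e3 := CompactWave.abs_initial_residual_le hX hT hC hα hη hH htT ha hU hUs
    (p := stPoint (node h k) 0)
    (stPoint_node_mem_region hX hN hh (by simp) hkr ht00 (by simp)) rfl
  -- The factor `h_t/2` raises the error `K h_t³` of the chosen `fd` to fourth order; `|K|` is used
  -- because the sign of `K` is not prescribed.
  have e4 : |ht / 2 * (fD0 T ht f (node h k) - fd k)| ≤ |K| * H ^ 4 := by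
    rw [abs_mul, abs_sub_comm, abs_of_pos (by positivity)]
    calc ht / 2 * |fd k - fD0 T ht f (node h k)| ≤ ht / 2 * (|K| * ht ^ 3) := by
          gcongr
          refine hfd.trans ?_
          gcongr
          exact le_abs_self K
      _ = |K| * ht ^ 4 / 2 := by ring
      _ ≤ |K| * ht ^ 4 := by linarith [show 0 ≤ |K| * ht ^ 4 by positivity]
      _ ≤ |K| * H ^ 4 := by gcongr
  have hinit : initN a h ht u₁ k = partialD (stBox X T) none U (stPoint (node h k) 0)
      + ∑ i, h i ^ 2 / 12 * sd (stBox h ht) (some i) (partialD (stBox X T) none U)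
          (stPoint (node h k) 0)
      + ht ^ 2 / 12 * ∑ i, a i ^ 2 * sd (stBox h ht) (some i) (partialD (stBox X T) none U)
          (stPoint (node h k) 0) := by
    have hl : ∀ i, lam h i (onMesh h u₁) k = sd (stBox h ht) (some i) (partialD (stBox X T) none U)
          (stPoint (node h k) 0) := fun i => by
      rw [lam_congr (J := ∅) (N := N) (by simp) (w := onMesh h u₁)
        (w' := sample h (partialD (stBox X T) none U) 0)
        (fun k hk => hu₁_eq (mem_meshRegion_empty.1 hk))
        (meshRegion_anti (Finset.subset_univ _) hkr), lam_sample h ht]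
      rfl
    simp only [initN, sN, LinearMap.add_apply, Module.End.one_apply, LinearMap.sum_apply,
      LinearMap.smul_apply, Pi.add_apply, Finset.sum_apply, Pi.smul_apply, smul_eq_mul, hl]
    rw [show onMesh h u₁ k = u₁ (node h k) from rfl, hu₁_eq hkc]
  have hrhs : rhsN0 h f fd k = fd k + ∑ j, h j ^ 2 / 12
        * sd (stBox h ht) (some j) (waveOp a X T U) (stPoint (node h k) 0) := by
    simp only [rhsN0, Pi.add_apply, Pi.smul_apply, smul_eq_mul, Finset.sum_apply]
    congr 1
    refine Finset.sum_congr rfl fun j _ => ?_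
    rw [lam_congr (J := ∅) (N := N) (by simp) (w := onMesh h fun x => f x 0)
      (w' := sample h (waveOp a X T U) 0)
      (fun k hk => hf_eq (mem_meshRegion_empty.1 hk))
      (meshRegion_anti (Finset.subset_univ _) hkr), lam_sample h ht]
    rfl
  have e2' := abs_mul_le_mul (c := ht / 2) (by positivity) (by linarith : ht / 2 ≤ T) e2
  rw [polyOp_aNPoly_apply] at e2'
  simp only [lam_sample h ht] at e1 e2'
  have hfD := hu.fD0_eq hX hT hf hUs2 (node_mem_closedBox hX hN hh hkc) ht
  rw [hfD] at e4
  rw [deltaT_onMeshT, ← hUdef, hrhs, hinit,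
    show onMeshT h ht u 0 = sample h U 0 by funext k; simp [onMeshT, sample, hUdef]]
  refine le_trans (le_of_eq (congrArg abs ?_)) (((abs_add_le _ _).trans (add_le_add
    ((abs_add_le _ _).trans (add_le_add ((abs_add_le _ _).trans (add_le_add e1 e2')) e3))
      e4)).trans (le_of_eq ?_))
  · simp only [sample]
    ring
  · ring

end Residual

end

end CompactWave

namespace CompactWave

noncomputable section

open MvPolynomial

variable {n : ℕ}

/-! ### The error estimate -/

theorem norm_resFn_le {N : Fin n → ℕ} {w : MeshFn n} {b : ℝ} (hb : 0 ≤ b)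
    (hw : ∀ k ∈ innerMesh N, |w k| ≤ b) : ‖resFn N w‖ ≤ √((innerMesh N).card) * b := by
  have h1 : ‖resFn N w‖ ^ 2 ≤ (√((innerMesh N).card) * b) ^ 2 := by
    rw [← real_inner_self_eq_norm_sq, inner_resFn, mul_pow, Real.sq_sqrt (by positivity),
      ← nsmul_eq_mul]
    refine Finset.sum_le_card_nsmul _ _ _ fun k hk => ?_
    rw [← pow_two, ← sq_abs]
    exact pow_le_pow_left₀ (abs_nonneg _) (hw k hk) 2
  exact le_of_sq_le_sq h1 (by positivity)

/-- The mesh norm of a bounded function is thereby controlled uniformly in the mesh. -/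
theorem prod_steps_mul_card_le {X : Fin n → ℝ} {N : Fin n → ℕ} (hX : ∀ i, 0 < X i)
    (hN : ∀ i, 1 ≤ N i) : (∏ i, steps X N i) * (innerMesh N).card ≤ ∏ i, X i := by
  have hcard : (innerMesh N).card ≤ ∏ i, N i := by
    rw [innerMesh, Pi.card_Icc]
    refine Finset.prod_le_prod' fun i _ => ?_
    rw [Int.card_Icc]
    omega
  calc (∏ i, steps X N i) * (innerMesh N).card ≤ (∏ i, steps X N i) * ∏ i, (N i : ℝ) := by
        gcongr
        · exact Finset.prod_nonneg fun i _ => (steps_pos hX hN i).le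
        · exact_mod_cast hcard
    _ = ∏ i, X i := by
        rw [← Finset.prod_mul_distrib]
        exact Finset.prod_congr rfl fun i _ => by rw [mul_comm, natCast_mul_steps hN i]

theorem opNorm_polyOp_sq {h : Fin n → ℝ} (hh : ∀ i, 0 < h i) {N : Fin n → ℕ}
    {q : MvPolynomial (Fin n) ℝ} (hq : q ∈ compatible h N)
    (hpos : ∀ v : InnerFn N, 0 ≤ inner ℝ (polyInner h N q v) v) {w : MeshFn n}
    (hw : ∀ k ∈ boundaryMesh N, w k = 0) :
    opNorm h N (polyOp h q) w ^ 2
      = (∏ i, h i) * inner ℝ (polyInner h N q (resFn N w)) (resFn N w) := by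
  have h1 : meshInner h N (polyOp h q w) w
      = (∏ i, h i) * inner ℝ (polyInner h N q (resFn N w)) (resFn N w) := by
    rw [meshInner, ← inner_resFn, hq w hw]
  rw [opNorm, Real.sq_sqrt, h1]
  rw [h1]
  exact mul_nonneg (Finset.prod_nonneg fun i _ => (hh i).le) (hpos _)

theorem Scheme.one_le_C0 (S : Scheme) : 1 ≤ S.C0 := by
  cases S <;> norm_num [Scheme.C0]

theorem Scheme.pos_of_admissible {S : Scheme} (hS : S.Admissible n) : 0 < n := by
  cases S <;> simp only [Scheme.Admissible] at hS <;> omega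

/-- Stability of the schemes: a bound of the error in the energy norm by the residual. -/
theorem Scheme.energy_norm_le {S : Scheme} (hS : S.Admissible n) {a h : Fin n → ℝ} {N : Fin n → ℕ}
    {M : ℕ} {ht ε₀ b : ℝ} (hh : ∀ i, 0 < h i) (ht0 : 0 < ht) (hε₀ : 0 < ε₀) (hb : 0 ≤ b)
    (hcond : S.C0 * ht ^ 2 * ∑ i, a i ^ 2 / h i ^ 2 ≤ 1 - ε₀ ^ 2) (e : ℕ → MeshFn n)
    (he0 : ∀ k ∈ innerMesh N, e 0 k = 0) (hbd : ∀ m ≤ M, ∀ k ∈ boundaryMesh N, e m k = 0)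
    (hinit : ∀ k ∈ innerMesh N, |polyOp h (S.pPoly a h ht) (deltaT ht e 0) k| ≤ b)
    (hstep : ∀ m, 1 ≤ m → m + 1 ≤ M → ∀ k ∈ innerMesh N,
      |polyOp h (S.pPoly a h ht) (lamT ht e m) k + polyOp h (S.aPoly a h) (e m) k| ≤ b)
    {m : ℕ} (hm : 1 ≤ m) (hmM : m ≤ M) :
    ε₀ ^ 2 * opNorm h N (S.normB a h ht) (deltaBarT ht e m) ^ 2
        + opNorm h N (S.normA a h) (sBarT e m) ^ 2
      ≤ (∏ i, h i) * (innerMesh N).card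
        * (b / (ε₀ * (1 / 3) ^ n) * (1 + ((m : ℝ) - 1) * ht)) ^ 2 := by
  set A := polyInner h N (S.aPoly a h) with hA
  set B := polyInner h N (S.bPoly a h ht) with hB
  -- As `1/12 + 1/6 = 1/4`, this choice makes `D + (h_t²/4) A` equal to `P`.
  set D := polyInner h N (S.bPoly a h ht - (ht ^ 2 / 6) • S.aPoly a h) with hD
  have hc : 0 < ε₀ * (1 / 3 : ℝ) ^ n := by positivity
  have hsc : ∀ γ : Fin n → ℝ, (∀ l, -4 ≤ h l ^ 2 * γ l ∧ h l ^ 2 * γ l ≤ 0) →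
      ε₀ ^ 2 * eval γ (S.bPoly a h ht)
        ≤ eval γ (S.bPoly a h ht - (ht ^ 2 / 6) • S.aPoly a h) := by
    intro γ hγ
    have h1 := S.eval_aPoly_le (a := a) (ht := ht) hS hh hγ
    have h2 := S.eval_bPoly_ge (a := a) (ht := ht) hS hh hγ
    have h3 : 0 ≤ eval γ (S.bPoly a h ht) := le_trans (by positivity) h2
    rw [map_sub, smul_eval]
    have h4 := mul_le_mul_of_nonneg_left h1 (by positivity : 0 ≤ ht ^ 2 / 6)
    have h5 := mul_le_mul_of_nonneg_right hcond h3
    linarith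
  have hApos : ∀ v, 0 ≤ inner ℝ (A v) v :=
    inner_polyInner_nonneg hh N fun γ hγ => S.eval_aPoly_nonneg hS hh hγ
  have hBpos : ∀ v, 0 ≤ inner ℝ (B v) v :=
    inner_polyInner_nonneg hh N fun γ hγ =>
      le_trans (by positivity) (S.eval_bPoly_ge hS hh hγ)
  have hDB : ∀ v, ε₀ ^ 2 * inner ℝ (B v) v ≤ inner ℝ (D v) v := fun v => by
    have := inner_polyInner_nonneg hh N (q := (S.bPoly a h ht - (ht ^ 2 / 6) • S.aPoly a h)
      - ε₀ ^ 2 • S.bPoly a h ht) (fun γ hγ => by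
        rw [map_sub, smul_eval]
        linarith [hsc γ hγ]) v
    rw [map_sub, map_smul, LinearMap.sub_apply, LinearMap.smul_apply, inner_sub_left,
      inner_smul_left, RCLike.conj_to_real, ← hD, ← hB] at this
    linarith
  have hBge : ∀ v, (1 / 3 : ℝ) ^ n * ‖v‖ ^ 2 ≤ inner ℝ (B v) v := fun v => by
    have := inner_polyInner_nonneg hh N (q := S.bPoly a h ht - (1 / 3 : ℝ) ^ n • 1)
      (fun γ hγ => by
        rw [map_sub, smul_eval, map_one, mul_one]
        linarith [S.eval_bPoly_ge (a := a) (ht := ht) hS hh hγ]) v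
    rw [map_sub, map_smul, map_one, LinearMap.sub_apply, LinearMap.smul_apply,
      Module.End.one_apply, inner_sub_left, inner_smul_left, RCLike.conj_to_real,
      real_inner_self_eq_norm_sq, ← hB] at this
    linarith
  -- The energy estimate asks for a square as coercivity constant; since `(1/3)^n ≤ 1`, squaring it
  -- only weakens the bound.
  have hDge : ∀ v, (ε₀ * (1 / 3 : ℝ) ^ n) ^ 2 * ‖v‖ ^ 2 ≤ inner ℝ (D v) v := fun v => by
    have h1 : ((1 / 3 : ℝ) ^ n) ^ 2 ≤ (1 / 3 : ℝ) ^ n := by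
      rw [pow_two]
      exact mul_le_of_le_one_left (by positivity) (pow_le_one₀ (by norm_num) (by norm_num))
    calc (ε₀ * (1 / 3 : ℝ) ^ n) ^ 2 * ‖v‖ ^ 2
        = ε₀ ^ 2 * (((1 / 3 : ℝ) ^ n) ^ 2 * ‖v‖ ^ 2) := by ring
      _ ≤ ε₀ ^ 2 * ((1 / 3 : ℝ) ^ n * ‖v‖ ^ 2) := by gcongr
      _ ≤ ε₀ ^ 2 * inner ℝ (B v) v := by gcongr; exact hBge v
      _ ≤ _ := hDB v
  have hP : D + (ht ^ 2 / 4) • A = polyInner h N (S.pPoly a h ht) := by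
    rw [hD, hA, ← map_smul, ← map_add, S.pPoly_eq]
    congr 1
    module
  have hlamT : ∀ j, resFn N (lamT ht e (j + 1))
      = (ht ^ 2)⁻¹ • (resFn N (e (j + 2)) - (2 : ℝ) • resFn N (e (j + 1)) + resFn N (e j)) := by
    intro j
    ext k
    simp only [resFn_apply, lamT, PiLp.smul_apply, PiLp.add_apply, PiLp.sub_apply, smul_eq_mul,
      add_tsub_cancel_right]
    ring
  have hdelta : ∀ j, resFn N (deltaT ht e j)
      = ht⁻¹ • (resFn N (e (j + 1)) - resFn N (e j)) := by
    intro j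
    ext k
    simp only [resFn_apply, deltaT, PiLp.smul_apply, PiLp.sub_apply, smul_eq_mul]
    ring
  have hsbar : ∀ j, resFn N (sBarT e (j + 1))
      = (2 : ℝ)⁻¹ • (resFn N (e j) + resFn N (e (j + 1))) := by
    intro j
    ext k
    simp only [resFn_apply, sBarT, PiLp.smul_apply, PiLp.add_apply, smul_eq_mul,
      add_tsub_cancel_right]
    ring
  obtain ⟨j, rfl⟩ : ∃ j, m = j + 1 := ⟨m - 1, by omega⟩
  have hE := energy_le (polyInner_isSymmetric h N _) (polyInner_isSymmetric h N _)
    (τ := ht) (c := ε₀ * (1 / 3 : ℝ) ^ n) (Ψ := √((innerMesh N).card) * b) ht0 hc (by positivity)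
    hDge hApos (fun m => resFn N (e m)) M (by ext k; exact he0 k k.2)
    (by
      rw [← hdelta 0, ← hD, ← hA, hP, ← S.pPoly_mem a h ht N _ fun k hk => ?_]
      · exact norm_resFn_le hb hinit
      · simp [deltaT, hbd 0 (by omega) k hk, hbd 1 (by omega) k hk])
    (fun j hj => by
      rw [← hlamT j, ← hD, ← hA, hP, hA, ← S.pPoly_mem a h ht N _ fun k hk => ?_,
        ← S.aPoly_mem a h N _ (hbd (j + 1) (by omega)), ← map_add]
      · exact norm_resFn_le hb (hstep (j + 1) (by omega) hj)
      · simp [lamT, hbd (j + 2) (by omega) k hk, hbd (j + 1) (by omega) k hk,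
          hbd j (by omega) k hk])
    j hmM
  have hdb : deltaBarT ht e (j + 1) = deltaT ht e j := rfl
  rw [hdb, S.normB_eq, S.normA_eq,
    opNorm_polyOp_sq hh (S.bPoly_mem a h ht N) hBpos (fun k hk => by
      simp [deltaT, hbd j (by omega) k hk, hbd (j + 1) (by omega) k hk]),
    opNorm_polyOp_sq hh (S.aPoly_mem a h N) hApos (fun k hk => by
      simp [sBarT, hbd j (by omega) k hk, hbd (j + 1) (by omega) k hk]), hdelta, hsbar]
  have hprod : 0 ≤ ∏ i, h i := Finset.prod_nonneg fun i _ => (hh i).le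
  have h1 := hDB (ht⁻¹ • (resFn N (e (j + 1)) - resFn N (e j)))
  calc _ = (∏ i, h i) * (ε₀ ^ 2 * inner ℝ (B (ht⁻¹ • (resFn N (e (j + 1)) - resFn N (e j))))
          (ht⁻¹ • (resFn N (e (j + 1)) - resFn N (e j)))
        + inner ℝ (A ((2 : ℝ)⁻¹ • (resFn N (e j) + resFn N (e (j + 1)))))
          ((2 : ℝ)⁻¹ • (resFn N (e j) + resFn N (e (j + 1))))) := by ring
    _ ≤ (∏ i, h i) * (√((innerMesh N).card) * b / (ε₀ * (1 / 3) ^ n) * (1 + j * ht)) ^ 2 := by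
        refine mul_le_mul_of_nonneg_left ?_ hprod
        linarith
    _ = _ := by
        rw [mul_div_assoc, mul_assoc, mul_pow, Real.sq_sqrt (by positivity)]
        push_cast
        ring

end

end CompactWave

/-! ### The fourth-order error bound. -/

open CompactWave in
theorem mainTheorem2 {n : ℕ} (S : Scheme) (hS : S.Admissible n)
    (a X : Fin n → ℝ) (T : ℝ) (ha : ∀ i, 0 < a i) (hX : ∀ i, 0 < X i) (hT : 0 < T)
    (f g : (Fin n → ℝ) → ℝ → ℝ) (u₀ u₁ : (Fin n → ℝ) → ℝ) (u : (Fin n → ℝ) → ℝ → ℝ)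
    -- the data are continuous up to the boundary, where the schemes use their values
    (hf : ContinuousOn (fun p : (Fin n → ℝ) × ℝ => f p.1 p.2) (closedBox X ×ˢ Set.Icc 0 T))
    (hg : ContinuousOn (fun p : (Fin n → ℝ) × ℝ => g p.1 p.2)
      (frontier (box X) ×ˢ Set.Icc 0 T))
    (hu₀ : ContinuousOn u₀ (closedBox X)) (hu₁ : ContinuousOn u₁ (closedBox X))
    (husmooth : ContDiffOn ℝ 6 (fun p : (Fin n → ℝ) × ℝ => u p.1 p.2)
      (closedBox X ×ˢ Set.Icc 0 T))
    (hu : IsIBVPSolution a X T f g u₀ u₁ u)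
    (ε₀ : ℝ) (hε₀ : 0 < ε₀) (hε₀' : ε₀ < 1) (K : ℝ) :
    ∃ C : ℝ, ∀ (N : Fin n → ℕ) (M : ℕ) (h : Fin n → ℝ) (ht : ℝ)
      (fd : MeshFn n) (v : ℕ → MeshFn n),
      (∀ i, 1 ≤ N i) → 2 ≤ M → h = steps X N → ht = T / (M : ℝ) →
      S.C0 * ht ^ 2 * ∑ i, a i ^ 2 / h i ^ 2 ≤ 1 - ε₀ ^ 2 →
      (∀ k ∈ innerMesh N, |fd k - fD0 T ht f (node h k)| ≤ K * ht ^ 3) →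
      (∀ k ∈ closedMesh N, v 0 k = u₀ (node h k)) →
      S.IsSolution a h ht N M f g u₁ fd v →
      ∀ m : ℕ, 1 ≤ m → m ≤ M →
        Real.sqrt
          (ε₀ ^ 2 * opNorm h N (S.normB a h ht) (deltaBarT ht (onMeshT h ht u - v) m) ^ 2
            + opNorm h N (S.normA a h) (sBarT (onMeshT h ht u - v) m) ^ 2)
          ≤ C * stepLength h ^ 4 := by
  have hUs : ContDiffOn ℝ 6 (stFun u) (cbox (stBox X T)) := contDiffOn_stFun husmooth
  obtain ⟨C₁, hC₁⟩ := exists_jet (stBox_pos hX hT) 6 (by exact_mod_cast hUs)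
  obtain ⟨C, hC0, hU⟩ : ∃ C, 0 ≤ C ∧ Jet (stBox X T) C 6 (stFun u) :=
    ⟨|C₁|, abs_nonneg _, hC₁.mono (le_abs_self _)⟩
  obtain ⟨i₀⟩ : Nonempty (Fin n) := ⟨⟨0, S.pos_of_admissible hS⟩⟩
  set α := ∑ i, a i ^ 2 with hα
  have hα0 : 0 ≤ α := Finset.sum_nonneg fun i _ => sq_nonneg _
  have haα : ∀ i, a i ^ 2 ≤ α := fun i =>
    Finset.single_le_sum (f := fun i => a i ^ 2) (fun i _ => sq_nonneg _) (Finset.mem_univ i)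
  -- The step condition implies `h_t ≤ h_{i₀} / a_{i₀}`, so `κ |h|` dominates all steps, including
  -- the time step.
  set κ := 1 + 1 / a i₀ with hκ
  have hκ1 : 1 ≤ κ := by
    have := ha i₀
    rw [hκ]
    linarith [show 0 < 1 / a i₀ by positivity]
  set K₁ := ((8 ^ n + n * n + n * 8 ^ n) * 8 + n * 8 ^ n * (8 * α)
    + (3 + n + n * α + n * (α * (3 + n)))) * C with hK₁
  set K₂ := ((8 ^ n + n * n + n * 8 ^ n) * 8 + T * (n * 8 ^ n * (8 * α))
    + (1 + n + T * (n * (α * (3 + n))) + n * α * (1 + T))) * C + |K| with hK₂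
  have hK₁0 : 0 ≤ K₁ := by positivity
  have hK₂0 : 0 ≤ K₂ := by positivity
  have hκ0 : 0 ≤ κ := zero_le_one.trans hκ1
  clear_value K₁ K₂ κ α
  refine ⟨√(∏ i, X i) * ((K₁ + K₂) * κ ^ 4 / (ε₀ * (1 / 3) ^ n) * (1 + T)), ?_⟩
  intro N M h ht fd v hN hM hh hht hcond hfd hv0 hsol m hm hmM
  have hM0 : (0 : ℝ) < M := by exact_mod_cast (by omega : 0 < M)
  have ht0 : 0 < ht := hht ▸ div_pos hT hM0
  have hMT : (M : ℝ) * ht = T := by rw [hht]; field_simp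
  have hh0 : ∀ i, 0 < h i := fun i => hh ▸ steps_pos hX hN i
  have hη : ∀ d, 0 < stBox h ht d := stBox_pos hh0 ht0
  have hlen : ∀ i, h i ≤ stepLength h := fun i => by
    refine Real.le_sqrt_of_sq_le ?_
    exact Finset.single_le_sum (f := fun i => h i ^ 2) (fun i _ => sq_nonneg _) (Finset.mem_univ i)
  have hlen0 : 0 ≤ stepLength h := Real.sqrt_nonneg _
  -- A single term of the sum in the step condition, together with `C_0 ≥ 1`.
  have hcfl : ∀ l, ht ^ 2 * a l ^ 2 ≤ h l ^ 2 := fun l => by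
    have hsum0 : 0 ≤ ∑ i, a i ^ 2 / h i ^ 2 := Finset.sum_nonneg fun i _ => by positivity
    have h1 : a l ^ 2 / h l ^ 2 ≤ ∑ i, a i ^ 2 / h i ^ 2 :=
      Finset.single_le_sum (f := fun i => a i ^ 2 / h i ^ 2) (fun i _ => by positivity)
        (Finset.mem_univ l)
    have h2 : ht ^ 2 * ∑ i, a i ^ 2 / h i ^ 2 ≤ 1 := by
      have h3 : 1 * (ht ^ 2 * ∑ i, a i ^ 2 / h i ^ 2) ≤ S.C0 * (ht ^ 2 * ∑ i, a i ^ 2 / h i ^ 2) :=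
        mul_le_mul_of_nonneg_right S.one_le_C0 (by positivity)
      linarith [sq_nonneg ε₀]
    have h4 : ht ^ 2 * (a l ^ 2 / h l ^ 2) ≤ 1 :=
      (mul_le_mul_of_nonneg_left h1 (sq_nonneg _)).trans h2
    rwa [← mul_div_assoc, div_le_one (pow_pos (hh0 l) 2)] at h4
  set H := κ * stepLength h with hHdef
  have hH : ∀ d, stBox h ht d ≤ H := by
    rintro (_ | i)
    · have h1 : ht * a i₀ ≤ stepLength h :=
        (le_of_sq_le_sq (by rw [mul_pow]; exact hcfl i₀) (hh0 i₀).le).trans (hlen i₀)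
      have h2 : ht ≤ 1 / a i₀ * stepLength h := by
        rw [one_div_mul_eq_div, le_div_iff₀ (ha i₀)]
        exact h1
      change ht ≤ H
      rw [hHdef, hκ, add_mul]
      linarith
    · change h i ≤ H
      rw [hHdef]
      nlinarith [hlen i]
  have hH0 : 0 ≤ H := ht0.le.trans (hH none)
  have htT : ht ≤ T := by
    rw [← hMT]
    have : (1 : ℝ) ≤ M := by exact_mod_cast (by omega : 1 ≤ M)
    nlinarith
  have hUc : ContinuousOn (stFun u) (cbox (stBox X T)) := hUs.continuousOn
  set e : ℕ → MeshFn n := onMeshT h ht u - v with he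
  have he0 : ∀ k ∈ closedMesh N, e 0 k = 0 := fun k hk => by
    simp only [he, Pi.sub_apply, onMeshT, hv0 k hk, Nat.cast_zero, zero_mul,
      hu.initial_eq hX hT hu₀ hUc (node_mem_closedBox hX hN hh hk), sub_self]
  have hinner : ∀ k ∈ innerMesh N, k ∈ closedMesh N := fun k hk =>
    mem_meshRegion_empty.1 (meshRegion_anti (Finset.empty_subset _) (mem_meshRegion_univ.2 hk))
  -- The scheme prescribes boundary values only for `m ≥ 1`; at `m = 0` the error vanishes because
  -- `v⁰ = u₀` on the closed mesh.
  have hbd : ∀ m ≤ M, ∀ k ∈ boundaryMesh N, e m k = 0 := fun m hm k hk => by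
    have hkc : k ∈ closedMesh N := (Finset.mem_sdiff.1 hk).1
    rcases Nat.eq_zero_or_pos m with rfl | hm0
    · exact he0 k hkc
    · have htm : (m : ℝ) * ht ∈ Set.Icc 0 T := by
        refine ⟨by positivity, ?_⟩
        rw [← hMT]
        gcongr
      simp only [he, Pi.sub_apply, onMeshT, hsol.boundary m hm0 hm k hk,
        hu.boundary_eq hT hg hUc (node_mem_closedBox hX hN hh hkc)
          (node_mem_frontier hX hN hh hk) htm, sub_self]
  have hb0 : 0 ≤ (K₁ + K₂) * H ^ 4 := by positivity
  have hinit : ∀ k ∈ innerMesh N,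
      |polyOp h (S.pPoly a h ht) (deltaT ht e 0) k| ≤ (K₁ + K₂) * H ^ 4 := by
    intro k hk
    have h1 := S.abs_initial_residual_le hX hT hf hu₁ hu hUs hU hC0 hα0 haα hN hh hη hH htT hcfl hk
      (hfd k hk)
    rw [← hsol.initial k hk, S.opP_eq hS, S.opA_eq hS, ← hK₂] at h1
    -- The initial error is zero on the closed mesh, so the term with `A` drops out and the initial
    -- residual is `P δ_t e⁰`.
    have h2 : polyOp h (S.aPoly a h) (e 0) k = 0 := by
      have h3 := congrArg (fun y : InnerFn N => y ⟨k, hk⟩)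
        (S.aPoly_mem a h N (e 0) (hbd 0 (by omega)))
      have h4 : resFn N (e 0) = 0 := by
        ext k
        exact he0 k (hinner k k.2)
      simpa only [h4, map_zero, resFn_apply, PiLp.zero_apply] using h3
    have h5 : deltaT ht e 0 = deltaT ht (onMeshT h ht u) 0 - deltaT ht v 0 := by
      funext k
      simp only [deltaT, he, Pi.sub_apply]
      ring
    have h6 : e 0 = onMeshT h ht u 0 - v 0 := rfl
    rw [h6, map_sub, Pi.sub_apply] at h2
    rw [h5, map_sub, Pi.sub_apply]
    refine le_trans (le_of_eq (congrArg abs ?_)) (h1.trans ?_)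
    · linear_combination (-(ht / 2)) * h2
    · rw [add_mul]
      linarith [show 0 ≤ K₁ * H ^ 4 by positivity]
  have hstep : ∀ m, 1 ≤ m → m + 1 ≤ M → ∀ k ∈ innerMesh N,
      |polyOp h (S.pPoly a h ht) (lamT ht e m) k + polyOp h (S.aPoly a h) (e m) k|
        ≤ (K₁ + K₂) * H ^ 4 := by
    intro m hm hmM k hk
    have hmT : ((m : ℝ) + 1) * ht ≤ T := by
      rw [← hMT]
      gcongr
      exact_mod_cast hmM
    have h1 := S.abs_residual_le hX hT hf hu hUs hU hC0 hα0 haα hN hh hη hH hcfl hm hmT hk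
    rw [← hsol.eqn m hm hmM k hk, S.opP_eq hS, S.opA_eq hS, ← mul_assoc, ← hK₁] at h1
    have h5 : lamT ht e m = lamT ht (onMeshT h ht u) m - lamT ht v m := by
      funext k
      simp only [lamT, he, Pi.sub_apply]
      ring
    have h6 : e m = onMeshT h ht u m - v m := rfl
    rw [h5, h6, map_sub, map_sub, Pi.sub_apply, Pi.sub_apply]
    refine le_trans (le_of_eq (congrArg abs ?_)) (h1.trans ?_)
    · ring
    · rw [add_mul]
      linarith [show 0 ≤ K₂ * H ^ 4 by positivity]
  have hfin := S.energy_norm_le hS hh0 ht0 hε₀ hb0 hcond e (fun k hk => he0 k (hinner k hk)) hbd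
    hinit hstep hm hmM
  have hm1 : (1 : ℝ) ≤ m := by exact_mod_cast hm
  have hmT : ((m : ℝ) - 1) * ht ≤ T := by
    rw [← hMT]
    have : (m : ℝ) ≤ M := by exact_mod_cast hmM
    gcongr
    linarith
  have hm0 : 0 ≤ ((m : ℝ) - 1) * ht := mul_nonneg (by linarith) ht0.le
  have hXp : 0 ≤ ∏ i, X i := Finset.prod_nonneg fun i _ => (hX i).le
  refine Real.sqrt_le_iff.2 ⟨by positivity, hfin.trans ?_⟩
  calc (∏ i, h i) * (innerMesh N).card
        * ((K₁ + K₂) * H ^ 4 / (ε₀ * (1 / 3) ^ n) * (1 + ((m : ℝ) - 1) * ht)) ^ 2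
      ≤ (∏ i, X i) * ((K₁ + K₂) * H ^ 4 / (ε₀ * (1 / 3) ^ n) * (1 + T)) ^ 2 := by
        gcongr
        rw [hh]
        exact prod_steps_mul_card_le hX hN
    _ = _ := by
        rw [hHdef]
        nth_rewrite 1 [← Real.sq_sqrt hXp]
        ring
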